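/- For a real-valued $V:\mathbb{R}\to\mathbb{R}$ with $V\in L^p(\mathbb{R})$ for some $p\in[2,\infty]$, let $H=-\frac{d^2}{dx^2}+V$ be the Schrödinger operator on $L^2(\mathbb{R})$ with domain the Sobolev space $H^2(\mathbb{R})$, let $(\mu_j)_j$ be its negative eigenvalues, repeated according to multiplicity, and let $V(x)_-=(|V(x)|-V(x))/2$. For $\gamma\ge\frac32$ put $$L^{\mathrm{cl}}_{\gamma,1}=(4\pi)^{-1/2}\,\frac{\Gamma(\gamma+1)}{\Gamma(\gamma+\frac32)}.$$ Then for every $\gamma\ge\frac32$ and every such $V$, $$\sum_j|\mu_j|^{\gamma}\le L^{\mathrm{cl}}_{\gamma,1}\int_{\mathbb{R}}V(x)_-^{\gamma+\frac12}\,dx ,$$ where both sides are allowed to be $+\infty$. In particular, for $\gamma=\frac32$ and $V\in L^2(\mathbb{R})$, $\sum_j|\mu_j|^{3/2}\le L^{\mathrm{cl}}_{3/2,1}\int_{\mathbb{R}}V(x)_-^{2}\,dx$. The inequality is sharp: if $\gamma\ge\frac32$ and $L\in\mathbb{R}$ is such that $\sum_j|\mu_j|^{\gamma}\le L\int_{\mathbb{R}}V(x)_-^{\gamma+1/2}\,dx$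 for all real-valued $V\in L^{\gamma+1/2}(\mathbb{R})$ with $\lim_{|x|\to\infty}V(x)=0$, then $L^{\mathrm{cl}}_{\gamma,1}\le L$. -/

import Mathlib

open MeasureTheory Filter Topology
open scoped ENNReal SchwartzMap LineDeriv

noncomputable section

namespace LiebThirring

/-- The Hilbert space `L²(ℝ)` of complex-valued functions. -/
abbrev L2 : Type := Lp ℂ 2 (volume : Measure ℝ)

/-- The distribution defined by an `L²` function determines that function. -/
theorem toTemperedDistribution_injective :
    Function.Injective (fun f : L2 ↦ (f : 𝓢'(ℝ, ℂ))) := by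
  have h := Lp.ker_toTemperedDistributionCLM_eq_bot (F := ℂ) (μ := (volume : Measure ℝ)) (p := 2)
  intro f g hfg
  exact LinearMap.ker_eq_bot.mp h hfg

/-- The Sobolev space `H²(ℝ)`, as a subspace of `L²(ℝ)`. -/
def sobolevH2 : Submodule ℂ L2 where
  carrier := {f | TemperedDistribution.MemSobolev 2 2 (f : 𝓢'(ℝ, ℂ))}
  add_mem' {f g} hf hg := by
    have h := TemperedDistribution.MemSobolev.add hf hg
    simp only [← Lp.toTemperedDistributionCLM_apply, ← map_add] at h
    exact h
  zero_mem' := by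
    have h := TemperedDistribution.memSobolev_fun_zero ℝ ℂ 2 2
    rw [← map_zero (Lp.toTemperedDistributionCLM ℂ (volume : Measure ℝ) 2)] at h
    exact h
  smul_mem' c f hf := by
    have h := TemperedDistribution.MemSobolev.smul c hf
    simp only [← Lp.toTemperedDistributionCLM_apply, ← map_smul] at h
    exact h

/-- The second distributional derivative of a function in `H²(ℝ)` is a function in `L²(ℝ)`. -/
theorem exists_secondDeriv (f : sobolevH2) :
    ∃ g : L2, ∂_{(1 : ℝ)} (∂_{(1 : ℝ)} ((f : L2) : 𝓢'(ℝ, ℂ))) = (g : 𝓢'(ℝ, ℂ)) := by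
  have hf : TemperedDistribution.MemSobolev 2 2 ((f : L2) : 𝓢'(ℝ, ℂ)) := f.2
  have h := (hf.lineDerivOp (m := (1 : ℝ))).lineDerivOp (m := (1 : ℝ))
  rw [show (2 - 1 - 1 : ℝ) = 0 by norm_num] at h
  exact TemperedDistribution.memSobolev_zero_iff.mp h

/-- The weak second derivative `f''` of `f ∈ H²(ℝ)`, as an element of `L²(ℝ)`. -/
def secondDeriv (f : sobolevH2) : L2 := (exists_secondDeriv f).choose

theorem secondDeriv_spec (f : sobolevH2) :
    (secondDeriv f : 𝓢'(ℝ, ℂ)) = ∂_{(1 : ℝ)} (∂_{(1 : ℝ)} ((f : L2) : 𝓢'(ℝ, ℂ))) :=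
  (exists_secondDeriv f).choose_spec.symm

/-- The free operator `-d²/dx²` on `L²(ℝ)` with domain `H²(ℝ)`. -/
def freeOperator : L2 →ₗ.[ℂ] L2 where
  domain := sobolevH2
  toFun :=
    { toFun := fun f ↦ -secondDeriv f
      map_add' := fun f g ↦ by
        rw [← neg_add, neg_inj]
        apply toTemperedDistribution_injective
        have hf := secondDeriv_spec f
        have hg := secondDeriv_spec g
        have hfg := secondDeriv_spec (f + g)
        simp only [← Lp.toTemperedDistributionCLM_apply, Submodule.coe_add, map_add] at hf hg hfg ⊢
        rw [hfg, hf, hg, LineDeriv.lineDerivOp_add, LineDeriv.lineDerivOp_add]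
      map_smul' := fun c f ↦ by
        rw [RingHom.id_apply, smul_neg, neg_inj]
        apply toTemperedDistribution_injective
        have hf := secondDeriv_spec f
        have hcf := secondDeriv_spec (c • f)
        simp only [← Lp.toTemperedDistributionCLM_apply, Submodule.coe_smul, map_smul] at hf hcf ⊢
        rw [hcf, hf, LineDeriv.lineDerivOp_smul, LineDeriv.lineDerivOp_smul] }

/-- Multiplication by a real function `V` on `L²(ℝ)`, on its maximal domain
`{f ∈ L²(ℝ) : V f ∈ L²(ℝ)}`. -/
def mulOperator (V : ℝ → ℝ) : L2 →ₗ.[ℂ] L2 where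
  domain :=
    { carrier := {f | MemLp (fun x ↦ (V x : ℂ) * f x) 2 volume}
      add_mem' := fun {f g} hf hg ↦ by
        refine (memLp_congr_ae ?_).mp (MemLp.add hf hg)
        filter_upwards [Lp.coeFn_add f g] with x hx
        simp only [Pi.add_apply]
        rw [hx, Pi.add_apply, mul_add]
      zero_mem' := by
        refine (memLp_congr_ae ?_).mp (MemLp.zero (ε := ℂ) (p := 2) (μ := (volume : Measure ℝ)))
        filter_upwards with x
        simp
      smul_mem' := fun c f hf ↦ by
        refine (memLp_congr_ae ?_).mp (MemLp.const_smul hf c)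
        filter_upwards [Lp.coeFn_smul c f] with x hx
        simp [hx, mul_left_comm] }
  toFun :=
    { toFun := fun f ↦ MemLp.toLp (fun x ↦ (V x : ℂ) * (f : L2) x) f.2
      map_add' := fun f g ↦ by
        rw [← MemLp.toLp_add]
        refine MemLp.toLp_congr _ _ ?_
        filter_upwards [Lp.coeFn_add (f : L2) (g : L2)] with x hx
        simp only [Submodule.coe_add, Pi.add_apply]
        rw [hx, Pi.add_apply, mul_add]
      map_smul' := fun c f ↦ by
        rw [RingHom.id_apply, ← MemLp.toLp_const_smul]
        refine MemLp.toLp_congr _ _ ?_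
        filter_upwards [Lp.coeFn_smul c (f : L2)] with x hx
        simp [hx, mul_left_comm] }

/-- The Schrödinger operator `H = -d²/dx² + V` on `L²(ℝ)`, with domain
`{f ∈ H²(ℝ) : V f ∈ L²(ℝ)}`. As functions in `H²(ℝ)` belong to `L² ∩ L^∞`, the domain is `H²(ℝ)`
for every `V ∈ L^p(ℝ)` with `2 ≤ p ≤ ∞`. -/
def schrodinger (V : ℝ → ℝ) : L2 →ₗ.[ℂ] L2 := freeOperator + mulOperator V

/-- The eigenspace `{f ∈ dom H : H f = μ f}`, as a subspace of the domain. It is non-zero exactly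
when `μ` is an eigenvalue, and its dimension is the multiplicity of `μ`. -/
def eigenspace (H : L2 →ₗ.[ℂ] L2) (μ : ℝ) : Submodule ℂ H.domain :=
  LinearMap.ker (H.toFun - (μ : ℂ) • H.domain.subtype)

/-- The multiplicity of `μ` as an eigenvalue, in `{0, 1, 2, …, ∞}`. -/
def multiplicity (H : L2 →ₗ.[ℂ] L2) (μ : ℝ) : ℕ∞ :=
  Cardinal.toENat (Module.rank ℂ (eigenspace H μ))

/-- The sum `∑ⱼ |μⱼ|^γ` over the negative eigenvalues of `H`, repeated according to multiplicity;
a number that is not an eigenvalue has multiplicity `0` and contributes nothing. -/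
def negativeEigenvalueSum (H : L2 →ₗ.[ℂ] L2) (γ : ℝ) : ℝ≥0∞ :=
  ∑' μ : Set.Iio (0 : ℝ), (multiplicity H μ : ℝ≥0∞) * ENNReal.ofReal (|(μ : ℝ)| ^ γ)

/-- The semi-classical constant
`L^cl_{γ,d} = (4π)^{-d/2} Γ(γ + 1) / Γ(γ + 1 + d/2)`. -/
def semiclassicalConstant (γ : ℝ) (d : ℕ) : ℝ :=
  (4 * Real.pi) ^ (-(d : ℝ) / 2) * (Real.Gamma (γ + 1) / Real.Gamma (γ + 1 + (d : ℝ) / 2))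

/-- The Lieb–Thirring inequality `∑ⱼ |μⱼ|^γ ≤ L ∫ V(x)_-^{γ + 1/2} dx` for `-d²/dx² + V`. -/
def LiebThirringInequality (γ L : ℝ) (V : ℝ → ℝ) : Prop :=
  negativeEigenvalueSum (schrodinger V) γ
    ≤ ENNReal.ofReal L * ∫⁻ x, ENNReal.ofReal ((V x)⁻ ^ (γ + 1 / 2))

end LiebThirring

end

open MeasureTheory Filter Topology
open scoped ENNReal SchwartzMap LineDeriv

noncomputable section

namespace LiebThirring

open scoped BoundedContinuousFunction FourierTransform

/-! For γ = 3/2 the inequality is a sum rule with a nonnegative remainder dropped. Let `-d²/dx² + W`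
have a bound state ψ of energy -ν², and put m(x) = ∫_{-∞}^x ψ². The double commutation W̃ = W - 2
(log m)'' removes this bound state, preserves the others, and lowers ∫ W² by exactly (16/3) ν³:
indeed W² - W̃² = 4 (log m)'' (W - (log m)''), and the right side has an explicit primitive whose
values at the two ends are known (`IsBoundState.integral_sq_eq`, `IsBoundState.exists_commuted`).
Removing finitely many bound states in turn gives (16/3) ∑ νᵢ³ ≤ ∫ W² (`sum_cube_le_integral_sq`),
which is the constant 3/16. Commutation destroys compact support on the right but not the pure
exponential behaviour on the left; hence the asymmetric notion `IsBoundState`, which is stable under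
the induction.

Compactly supported continuous potentials are reached by functional analysis. The resolvent of
`-d²/dx² - U` at -κ² is the free resolvent plus a compact operator, so a min-max argument
(`exists_orthonormal_eigenvectors`) turns trial functions into genuine eigenfunctions. The kernel
e^{-κ|x-y|}/(2κ) yields both compactness and classical regularity, and energies are distinct because
bounded solutions with the same energy are proportional.

For general V, the eigenfunctions themselves are the trial functions. If -V ≤ U₀ with U₀ in L²,
replacing V by -U₀ only lowers the form; approximating U₀ in L² by compactly supported U costs
little because functions in H² are bounded (`re_inner_form_le`, `sum_sqrt_cube_le`). Thus V_- alone
enters the bound.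

Larger γ follows by the Aizenman–Lieb argument: apply the case 3/2 to V + t and integrate against
t^{γ-5/2} dt. Both sides become Beta integrals, whose ratio is the semi-classical constant
(`sum_rpow_le`).

For optimality, the potentials -N(N+1) sech² have eigenvalues -k² for 1 ≤ k ≤ N, with associated
Legendre functions of tanh as eigenfunctions. As N → ∞, comparing ∑ k^{2γ} with the explicit
integral of the potential forces L to be at least the semi-classical constant. -/

/-! ### Multiplication by bounded continuous functions -/

/-- The complexification of a bounded continuous real function, as an element of `L^∞`. -/
theorem memLp_top_ofReal (g : ℝ →ᵇ ℝ) : MemLp (fun x ↦ (g x : ℂ)) ∞ (volume : Measure ℝ) :=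
  (g.memLp_top (μ := volume)).ofReal

/-- Multiplication by a bounded continuous real function, as a bounded operator on `L²(ℝ)`. -/
def mulBounded (g : ℝ →ᵇ ℝ) : L2 →L[ℂ] L2 :=
  (ContinuousLinearMap.lsmul ℂ ℂ).holderL volume ∞ 2 2 ((memLp_top_ofReal g).toLp)

theorem mulBounded_eq_smul (g : ℝ →ᵇ ℝ) (f : L2) :
    mulBounded g f = ((memLp_top_ofReal g).toLp • f : L2) := rfl

theorem coeFn_mulBounded (g : ℝ →ᵇ ℝ) (f : L2) :
    mulBounded g f =ᵐ[volume] fun x ↦ (g x : ℂ) * f x := by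
  rw [mulBounded_eq_smul]
  filter_upwards [Lp.coeFn_lpSMul (r := 2) (memLp_top_ofReal g).toLp f,
    (memLp_top_ofReal g).coeFn_toLp] with x hx hx'
  simp [hx, hx']

theorem L2_inner_def (f g : L2) : inner ℂ f g = ∫ x, inner ℂ (f x) (g x) := rfl

theorem inner_mulBounded_left (g : ℝ →ᵇ ℝ) (f h : L2) :
    inner ℂ (mulBounded g f) h = inner ℂ f (mulBounded g h) := by
  rw [L2_inner_def, L2_inner_def]
  refine integral_congr_ae ?_
  filter_upwards [coeFn_mulBounded g f, coeFn_mulBounded g h] with x hx hx'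
  rw [hx, hx']
  simp [mul_comm, mul_left_comm]

theorem norm_mulBounded_le (g : ℝ →ᵇ ℝ) (f : L2) : ‖mulBounded g f‖ ≤ ‖g‖ * ‖f‖ := by
  refine Lp.norm_le_mul_norm_of_ae_le_mul ?_
  filter_upwards [coeFn_mulBounded g f] with x hx
  rw [hx, norm_mul, Complex.norm_real]
  gcongr
  exact g.norm_coe_le_norm x

theorem re_inner_mulBounded (g : ℝ →ᵇ ℝ) (f : L2) :
    (inner ℂ f (mulBounded g f)).re = ∫ x, g x * ‖f x‖ ^ 2 := by
  have hInt : Integrable (fun x ↦ inner ℂ (f x) (mulBounded g f x)) volume :=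
    L2.integrable_inner f (mulBounded g f)
  rw [L2_inner_def, ← RCLike.re_eq_complex_re, ← integral_re hInt]
  refine integral_congr_ae ?_
  filter_upwards [coeFn_mulBounded g f] with x hx
  rw [hx]
  simp only [RCLike.inner_apply, RCLike.re_eq_complex_re]
  rw [mul_assoc, Complex.mul_conj, ← Complex.ofReal_mul, Complex.ofReal_re,
    Complex.normSq_eq_norm_sq]

theorem norm_sq_eq_integral (f : L2) : ‖f‖ ^ 2 = ∫ x, ‖f x‖ ^ 2 := by
  rw [← inner_self_eq_norm_sq (𝕜 := ℂ), L2_inner_def, ← integral_re (L2.integrable_inner f f)]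
  refine integral_congr_ae (Eventually.of_forall fun x ↦ ?_)
  exact inner_self_eq_norm_sq (𝕜 := ℂ) (f x)

theorem integrable_norm_sq (f : L2) : Integrable (fun x ↦ ‖f x‖ ^ 2) volume :=
  (Lp.memLp f).integrable_norm_pow (by norm_num)

/-! ### The free resolvent -/

/-- The Fourier symbol of `(-d²/dx² + κ²)⁻¹`. -/
def resolventSymbol (κ ξ : ℝ) : ℝ := (κ ^ 2 + (2 * Real.pi * ξ) ^ 2)⁻¹

theorem resolventSymbol_pos {κ : ℝ} (hκ : 0 < κ) (ξ : ℝ) : 0 < resolventSymbol κ ξ := by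
  unfold resolventSymbol; positivity

theorem sq_mul_resolventSymbol_le {κ : ℝ} (hκ : 0 < κ) (ξ : ℝ) :
    κ ^ 2 * resolventSymbol κ ξ ≤ 1 := by
  unfold resolventSymbol
  rw [mul_inv_le_iff₀ (by positivity)]
  nlinarith [sq_nonneg (2 * Real.pi * ξ)]

/-- The symbol is a rescaling of (1 + x²)⁻¹. Temperate growth lets it act as a Fourier multiplier on
tempered distributions, where the resolvent equation is verified. -/
theorem resolventSymbol_hasTemperateGrowth {κ : ℝ} (hκ : 0 < κ) :
    (resolventSymbol κ).HasTemperateGrowth := by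
  have h : resolventSymbol κ =
      fun ξ ↦ (κ ^ 2)⁻¹ * ((fun x : ℝ ↦ (1 + ‖x‖ ^ 2) ^ (-1 : ℝ)) ((2 * Real.pi / κ) * ξ)) := by
    ext ξ
    simp only [resolventSymbol, Real.norm_eq_abs, sq_abs]
    rw [Real.rpow_neg_one, ← mul_inv]
    congr 1
    field_simp
  rw [h]
  have h1 : (fun x : ℝ ↦ (1 + ‖x‖ ^ 2) ^ (-1 : ℝ)).HasTemperateGrowth := by fun_prop
  have h2 : (fun ξ : ℝ ↦ (2 * Real.pi / κ) * ξ).HasTemperateGrowth := by fun_prop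
  exact (Function.HasTemperateGrowth.const _).mul (h1.comp h2)

/-- The symbol of the free resolvent as a bounded continuous function. -/
def resolventSymbolBCF (κ : ℝ) (hκ : 0 < κ) : ℝ →ᵇ ℝ :=
  BoundedContinuousFunction.ofNormedAddCommGroup (resolventSymbol κ)
    (resolventSymbol_hasTemperateGrowth hκ).1.continuous ((κ ^ 2)⁻¹) fun ξ ↦ by
      rw [Real.norm_of_nonneg (resolventSymbol_pos hκ ξ).le, ← one_div,
        le_div_iff₀' (by positivity)]
      exact sq_mul_resolventSymbol_le hκ ξ

@[simp]
theorem resolventSymbolBCF_apply (κ : ℝ) (hκ : 0 < κ) (ξ : ℝ) :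
    resolventSymbolBCF κ hκ ξ = resolventSymbol κ ξ := rfl

/-- The free resolvent `(-d²/dx² + κ²)⁻¹` on `L²(ℝ)`. -/
def freeResolvent (κ : ℝ) (hκ : 0 < κ) : L2 →L[ℂ] L2 :=
  ((Lp.fourierTransformₗᵢ ℝ ℂ).symm.toContinuousLinearEquiv : L2 →L[ℂ] L2) ∘L
    mulBounded (resolventSymbolBCF κ hκ) ∘L
      ((Lp.fourierTransformₗᵢ ℝ ℂ).toContinuousLinearEquiv : L2 →L[ℂ] L2)

theorem freeResolvent_apply (κ : ℝ) (hκ : 0 < κ) (f : L2) :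
    freeResolvent κ hκ f = 𝓕⁻ (mulBounded (resolventSymbolBCF κ hκ) (𝓕 f)) := rfl

theorem fourier_freeResolvent (κ : ℝ) (hκ : 0 < κ) (f : L2) :
    𝓕 (freeResolvent κ hκ f) = mulBounded (resolventSymbolBCF κ hκ) (𝓕 f) := by
  rw [freeResolvent_apply, FourierTransform.fourier_fourierInv_eq]

theorem inner_freeResolvent_left {κ : ℝ} (hκ : 0 < κ) (f g : L2) :
    inner ℂ (freeResolvent κ hκ f) g = inner ℂ f (freeResolvent κ hκ g) := by
  rw [← Lp.inner_fourier_eq, ← Lp.inner_fourier_eq f, fourier_freeResolvent,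
    fourier_freeResolvent, inner_mulBounded_left]

/-- On the Fourier side κ² s² ≤ s, because the symbol satisfies 0 < s ≤ κ⁻². This expresses -d²/dx²
+ κ² ≥ κ² without mentioning the unbounded operator. -/
theorem sq_mul_norm_freeResolvent_sq_le {κ : ℝ} (hκ : 0 < κ) (f : L2) :
    κ ^ 2 * ‖freeResolvent κ hκ f‖ ^ 2 ≤ (inner ℂ f (freeResolvent κ hκ f)).re := by
  rw [← Lp.inner_fourier_eq, ← Lp.norm_fourier_eq, fourier_freeResolvent, re_inner_mulBounded,
    norm_sq_eq_integral, ← integral_const_mul]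
  have h := coeFn_mulBounded (resolventSymbolBCF κ hκ) (𝓕 f)
  have hInt : Integrable (fun x ↦ resolventSymbolBCF κ hκ x * ‖(𝓕 f : L2) x‖ ^ 2) volume := by
    refine (integrable_norm_sq (𝓕 f)).bdd_mul (c := ‖resolventSymbolBCF κ hκ‖)
      (resolventSymbolBCF κ hκ).continuous.aestronglyMeasurable ?_
    exact Eventually.of_forall fun x ↦ (resolventSymbolBCF κ hκ).norm_coe_le_norm x
  refine integral_mono_ae ((integrable_norm_sq _).const_mul _) hInt ?_
  filter_upwards [h] with x hx
  simp only [hx, norm_mul, Complex.norm_real, mul_pow, resolventSymbolBCF_apply, Real.norm_eq_abs,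
    sq_abs]
  have h1 := sq_mul_resolventSymbol_le hκ x
  have h2 := resolventSymbol_pos hκ x
  calc _ = (κ ^ 2 * resolventSymbol κ x) * (resolventSymbol κ x * ‖(𝓕 f : L2) x‖ ^ 2) := by ring
    _ ≤ 1 * (resolventSymbol κ x * ‖(𝓕 f : L2) x‖ ^ 2) := by gcongr
    _ = _ := one_mul _

theorem sq_mul_norm_freeResolvent_le {κ : ℝ} (hκ : 0 < κ) (f : L2) :
    κ ^ 2 * ‖freeResolvent κ hκ f‖ ≤ ‖f‖ := by
  have h1 := sq_mul_norm_freeResolvent_sq_le hκ f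
  have h2 := (Complex.re_le_norm _).trans (norm_inner_le_norm (𝕜 := ℂ) f (freeResolvent κ hκ f))
  rcases (norm_nonneg (freeResolvent κ hκ f)).eq_or_lt with h | h
  · rw [← h]; simp
  · refine le_of_mul_le_mul_right ?_ h
    nlinarith

theorem ofReal_resolventSymbol_hasTemperateGrowth {κ : ℝ} (hκ : 0 < κ) :
    (fun ξ ↦ (resolventSymbol κ ξ : ℂ)).HasTemperateGrowth :=
  Function.HasTemperateGrowth.comp (g := Complex.ofReal) (by fun_prop)
    (resolventSymbol_hasTemperateGrowth hκ)

theorem ofReal_inv_resolventSymbol_hasTemperateGrowth (κ : ℝ) :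
    (fun ξ : ℝ ↦ (κ ^ 2 : ℂ) + (2 * Real.pi * (ξ : ℂ)) ^ 2).HasTemperateGrowth := by
  fun_prop

theorem freeResolvent_toTemperedDistribution {κ : ℝ} (hκ : 0 < κ) (f : L2) :
    (freeResolvent κ hκ f : 𝓢'(ℝ, ℂ)) =
      TemperedDistribution.fourierMultiplierCLM ℂ (fun ξ ↦ (resolventSymbol κ ξ : ℂ))
        (f : 𝓢'(ℝ, ℂ)) := by
  rw [freeResolvent_apply, ← Lp.fourierInv_toTemperedDistribution_eq, mulBounded_eq_smul,
    TemperedDistribution.fourierMultiplierCLM_apply, Lp.fourier_toTemperedDistribution_eq]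
  congr 1
  exact Lp.toTemperedDistribution_smul_eq (ofReal_resolventSymbol_hasTemperateGrowth hκ)
    (memLp_top_ofReal (resolventSymbolBCF κ hκ)) (𝓕 f)

theorem resolventSymbol_mul_inv {κ : ℝ} (hκ : 0 < κ) :
    (fun ξ ↦ (resolventSymbol κ ξ : ℂ)) * (fun ξ : ℝ ↦ (κ ^ 2 : ℂ) + (2 * Real.pi * (ξ : ℂ)) ^ 2)
      = fun _ ↦ 1 := by
  ext ξ
  simp only [Pi.mul_apply, resolventSymbol]
  have h : (κ ^ 2 + (2 * Real.pi * ξ) ^ 2 : ℝ) ≠ 0 := by positivity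
  rw [← Complex.ofReal_one, ← inv_mul_cancel₀ h]
  push_cast
  ring

/-- Each derivative is multiplication by 2πiξ on the Fourier side, so -∂² contributes (2πξ)². -/
theorem distribution_helmholtz_eq (κ : ℝ) (f : 𝓢'(ℝ, ℂ)) :
    ((κ : ℂ) ^ 2) • f - ∂_{(1 : ℝ)} (∂_{(1 : ℝ)} f) =
      TemperedDistribution.fourierMultiplierCLM ℂ
        (fun ξ : ℝ ↦ (κ ^ 2 : ℂ) + (2 * Real.pi * (ξ : ℂ)) ^ 2) f := by
  have hsplit : (fun ξ : ℝ ↦ (κ ^ 2 : ℂ) + (2 * Real.pi * (ξ : ℂ)) ^ 2) =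
      fun ξ : ℝ ↦ ∑ i : Fin 2,
        (![fun _ ↦ (κ ^ 2 : ℂ), fun ξ : ℝ ↦ (2 * Real.pi * (ξ : ℂ)) ^ 2] i) ξ := by
    ext ξ; simp
  rw [hsplit, TemperedDistribution.fourierMultiplierCLM_sum]
  · simp only [Fin.sum_univ_two, Matrix.cons_val_zero, Matrix.cons_val_one,
      TemperedDistribution.fourierMultiplierCLM_const, add_apply,
      smul_apply, ContinuousLinearMap.id_apply]
    rw [sub_eq_add_neg]
    congr 1
    simp only [TemperedDistribution.lineDeriv_eq_fourierMultiplierCLM, map_smul, smul_smul]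
    rw [TemperedDistribution.fourierMultiplierCLM_fourierMultiplierCLM_apply (by fun_prop)
      (by fun_prop)]
    have : (fun ξ : ℝ ↦ (2 * Real.pi * (ξ : ℂ)) ^ 2) = ((2 * Real.pi : ℂ) ^ 2) •
        ((fun x : ℝ ↦ ((inner ℝ x (1 : ℝ) : ℝ) : ℂ)) *
          fun x : ℝ ↦ ((inner ℝ x (1 : ℝ) : ℝ) : ℂ)) := by
      ext ξ; simp; ring
    rw [this, TemperedDistribution.fourierMultiplierCLM_smul (by fun_prop),
      smul_apply, ← neg_smul]
    congr 1
    ring_nf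
    simp
  · intro i _
    fin_cases i
    · simp
    · change (fun ξ : ℝ ↦ (2 * Real.pi * (ξ : ℂ)) ^ 2).HasTemperateGrowth
      fun_prop

/-- The symbols of κ² - ∂² and of the resolvent multiply to 1. Through this identity, questions
about the unbounded operator on H² become questions about one bounded symmetric operator. -/
theorem eq_freeResolvent_of_sobolevH2 {κ : ℝ} (hκ : 0 < κ) (f : sobolevH2) :
    (f : L2) = freeResolvent κ hκ (((κ : ℂ) ^ 2) • (f : L2) - secondDeriv f) := by
  apply toTemperedDistribution_injective
  have h := secondDeriv_spec f
  simp only [freeResolvent_toTemperedDistribution]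
  simp only [← Lp.toTemperedDistributionCLM_apply, map_sub, map_smul] at h ⊢
  rw [h, ← map_smul, ← map_sub, distribution_helmholtz_eq,
    TemperedDistribution.fourierMultiplierCLM_fourierMultiplierCLM_apply
      (ofReal_inv_resolventSymbol_hasTemperateGrowth κ)
      (ofReal_resolventSymbol_hasTemperateGrowth hκ), mul_comm, resolventSymbol_mul_inv hκ]
  simp

theorem schwartz_toTemperedDistribution_injective {φ η : 𝓢(ℝ, ℂ)}
    (h : (φ : 𝓢'(ℝ, ℂ)) = (η : 𝓢'(ℝ, ℂ))) : φ = η := by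
  apply SchwartzMap.injective_toLp (F := ℂ) 2 (volume : Measure ℝ)
  apply toTemperedDistribution_injective
  simp only [Lp.toTemperedDistribution_toLp_eq]
  exact h

/-- The free resolvent preserves Schwartz functions and solves the Helmholtz equation there. -/
theorem exists_freeResolvent_schwartz {κ : ℝ} (hκ : 0 < κ) (η : 𝓢(ℝ, ℂ)) :
    ∃ φ : 𝓢(ℝ, ℂ), freeResolvent κ hκ (η.toLp 2) = φ.toLp 2 ∧
      ((κ : ℂ) ^ 2) • φ - ∂_{(1 : ℝ)} (∂_{(1 : ℝ)} φ) = η := by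
  refine ⟨SchwartzMap.fourierMultiplierCLM ℂ (fun ξ ↦ (resolventSymbol κ ξ : ℂ)) η, ?_, ?_⟩
  · apply toTemperedDistribution_injective
    simp only
    rw [freeResolvent_toTemperedDistribution, Lp.toTemperedDistribution_toLp_eq,
      Lp.toTemperedDistribution_toLp_eq,
      TemperedDistribution.fourierMultiplierCLM_toTemperedDistributionCLM_eq
        (ofReal_resolventSymbol_hasTemperateGrowth hκ)]
  · apply schwartz_toTemperedDistribution_injective
    rw [map_sub, map_smul, ← TemperedDistribution.lineDerivOp_toTemperedDistributionCLM_eq,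
      ← TemperedDistribution.lineDerivOp_toTemperedDistributionCLM_eq, distribution_helmholtz_eq,
      ← TemperedDistribution.fourierMultiplierCLM_toTemperedDistributionCLM_eq
        (ofReal_resolventSymbol_hasTemperateGrowth hκ),
      TemperedDistribution.fourierMultiplierCLM_fourierMultiplierCLM_apply
        (ofReal_resolventSymbol_hasTemperateGrowth hκ)
        (ofReal_inv_resolventSymbol_hasTemperateGrowth κ), resolventSymbol_mul_inv hκ]
    simp

/-! ### The integral kernel of the free resolvent -/

/-- The fundamental solution `e^{-κ|z|} / (2κ)` of `-d²/dx² + κ²`. -/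
def green (κ z : ℝ) : ℝ := Real.exp (-κ * |z|) / (2 * κ)

theorem continuous_green (κ : ℝ) : Continuous (green κ) := by
  unfold green; fun_prop

theorem integrable_exp_neg_mul_abs {a : ℝ} (ha : 0 < a) :
    Integrable (fun z ↦ Real.exp (-a * |z|)) volume := by
  rw [← integrableOn_univ, ← Set.Iic_union_Ioi (a := (0 : ℝ))]
  refine IntegrableOn.union ?_ ?_
  · refine (integrableOn_exp_mul_Iic ha 0).congr_fun (fun z hz ↦ ?_) measurableSet_Iic
    simp only [abs_of_nonpos (Set.mem_Iic.mp hz)]; ring_nf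
  · refine (integrableOn_exp_mul_Ioi (neg_lt_zero.mpr ha) 0).congr_fun (fun z hz ↦ ?_)
      measurableSet_Ioi
    simp only [abs_of_pos (Set.mem_Ioi.mp hz)]

theorem memLp_green {κ : ℝ} (hκ : 0 < κ) : MemLp (fun z ↦ (green κ z : ℂ)) 2 volume := by
  refine MemLp.ofReal (f := green κ) ?_
  rw [memLp_two_iff_integrable_sq (continuous_green κ).aestronglyMeasurable]
  refine ((integrable_exp_neg_mul_abs (mul_pos two_pos hκ)).const_mul ((2 * κ) ^ 2)⁻¹).congr
    (Eventually.of_forall fun z ↦ ?_)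
  simp only [green, div_pow, ← Real.exp_nat_mul]
  rw [div_eq_inv_mul]
  congr 2
  push_cast; ring

theorem memLp_green_sub {κ : ℝ} (hκ : 0 < κ) (x : ℝ) :
    MemLp (fun y ↦ (green κ (x - y) : ℂ)) 2 volume :=
  (memLp_green hκ).comp_measurePreserving (Measure.measurePreserving_sub_left volume x)

/-- The kernel of the free resolvent at `x`, as an element of `L²(ℝ)`. -/
def greenFn {κ : ℝ} (hκ : 0 < κ) (x : ℝ) : L2 := (memLp_green_sub hκ x).toLp

theorem coeFn_greenFn {κ : ℝ} (hκ : 0 < κ) (x : ℝ) :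
    greenFn hκ x =ᵐ[volume] fun y ↦ (green κ (x - y) : ℂ) := (memLp_green_sub hκ x).coeFn_toLp

theorem norm_greenFn {κ : ℝ} (hκ : 0 < κ) (x : ℝ) : ‖greenFn hκ x‖ = ‖greenFn hκ 0‖ := by
  have h : ∀ x, ‖greenFn hκ x‖ = (eLpNorm (fun z ↦ (green κ z : ℂ)) 2 volume).toReal := by
    intro x
    rw [greenFn, Lp.norm_toLp, ← eLpNorm_comp_measurePreserving
      (memLp_green hκ).aestronglyMeasurable (Measure.measurePreserving_sub_left volume x)]
    rfl
  rw [h, h]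

/-- The bound has the sum of the exponentials on the right so that it can be integrated: the L²
distance of two kernels is then controlled by the L² norm of their sum. -/
theorem abs_exp_neg_sub_exp_neg_le {a b : ℝ} :
    |Real.exp (-a) - Real.exp (-b)| ≤ |a - b| * (Real.exp (-a) + Real.exp (-b)) := by
  wlog h : a ≤ b generalizing a b
  · rw [abs_sub_comm, abs_sub_comm a, add_comm]
    exact this (le_of_not_ge h)
  rw [abs_of_nonneg (by simpa using h), abs_of_nonpos (by linarith)]
  have h1 : 1 - (b - a) ≤ Real.exp (-(b - a)) := by
    linarith [Real.add_one_le_exp (-(b - a))]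
  have h2 : Real.exp (-b) = Real.exp (-a) * Real.exp (-(b - a)) := by
    rw [← Real.exp_add]; ring_nf
  have h3 := Real.exp_pos (-a)
  have h4 := Real.exp_pos (-b)
  nlinarith [mul_nonneg (sub_nonneg.mpr h) h4.le]

theorem norm_greenFn_sub_le {κ : ℝ} (hκ : 0 < κ) (x x' : ℝ) :
    ‖greenFn hκ x - greenFn hκ x'‖ ≤ (2 * κ * ‖greenFn hκ 0‖) * |x - x'| := by
  have key : ‖greenFn hκ x - greenFn hκ x'‖ ≤
      (κ * |x - x'|) * ‖greenFn hκ x + greenFn hκ x'‖ := by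
    refine Lp.norm_le_mul_norm_of_ae_le_mul ?_
    filter_upwards [coeFn_greenFn hκ x, coeFn_greenFn hκ x', Lp.coeFn_sub (greenFn hκ x)
      (greenFn hκ x'), Lp.coeFn_add (greenFn hκ x) (greenFn hκ x')] with y h1 h2 h3 h4
    rw [h3, h4, Pi.sub_apply, Pi.add_apply, h1, h2, ← Complex.ofReal_sub, ← Complex.ofReal_add,
      Complex.norm_real, Complex.norm_real, Real.norm_eq_abs, Real.norm_eq_abs]
    have hb := @abs_exp_neg_sub_exp_neg_le (κ * |x - y|) (κ * |x' - y|)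
    have h5 : |(κ * |x - y|) - (κ * |x' - y|)| ≤ κ * |x - x'| := by
      rw [← mul_sub, abs_mul, abs_of_pos hκ]
      refine mul_le_mul_of_nonneg_left ?_ hκ.le
      refine (abs_abs_sub_abs_le (x - y) (x' - y)).trans ?_
      rw [sub_sub_sub_cancel_right]
    simp only [green, neg_mul]
    rw [← sub_div, ← add_div, abs_div, abs_div, mul_div_assoc']
    gcongr
    rw [abs_of_pos (a := (Real.exp (-(κ * |x - y|)) + Real.exp (-(κ * |x' - y|)) : ℝ))
      (by positivity)]
    exact hb.trans (by gcongr)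
  refine key.trans ?_
  have := norm_add_le (greenFn hκ x) (greenFn hκ x')
  rw [norm_greenFn hκ x, norm_greenFn hκ x'] at this
  calc _ ≤ (κ * |x - x'|) * (‖greenFn hκ 0‖ + ‖greenFn hκ 0‖) := by gcongr
    _ = _ := by ring

theorem inner_greenFn {κ : ℝ} (hκ : 0 < κ) (x : ℝ) (h : L2) :
    inner ℂ (greenFn hκ x) h = ∫ y, (green κ (x - y) : ℂ) * h y := by
  rw [L2_inner_def]
  refine integral_congr_ae ?_
  filter_upwards [coeFn_greenFn hκ x] with y hy
  rw [hy]
  simp [mul_comm]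

theorem integrable_green_mul {κ : ℝ} (hκ : 0 < κ) (x : ℝ) (h : L2) :
    Integrable (fun y ↦ (green κ (x - y) : ℂ) * h y) volume := by
  refine (L2.integrable_inner (𝕜 := ℂ) (greenFn hκ x) h).congr ?_
  filter_upwards [coeFn_greenFn hκ x] with y hy
  rw [hy]
  simp [mul_comm]

/-- On each half-line the integrand has an explicit primitive, e^{-κ(x-y)} (κφ - φ')/(2κ) for y < x
and -e^{κ(x-y)} (κφ + φ')/(2κ) for y > x. The φ' terms cancel when the two boundary values are
added. -/
theorem integral_green_helmholtz {κ : ℝ} (hκ : 0 < κ) (φ : 𝓢(ℝ, ℂ)) (x : ℝ) :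
    ∫ y, (green κ (x - y) : ℂ) * (((κ : ℂ) ^ 2) • φ - ∂_{(1 : ℝ)} (∂_{(1 : ℝ)} φ)) y = φ x := by
  set φ' : 𝓢(ℝ, ℂ) := ∂_{(1 : ℝ)} φ
  have hd : ∀ (f : 𝓢(ℝ, ℂ)) (y : ℝ), HasDerivAt f ((∂_{(1 : ℝ)} f : 𝓢(ℝ, ℂ)) y) y := by
    intro f y
    have h := f.hasDerivAt y
    rwa [SchwartzMap.lineDerivOp_apply, ← SchwartzMap.lineDerivOp_apply,
      SchwartzMap.lineDerivOp_apply_eq_fderiv, fderiv_apply_one_eq_deriv]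
  set η : 𝓢(ℝ, ℂ) := ((κ : ℂ) ^ 2) • φ - ∂_{(1 : ℝ)} φ'
  have hη : ∀ y, η y = κ ^ 2 * φ y - (∂_{(1 : ℝ)} φ' : 𝓢(ℝ, ℂ)) y := fun y ↦ by
    simp [η]
  have hInt : Integrable (fun y ↦ (green κ (x - y) : ℂ) * η y) volume := by
    refine (integrable_green_mul hκ x (η.toLp 2)).congr ?_
    filter_upwards [η.coeFn_toLp 2] with y hy
    rw [hy]
  have hκ' : (κ : ℂ) ≠ 0 := by exact_mod_cast hκ.ne'
  have hexp : ∀ s y : ℝ, HasDerivAt (fun y : ℝ ↦ Complex.exp (s * (x - y)))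
      (-s * Complex.exp (s * (x - y))) y := by
    intro s y
    have h1 : HasDerivAt (fun y : ℝ ↦ (s : ℂ) * (x - y)) (s * (0 - 1)) y :=
      ((hasDerivAt_const y (x : ℂ)).sub (Complex.ofRealCLM.hasDerivAt)).const_mul _
    convert h1.cexp using 1
    ring
  have hlim : ∀ f : 𝓢(ℝ, ℂ), Tendsto f atTop (𝓝 0) ∧ Tendsto f atBot (𝓝 0) := by
    intro f
    have := f.tendsto_cocompact
    rw [cocompact_eq_atBot_atTop, tendsto_sup] at this
    exact ⟨this.2, this.1⟩
  have hsqueeze : ∀ (s : ℝ) (g : ℝ → ℂ) (l : Filter ℝ), Tendsto g l (𝓝 0) →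
      (∀ᶠ y in l, s * (x - y) ≤ 0) →
      Tendsto (fun y : ℝ ↦ Complex.exp (s * (x - y)) * g y) l (𝓝 0) := by
    intro s g l hg hl
    refine squeeze_zero_norm' ?_ (tendsto_zero_iff_norm_tendsto_zero.mp hg)
    filter_upwards [hl] with y hy
    rw [norm_mul, Complex.norm_exp]
    have : ((s : ℂ) * (x - y)).re = s * (x - y) := by
      rw [← Complex.ofReal_sub, ← Complex.ofReal_mul, Complex.ofReal_re]
    rw [this]
    exact mul_le_of_le_one_left (norm_nonneg _) (Real.exp_le_one_iff.mpr hy)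
  have hleft : ∫ y in Set.Iic x, (green κ (x - y) : ℂ) * η y =
      (κ * φ x - φ' x) / (2 * κ) := by
    rw [integral_Iic_of_hasDerivAt_of_tendsto (m := 0)
      (f := fun y ↦ Complex.exp ((-κ : ℝ) * (x - y)) * ((κ * φ y - φ' y) / (2 * κ)))]
    · simp
    · refine (Continuous.continuousWithinAt ?_)
      have := φ.continuous; have := φ'.continuous
      fun_prop
    · intro y hy
      convert! (hexp (-κ) y).mul ((((show HasDerivAt φ (φ' y) y from hd φ y).const_mul
        (κ : ℂ)).sub (hd φ' y)).div_const (2 * κ : ℂ))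
        using 1
      rw [hη]
      simp only [green, abs_of_pos (sub_pos.mpr (Set.mem_Iio.mp hy))]
      push_cast
      simp only [Pi.sub_apply]
      field_simp
      ring_nf
    · exact hInt.integrableOn
    · refine hsqueeze _ _ _ ?_ ?_
      · have := (((hlim φ).2.const_mul (κ : ℂ)).sub (hlim φ').2).div_const (2 * κ : ℂ)
        simpa using this
      · filter_upwards [eventually_le_atBot x] with y hy
        nlinarith
  have hright : ∫ y in Set.Ioi x, (green κ (x - y) : ℂ) * η y =
      (κ * φ x + φ' x) / (2 * κ) := by
    rw [integral_Ioi_of_hasDerivAt_of_tendsto (m := 0)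
      (f := fun y ↦ Complex.exp ((κ : ℝ) * (x - y)) * (-(κ * φ y + φ' y) / (2 * κ)))]
    · simp; ring
    · refine (Continuous.continuousWithinAt ?_)
      have := φ.continuous; have := φ'.continuous
      fun_prop
    · intro y hy
      convert! (hexp κ y).mul ((((show HasDerivAt φ (φ' y) y from hd φ y).const_mul
        (κ : ℂ)).add (hd φ' y)).neg.div_const (2 * κ : ℂ))
        using 1
      rw [hη]
      simp only [green, abs_of_neg (sub_neg.mpr (Set.mem_Ioi.mp hy))]
      push_cast
      simp only [Pi.add_apply, Pi.neg_apply]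
      field_simp
      ring_nf
    · exact hInt.integrableOn
    · refine hsqueeze _ _ _ ?_ ?_
      · have := (((hlim φ).1.const_mul (κ : ℂ)).add (hlim φ').1).neg.div_const (2 * κ : ℂ)
        simpa using this
      · filter_upwards [eventually_ge_atTop x] with y hy
        nlinarith
  rw [← intervalIntegral.integral_Iic_add_Ioi (b := x) hInt.integrableOn hInt.integrableOn, hleft,
    hright]
  field_simp
  ring

/-- The free resolvent is the integral operator with kernel `green`. -/
theorem freeResolvent_ae_eq {κ : ℝ} (hκ : 0 < κ) (h : L2) :
    freeResolvent κ hκ h =ᵐ[volume] fun x ↦ inner ℂ (greenFn hκ x) h := by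
  have hdense : DenseRange (SchwartzMap.toLpCLM ℝ ℂ 2 (volume : Measure ℝ)) :=
    SchwartzMap.denseRange_toLpCLM ENNReal.ofNat_ne_top
  obtain ⟨u, hu, hlim⟩ := mem_closure_iff_seq_limit.mp (hdense h)
  have hu' : ∀ n, freeResolvent κ hκ (u n) =ᵐ[volume] fun x ↦ inner ℂ (greenFn hκ x) (u n) := by
    intro n
    obtain ⟨η, hη⟩ := hu n
    rw [← hη, SchwartzMap.toLpCLM_apply]
    obtain ⟨φ, hφ1, hφ2⟩ := exists_freeResolvent_schwartz hκ η
    rw [hφ1]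
    filter_upwards [φ.coeFn_toLp 2] with x hx
    rw [hx, inner_greenFn, ← integral_green_helmholtz hκ φ x, hφ2]
    refine integral_congr_ae ?_
    filter_upwards [η.coeFn_toLp 2] with y hy
    rw [hy]
  have hlim' : Tendsto (fun n ↦ freeResolvent κ hκ (u n)) atTop (𝓝 (freeResolvent κ hκ h)) :=
    ((freeResolvent κ hκ).continuous.tendsto h).comp hlim
  -- Convergence in L² gives a.e. convergence only along a subsequence, which suffices since the
  -- kernel side converges at every point.
  obtain ⟨ns, hns, hae⟩ := (tendstoInMeasure_of_tendsto_Lp hlim').exists_seq_tendsto_ae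
  have hall := ae_all_iff.mpr hu'
  filter_upwards [hae, hall] with x hx1 hx2
  refine tendsto_nhds_unique hx1 ?_
  simp only [hx2]
  exact ((tendsto_const_nhds (x := greenFn hκ x)).inner hlim).comp hns.tendsto_atTop

theorem norm_inner_greenFn_le {κ : ℝ} (hκ : 0 < κ) (x : ℝ) (h : L2) :
    ‖inner ℂ (greenFn hκ x) h‖ ≤ ‖greenFn hκ 0‖ * ‖h‖ := by
  rw [← norm_greenFn hκ x]
  exact norm_inner_le_norm _ _

theorem continuous_greenFn {κ : ℝ} (hκ : 0 < κ) : Continuous (greenFn hκ) := by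
  refine LipschitzWith.continuous (K := (2 * κ * ‖greenFn hκ 0‖).toNNReal)
    (LipschitzWith.of_dist_le_mul fun x y ↦ ?_)
  rw [dist_eq_norm, Real.dist_eq, Real.coe_toNNReal _ (by positivity)]
  exact norm_greenFn_sub_le hκ x y

theorem hasDerivAt_integral_of_continuous {E : Type*} [NormedAddCommGroup E] [NormedSpace ℝ E]
    [CompleteSpace E] {f : ℝ → E} (hf : Continuous f) {a : ℝ} (x : ℝ) :
    HasDerivAt (fun x ↦ ∫ y in a..x, f y) (f x) x :=
  intervalIntegral.integral_hasDerivAt_right (hf.intervalIntegrable _ _)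
    hf.stronglyMeasurable.stronglyMeasurableAtFilter hf.continuousAt

/-- Solutions `-v'' + κ² v = k` given by the free resolvent of a continuous function. -/
theorem hasDerivAt_integral_green {κ : ℝ} (hκ : 0 < κ) {k : ℝ → ℂ} (hk : Continuous k)
    (hInt : ∀ x, Integrable (fun y ↦ (green κ (x - y) : ℂ) * k y) volume) :
    ∃ w : ℝ → ℂ, ∀ x, HasDerivAt (fun x ↦ ∫ y, (green κ (x - y) : ℂ) * k y) (w x) x ∧
      HasDerivAt w (κ ^ 2 * (∫ y, (green κ (x - y) : ℂ) * k y) - k x) x := by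
  have hκ' : (κ : ℂ) ≠ 0 := by exact_mod_cast hκ.ne'
  have hL : ∀ x, IntegrableOn (fun y : ℝ ↦ Complex.exp (κ * y) * k y) (Set.Iic x) volume := by
    intro x
    refine IntegrableOn.congr_fun (((hInt x).integrableOn (s := Set.Iic x)).const_mul
      (2 * κ * Complex.exp (κ * x))) (fun y hy ↦ ?_) measurableSet_Iic
    simp only [green, abs_of_nonneg (sub_nonneg.mpr (Set.mem_Iic.mp hy))]
    push_cast
    rw [show (κ : ℂ) * y = κ * x + -κ * (x - y) by ring, Complex.exp_add]
    field_simp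
  have hR : ∀ x, IntegrableOn (fun y : ℝ ↦ Complex.exp (-κ * y) * k y) (Set.Ioi x) volume := by
    intro x
    refine IntegrableOn.congr_fun (((hInt x).integrableOn (s := Set.Ioi x)).const_mul
      (2 * κ * Complex.exp (-κ * x))) (fun y hy ↦ ?_) measurableSet_Ioi
    simp only [green, abs_of_neg (sub_neg.mpr (Set.mem_Ioi.mp hy))]
    push_cast
    rw [show -(κ : ℂ) * y = -κ * x + -κ * -(x - y) by ring, Complex.exp_add]
    field_simp
  -- Splitting the kernel at y = x factors out e^{∓κx}. The remaining integrals depend on x only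
  -- through an endpoint, so the fundamental theorem of calculus differentiates them.
  set A : ℝ → ℂ := fun x ↦ ∫ y in Set.Iic x, Complex.exp (κ * y) * k y
  set B : ℝ → ℂ := fun x ↦ ∫ y in Set.Ioi x, Complex.exp (-κ * y) * k y
  have hA : ∀ x : ℝ, HasDerivAt A (Complex.exp (κ * x) * k x) x := by
    intro x
    have h : A = fun x ↦ A 0 + ∫ y in (0 : ℝ)..x, Complex.exp (κ * y) * k y := by
      ext x
      rw [← intervalIntegral.integral_Iic_sub_Iic (hL 0) (hL x)]
      simp [A]
    rw [h]
    refine HasDerivAt.const_add _ ?_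
    exact hasDerivAt_integral_of_continuous (by fun_prop) x
  have hB : ∀ x : ℝ, HasDerivAt B (-(Complex.exp (-κ * x) * k x)) x := by
    intro x
    have h : B = fun x ↦ B 0 - ∫ y in (0 : ℝ)..x, Complex.exp (-κ * y) * k y := by
      ext x
      rw [← intervalIntegral.integral_Ioi_sub_Ioi' (hR 0) (hR x)]
      simp [B]
    rw [h]
    refine HasDerivAt.const_sub _ ?_
    exact hasDerivAt_integral_of_continuous (by fun_prop) x
  have hv : ∀ x, ∫ y, (green κ (x - y) : ℂ) * k y =
      (Complex.exp (-κ * x) * A x + Complex.exp (κ * x) * B x) / (2 * κ) := by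
    intro x
    rw [← intervalIntegral.integral_Iic_add_Ioi (b := x) (hInt x).integrableOn
      (hInt x).integrableOn, add_div, mul_div_right_comm, mul_div_right_comm]
    congr 1
    · rw [← integral_const_mul]
      refine setIntegral_congr_fun measurableSet_Iic fun y hy ↦ ?_
      simp only [green, abs_of_nonneg (sub_nonneg.mpr (Set.mem_Iic.mp hy))]
      push_cast
      rw [show -(κ : ℂ) * (x - y) = -κ * x + κ * y by ring, Complex.exp_add]
      ring
    · rw [← integral_const_mul]
      refine setIntegral_congr_fun measurableSet_Ioi fun y hy ↦ ?_
      simp only [green, abs_of_neg (sub_neg.mpr (Set.mem_Ioi.mp hy))]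
      push_cast
      rw [show -(κ : ℂ) * -(x - y) = κ * x + -κ * y by ring, Complex.exp_add]
      ring
  have hexp : ∀ (s : ℂ) (x : ℝ), HasDerivAt (fun x : ℝ ↦ Complex.exp (s * x))
      (s * Complex.exp (s * x)) x := by
    intro s x
    have h1 : HasDerivAt (fun y : ℝ ↦ s * (y : ℂ)) (s * 1) x :=
      (Complex.ofRealCLM.hasDerivAt).const_mul _
    convert h1.cexp using 1
    ring
  have hee : ∀ x : ℝ, Complex.exp (-κ * x) * Complex.exp (κ * x) = 1 := fun x ↦ by
    rw [← Complex.exp_add]; simp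
  refine ⟨fun x ↦ (Complex.exp (κ * x) * B x - Complex.exp (-κ * x) * A x) / 2, fun x ↦ ⟨?_, ?_⟩⟩
  · rw [funext hv]
    convert! (((hexp (-κ) x).mul (hA x)).add ((hexp κ x).mul (hB x))).div_const (2 * κ : ℂ) using 1
    beta_reduce
    generalize Complex.exp (-κ * x) = e₁
    generalize Complex.exp (κ * x) = e₂
    field_simp
    ring
  · rw [hv]
    convert! (((hexp κ x).mul (hB x)).sub ((hexp (-κ) x).mul (hA x))).div_const (2 : ℂ) using 1
    have h := hee x
    generalize Complex.exp (-κ * x) = e₁ at h ⊢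
    generalize Complex.exp (κ * x) = e₂ at h ⊢
    field_simp
    linear_combination (2 * k x) * h

/-! ### Compactness -/

/-- The restriction of the free resolvent to a compact interval, with values in continuous
functions. -/
def resolventOnIcc {κ : ℝ} (hκ : 0 < κ) (R : ℝ) (h : L2) : Set.Icc (-R) R →ᵇ ℂ :=
  BoundedContinuousFunction.mkOfCompact
    ⟨fun x ↦ inner ℂ (greenFn hκ (x : ℝ)) h,
      ((continuous_greenFn hκ).comp continuous_subtype_val).inner continuous_const⟩

/-- Arzelà–Ascoli applies because the kernel x ↦ `greenFn hκ x` is bounded and Lipschitz in L²: the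
image of the unit ball is uniformly bounded and equi-Lipschitz. -/
theorem isCompactOperator_resolventOnIcc {κ : ℝ} (hκ : 0 < κ) (R : ℝ) :
    IsCompactOperator (resolventOnIcc hκ R) := by
  refine ⟨closure (resolventOnIcc hκ R '' Metric.closedBall 0 1), ?_, ?_⟩
  · refine BoundedContinuousFunction.arzela_ascoli (Metric.closedBall 0 ‖greenFn hκ 0‖)
      (isCompact_closedBall _ _) _ ?_ ?_
    · rintro _ x ⟨h, hh, rfl⟩
      rw [mem_closedBall_zero_iff] at hh ⊢
      refine (norm_inner_greenFn_le hκ x h).trans ?_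
      exact mul_le_of_le_one_right (norm_nonneg _) hh
    · refine (LipschitzWith.uniformEquicontinuous _ (2 * κ * ‖greenFn hκ 0‖).toNNReal
        ?_).equicontinuous
      rintro ⟨_, h, hh, rfl⟩
      rw [mem_closedBall_zero_iff] at hh
      refine LipschitzWith.of_dist_le_mul fun x y ↦ ?_
      rw [Real.coe_toNNReal _ (by positivity), dist_eq_norm]
      change ‖inner ℂ (greenFn hκ x) h - inner ℂ (greenFn hκ y) h‖ ≤ _
      rw [← inner_sub_left]
      refine (norm_inner_le_norm _ _).trans ?_
      refine (mul_le_of_le_one_right (norm_nonneg _) hh).trans ?_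
      exact norm_greenFn_sub_le hκ x y
  · refine mem_of_superset (Metric.closedBall_mem_nhds 0 one_pos) fun h hh ↦ ?_
    exact subset_closure ⟨h, hh, rfl⟩

theorem memLp_mul_extend {U : ℝ →ᵇ ℝ} (hU : HasCompactSupport U) {R : ℝ} (hR : -R ≤ R)
    (f : Set.Icc (-R) R →ᵇ ℂ) :
    MemLp (fun x ↦ (U x : ℂ) * f (Set.projIcc (-R) R hR x)) 2 volume := by
  have hc : Continuous fun x ↦ (U x : ℂ) * f (Set.projIcc (-R) R hR x) := by
    have := f.continuous
    have := U.continuous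
    have := continuous_projIcc (h := hR)
    fun_prop
  refine hc.memLp_of_hasCompactSupport ?_
  exact (hU.comp_left (g := Complex.ofReal) Complex.ofReal_zero).mul_right

/-- For `U` continuous with compact support, `U (-d²/dx² + κ²)⁻¹` is compact. -/
theorem isCompactOperator_mulBounded_freeResolvent {U : ℝ →ᵇ ℝ} (hU : HasCompactSupport U)
    {κ : ℝ} (hκ : 0 < κ) :
    IsCompactOperator (mulBounded U ∘L freeResolvent κ hκ) := by
  obtain ⟨R, hRpos, hR⟩ : ∃ R : ℝ, 0 < R ∧ ∀ x, U x ≠ 0 → x ∈ Set.Icc (-R) R := by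
    obtain ⟨R, hR⟩ := hU.isCompact.isBounded.subset_closedBall 0
    refine ⟨max R 1, by positivity, fun x hx ↦ ?_⟩
    have := hR (subset_tsupport _ hx)
    rw [Real.closedBall_eq_Icc] at this
    exact ⟨by linarith [this.1, le_max_left R 1], by linarith [this.2, le_max_left R 1]⟩
  have hRR : -R ≤ R := by linarith
  set B : (Set.Icc (-R) R →ᵇ ℂ) → L2 := fun f ↦ (memLp_mul_extend hU hRR f).toLp
  have hB : Continuous B := by
    have hU2 : MemLp (fun x ↦ (U x : ℂ)) 2 volume :=
      (Complex.continuous_ofReal.comp U.continuous).memLp_of_hasCompactSupport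
        (hU.comp_left (g := Complex.ofReal) Complex.ofReal_zero)
    refine LipschitzWith.continuous (K := ‖hU2.toLp‖₊) (LipschitzWith.of_dist_le_mul fun f g ↦ ?_)
    rw [dist_eq_norm, dist_eq_norm, coe_nnnorm, mul_comm]
    refine Lp.norm_le_mul_norm_of_ae_le_mul ?_
    filter_upwards [Lp.coeFn_sub (B f) (B g), (memLp_mul_extend hU hRR f).coeFn_toLp,
      (memLp_mul_extend hU hRR g).coeFn_toLp, hU2.coeFn_toLp] with x h1 h2 h3 h4
    rw [h1, Pi.sub_apply, h2, h3, h4, ← mul_sub, norm_mul, mul_comm]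
    gcongr
    exact (f - g).norm_coe_le_norm _
  -- The operator factors through continuous functions on [-R, R]: a compact map into the sup norm,
  -- then a continuous map back to L². The extension by `Set.projIcc` is immaterial where U
  -- vanishes.
  have hcomp : (mulBounded U ∘L freeResolvent κ hκ : L2 → L2) = B ∘ resolventOnIcc hκ R := by
    ext1 h
    refine Lp.ext ?_
    change mulBounded U (freeResolvent κ hκ h) =ᵐ[volume] B (resolventOnIcc hκ R h)
    filter_upwards [coeFn_mulBounded U (freeResolvent κ hκ h), freeResolvent_ae_eq hκ h,
      (memLp_mul_extend hU hRR (resolventOnIcc hκ R h)).coeFn_toLp] with x h1 h2 h3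
    rw [h1, h3, h2]
    by_cases hx : U x = 0
    · simp [hx]
    · rw [Set.projIcc_of_mem hRR (hR x hx)]
      rfl
  rw [hcomp]
  exact (isCompactOperator_resolventOnIcc hκ R).continuous_comp hB

/-! ### A variational principle above the essential spectrum -/

section Abstract

variable {E : Type*} [NormedAddCommGroup E] [InnerProductSpace ℂ E]

theorem re_inner_add_smul_self {T : E →L[ℂ] E} (hT : ∀ x y, inner ℂ (T x) y = inner ℂ x (T y))
    (x y : E) (s : ℝ) :
    (inner ℂ (x + (s : ℂ) • y) (T (x + (s : ℂ) • y))).re =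
      (inner ℂ x (T x)).re + 2 * s * (inner ℂ x (T y)).re + s ^ 2 * (inner ℂ y (T y)).re := by
  have h : (inner ℂ y (T x)).re = (inner ℂ x (T y)).re := by
    rw [← hT y x, ← inner_conj_symm, Complex.conj_re]
  simp only [map_add, map_smul, inner_add_left, inner_add_right, inner_smul_left, inner_smul_right,
    Complex.add_re, Complex.conj_ofReal, Complex.re_ofReal_mul, h]
  ring

/-- Evaluate the nonnegative form at x - C⁻¹ D x. The consequence used later is that a sequence with
⟨x, D x⟩ → 0 satisfies D x → 0. -/
theorem norm_sq_le_of_nonneg_form {D : E →L[ℂ] E} (hD : ∀ x y, inner ℂ (D x) y = inner ℂ x (D y))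
    {M : Submodule ℂ E} (hM : ∀ x ∈ M, D x ∈ M) (hpos : ∀ x ∈ M, 0 ≤ (inner ℂ x (D x)).re)
    {C : ℝ} (hC : 0 < C) (hDC : ∀ x, ‖D x‖ ≤ C * ‖x‖) {x : E} (hx : x ∈ M) :
    ‖D x‖ ^ 2 ≤ C * (inner ℂ x (D x)).re := by
  have h := hpos (x + ((-C⁻¹ : ℝ) : ℂ) • D x) (M.add_mem hx (M.smul_mem _ (hM x hx)))
  rw [re_inner_add_smul_self hD] at h
  have h1 : (inner ℂ x (D (D x))).re = ‖D x‖ ^ 2 := by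
    rw [← hD x]; exact inner_self_eq_norm_sq (𝕜 := ℂ) (D x)
  have h2 : (inner ℂ (D x) (D (D x))).re ≤ C * ‖D x‖ ^ 2 := by
    refine (Complex.re_le_norm _).trans ((norm_inner_le_norm _ _).trans ?_)
    calc _ ≤ ‖D x‖ * (C * ‖D x‖) := by gcongr; exact hDC _
      _ = _ := by ring
  rw [h1] at h
  have h3 : (-C⁻¹) ^ 2 * (inner ℂ (D x) (D (D x))).re ≤ C⁻¹ * ‖D x‖ ^ 2 := by
    calc _ ≤ (-C⁻¹) ^ 2 * (C * ‖D x‖ ^ 2) := by gcongr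
      _ = _ := by field_simp
  have h4 : C⁻¹ * ‖D x‖ ^ 2 ≤ (inner ℂ x (D x)).re := by linarith
  rwa [inv_mul_le_iff₀ hC] at h4

/-- A bound for the form of `Γ⁻¹ - B` at a trial vector bounds the form of its inverse. -/
theorem form_resolvent_ge {T : E →L[ℂ] E} (hT : ∀ x y, inner ℂ (T x) y = inner ℂ x (T y))
    (hpos : ∀ x, 0 ≤ (inner ℂ x (T x)).re) {f g : E} (hfg : f = T g) {d : ℝ} (hd : 0 < d)
    (h : (inner ℂ f g).re ≤ d * ‖f‖ ^ 2) : d⁻¹ * ‖f‖ ^ 2 ≤ (inner ℂ f (T f)).re := by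
  -- Since T g = f, positivity of T at f - d⁻¹ g reads ⟨f, T f⟩ - 2 d⁻¹ ‖f‖² + d⁻² ⟨f, g⟩ ≥ 0, and
  -- the last term is at most d⁻¹ ‖f‖².
  have h1 := hpos (f + ((-d⁻¹ : ℝ) : ℂ) • g)
  rw [re_inner_add_smul_self hT, ← hfg] at h1
  have h2 : (inner ℂ f f).re = ‖f‖ ^ 2 := inner_self_eq_norm_sq (𝕜 := ℂ) f
  have h3 : (inner ℂ g f).re = (inner ℂ f g).re := by rw [← inner_conj_symm, Complex.conj_re]
  have h4 : (-d⁻¹) ^ 2 * (inner ℂ f g).re ≤ d⁻¹ * ‖f‖ ^ 2 := by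
    calc _ ≤ (-d⁻¹) ^ 2 * (d * ‖f‖ ^ 2) := by gcongr
      _ = _ := by field_simp
  rw [h2, h3] at h1
  linarith

variable [CompleteSpace E]

/-- If `T = Γ + K` is symmetric with `Γ ≤ a` and `K` compact, then a supremum of the quadratic form
of `T` over a closed invariant subspace that exceeds `a` is attained at an eigenvector. -/
theorem exists_eigenvector_of_form_gt {T Γ K : E →L[ℂ] E}
    (hT : ∀ x y, inner ℂ (T x) y = inner ℂ x (T y)) (hTK : T = Γ + K)
    (hK : IsCompactOperator K) {a : ℝ} (hΓ : ∀ x, (inner ℂ x (Γ x)).re ≤ a * ‖x‖ ^ 2)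
    {M : Submodule ℂ E} (hMc : IsClosed (M : Set E)) (hM : ∀ x ∈ M, T x ∈ M)
    {τ : ℝ} (hτ : a < τ) {x₀ : E} (hx₀ : x₀ ∈ M) (hx₀0 : x₀ ≠ 0)
    (hform : τ * ‖x₀‖ ^ 2 ≤ (inner ℂ x₀ (T x₀)).re) :
    ∃ ψ ∈ M, ‖ψ‖ = 1 ∧ ∃ θ : ℝ, τ ≤ θ ∧ T ψ = (θ : ℂ) • ψ := by
  set S : Set ℝ := (fun x ↦ (inner ℂ x (T x)).re) '' {x | x ∈ M ∧ ‖x‖ = 1}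
  have hnorm : ∀ x ∈ M, x ≠ 0 → (((‖x‖⁻¹ : ℝ) : ℂ) • x ∈ M ∧ ‖((‖x‖⁻¹ : ℝ) : ℂ) • x‖ = 1) ∧
      (inner ℂ (((‖x‖⁻¹ : ℝ) : ℂ) • x) (T (((‖x‖⁻¹ : ℝ) : ℂ) • x))).re =
        (inner ℂ x (T x)).re / ‖x‖ ^ 2 := by
    intro x hx hx0
    have : ‖x‖ ≠ 0 := norm_ne_zero_iff.mpr hx0
    refine ⟨⟨M.smul_mem _ hx, ?_⟩, ?_⟩
    · rw [norm_smul, Complex.norm_real, norm_inv, norm_norm, inv_mul_cancel₀ this]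
    · rw [map_smul, inner_smul_left, inner_smul_right, Complex.conj_ofReal, Complex.re_ofReal_mul,
        Complex.re_ofReal_mul]
      field_simp
  have hSne : S.Nonempty := ⟨_, _, (hnorm x₀ hx₀ hx₀0).1, rfl⟩
  have hSb : BddAbove S := by
    refine ⟨‖T‖, ?_⟩
    rintro _ ⟨x, ⟨_, hx⟩, rfl⟩
    refine (Complex.re_le_norm _).trans ((norm_inner_le_norm _ _).trans ?_)
    rw [hx, one_mul]
    simpa [hx] using T.le_opNorm x
  set θ := sSup S
  have hθτ : τ ≤ θ := by
    refine le_trans ?_ (le_csSup hSb ⟨_, (hnorm x₀ hx₀ hx₀0).1, rfl⟩)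
    beta_reduce
    rw [(hnorm x₀ hx₀ hx₀0).2, le_div_iff₀ (by positivity)]
    exact hform
  have hle : ∀ x ∈ M, (inner ℂ x (T x)).re ≤ θ * ‖x‖ ^ 2 := by
    intro x hx
    by_cases hx0 : x = 0
    · simp [hx0]
    · have := le_csSup hSb ⟨_, (hnorm x hx hx0).1, rfl⟩
      simp only at this
      rwa [(hnorm x hx hx0).2, div_le_iff₀ (by positivity)] at this
  set D : E →L[ℂ] E := (θ : ℂ) • ContinuousLinearMap.id ℂ E - T
  have hDapp : ∀ x, D x = (θ : ℂ) • x - T x := fun x ↦ by simp [D]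
  have hDsymm : ∀ x y, inner ℂ (D x) y = inner ℂ x (D y) := by
    intro x y
    rw [hDapp, hDapp, inner_sub_left, inner_sub_right, inner_smul_left, inner_smul_right, hT,
      Complex.conj_ofReal]
  have hDform : ∀ x, (inner ℂ x (D x)).re = θ * ‖x‖ ^ 2 - (inner ℂ x (T x)).re := by
    intro x
    rw [hDapp, inner_sub_right, inner_smul_right, Complex.sub_re, Complex.re_ofReal_mul]
    congr 2
    exact inner_self_eq_norm_sq (𝕜 := ℂ) x
  have hDM : ∀ x ∈ M, D x ∈ M := fun x hx ↦ by
    rw [hDapp]; exact M.sub_mem (M.smul_mem _ hx) (hM x hx)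
  obtain ⟨s, -, hs, hsS⟩ := exists_seq_tendsto_sSup hSne hSb
  choose f hf hfs using hsS
  -- D = θ - T is nonnegative on M, so a maximizing sequence of unit vectors is a sequence of
  -- approximate eigenvectors.
  have hDf : Tendsto (fun n ↦ D (f n)) atTop (𝓝 0) := by
    rw [tendsto_zero_iff_norm_tendsto_zero]
    have hb : ∀ n, ‖D (f n)‖ ^ 2 ≤ (‖D‖ + 1) * (θ - s n) := by
      intro n
      have := norm_sq_le_of_nonneg_form hDsymm hDM
        (fun x hx ↦ by rw [hDform]; linarith [hle x hx]) (C := ‖D‖ + 1) (by positivity)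
        (fun x ↦ (D.le_opNorm x).trans (by gcongr; linarith)) (hf n).1
      rwa [hDform, (hf n).2, one_pow, mul_one,
        show (inner ℂ (f n) (T (f n))).re = s n from hfs n] at this
    have hlim : Tendsto (fun n ↦ (‖D‖ + 1) * (θ - s n)) atTop (𝓝 0) := by
      have := (tendsto_const_nhds (x := θ)).sub hs
      simpa [θ] using this.const_mul (‖D‖ + 1)
    have hsq : Tendsto (fun n ↦ ‖D (f n)‖ ^ 2) atTop (𝓝 0) :=
      squeeze_zero (fun n ↦ by positivity) hb hlim
    simpa using hsq.sqrt
  obtain ⟨g, φ, hφ, hg⟩ : ∃ g, ∃ φ : ℕ → ℕ, StrictMono φ ∧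
      Tendsto (fun n ↦ K (f (φ n))) atTop (𝓝 g) := by
    obtain ⟨C, hC, hsub⟩ := hK.image_closedBall_subset_compact (f := (K : E →ₗ[ℂ] E)) 1
    obtain ⟨g, -, φ, hφ, hg⟩ := hC.tendsto_subseq (x := fun n ↦ K (f n))
      fun n ↦ hsub ⟨f n, by simp [(hf n).2], rfl⟩
    exact ⟨g, φ, hφ, hg⟩
  have hlim : Tendsto (fun n ↦ D (f (φ n)) + K (f (φ n))) atTop (𝓝 (0 + g)) :=
    (hDf.comp hφ.tendsto_atTop).add hg
  -- D + K = θ - Γ is coercive because Γ ≤ a < θ. Convergence of D f + K f along the subsequence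
  -- therefore makes f itself Cauchy.
  have hbelow : ∀ x, (θ - a) * ‖x‖ ≤ ‖D x + K x‖ := by
    intro x
    rcases (norm_nonneg x).eq_or_lt with h | h
    · rw [← h]; simp
    refine le_of_mul_le_mul_right ?_ h
    have h1 : (inner ℂ x (D x + K x)).re = θ * ‖x‖ ^ 2 - (inner ℂ x (Γ x)).re := by
      rw [inner_add_right, Complex.add_re, hDform, hTK]
      simp only [add_apply, inner_add_right, Complex.add_re]
      ring
    have h2 := (Complex.re_le_norm _).trans (norm_inner_le_norm (𝕜 := ℂ) x (D x + K x))
    nlinarith [hΓ x]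
  have hθa : 0 < θ - a := by linarith
  have hcauchy : CauchySeq (fun n ↦ f (φ n)) := by
    rw [Metric.cauchySeq_iff]
    intro ε hε
    obtain ⟨N, hN⟩ := Metric.cauchySeq_iff.mp hlim.cauchySeq ((θ - a) * ε) (by positivity)
    refine ⟨N, fun m hm n hn ↦ ?_⟩
    have h1 := hN m hm n hn
    have h2 := hbelow (f (φ m) - f (φ n))
    rw [dist_eq_norm] at h1 ⊢
    rw [map_sub, map_sub, sub_add_sub_comm] at h2
    exact lt_of_mul_lt_mul_left (h2.trans_lt h1) hθa.le
  obtain ⟨ψ, hψ⟩ := cauchySeq_tendsto_of_complete hcauchy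
  refine ⟨ψ, ?_, ?_, θ, hθτ, ?_⟩
  · exact hMc.mem_of_tendsto hψ (Eventually.of_forall fun n ↦ (hf _).1)
  · refine tendsto_nhds_unique hψ.norm ?_
    simp [(hf _).2]
  · have h1 : D ψ = 0 := tendsto_nhds_unique ((D.continuous.tendsto ψ).comp hψ)
      (hDf.comp hφ.tendsto_atTop)
    rw [hDapp, sub_eq_zero] at h1
    exact h1.symm

/-- Min-max principle: eigenvalues of `T = Γ + K` above `a ≥ Γ` are bounded below by the values of
the form of `T` on a flag of trial subspaces. -/
theorem exists_orthonormal_eigenvectors {T Γ K : E →L[ℂ] E}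
    (hT : ∀ x y, inner ℂ (T x) y = inner ℂ x (T y)) (hTK : T = Γ + K)
    (hK : IsCompactOperator K) {a : ℝ} (hΓ : ∀ x, (inner ℂ x (Γ x)).re ≤ a * ‖x‖ ^ 2)
    {N : ℕ} (x : Fin N → E) (hx : LinearIndependent ℂ x) (τ : Fin N → ℝ) (hτ : ∀ k, a < τ k)
    (hform : ∀ (k : Fin N) (c : Fin N → ℂ), (∀ i, k < i → c i = 0) →
      τ k * ‖∑ i, c i • x i‖ ^ 2 ≤ (inner ℂ (∑ i, c i • x i) (T (∑ i, c i • x i))).re) :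
    ∃ (ψ : Fin N → E) (θ : Fin N → ℝ), Orthonormal ℂ ψ ∧
      (∀ k, T (ψ k) = (θ k : ℂ) • ψ k) ∧ ∀ k, τ k ≤ θ k := by
  induction N with
  | zero => exact ⟨Fin.elim0, Fin.elim0, ⟨fun k ↦ k.elim0, fun k ↦ k.elim0⟩, fun k ↦ k.elim0,
      fun k ↦ k.elim0⟩
  | succ N ih =>
    obtain ⟨ψ, θ, hψ, hev, hθ⟩ := ih (fun i ↦ x i.castSucc)
      (hx.comp _ (Fin.castSucc_injective N)) (fun i ↦ τ i.castSucc) (fun k ↦ hτ _) (by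
        intro k c hc
        have := hform k.castSucc (Fin.snoc c 0) (by
          intro i
          refine Fin.lastCases (fun _ ↦ by simp) (fun j hj ↦ ?_) i
          rw [Fin.snoc_castSucc]
          exact hc j (by simpa using hj))
        simpa [Fin.sum_univ_castSucc] using this)
    set M : Submodule ℂ E := (Submodule.span ℂ (Set.range ψ))ᗮ
    have hmem : ∀ y, y ∈ M ↔ ∀ i, inner ℂ (ψ i) y = 0 := by
      intro y
      constructor
      · intro h i
        exact h _ (Submodule.subset_span ⟨i, rfl⟩)
      · intro h
        rw [Submodule.mem_orthogonal]
        intro u hu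
        induction hu using Submodule.span_induction with
        | mem u hu => obtain ⟨i, rfl⟩ := hu; exact h i
        | zero => simp
        | add u v _ _ hu hv => rw [inner_add_left, hu, hv, add_zero]
        | smul c u _ hu => rw [inner_smul_left, hu, mul_zero]
    -- Orthogonality to N eigenvectors imposes N linear conditions on N + 1 coefficients. The
    -- resulting trial vector lies in the invariant complement M, where the next eigenvector is
    -- sought.
    obtain ⟨c, hc0, hcM⟩ : ∃ c : Fin (N + 1) → ℂ, c ≠ 0 ∧ ∑ i, c i • x i ∈ M := by
      let L : (Fin (N + 1) → ℂ) →ₗ[ℂ] (Fin N → ℂ) :=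
        LinearMap.pi fun j ↦ (innerₛₗ ℂ (ψ j)) ∘ₗ Fintype.linearCombination ℂ x
      have hker : LinearMap.ker L ≠ ⊥ := LinearMap.ker_ne_bot_of_finrank_lt (by simp)
      obtain ⟨c, hc, hc0⟩ := Submodule.exists_mem_ne_zero_of_ne_bot hker
      refine ⟨c, hc0, (hmem _).mpr fun j ↦ ?_⟩
      have := congrFun (LinearMap.mem_ker.mp hc) j
      exact this
    have hne : ∑ i, c i • x i ≠ 0 := by
      intro h
      exact hc0 (funext (Fintype.linearIndependent_iff.mp hx c h))
    obtain ⟨ψ', hψ'M, hψ'1, θ', hθ', hev'⟩ := exists_eigenvector_of_form_gt hT hTK hK hΓ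
      (Submodule.isClosed_orthogonal _) (M := M) (fun y hy ↦ by
        rw [hmem] at hy ⊢
        intro i
        rw [← hT, hev, inner_smul_left, hy, mul_zero]) (hτ (Fin.last N)) hcM hne
      (hform (Fin.last N) c (fun i hi ↦ absurd hi (not_lt.mpr (Fin.le_last i))))
    rw [hmem] at hψ'M
    refine ⟨Fin.snoc ψ ψ', Fin.snoc θ θ', ?_, ?_, ?_⟩
    · rw [orthonormal_iff_ite] at hψ ⊢
      intro i j
      refine Fin.lastCases ?_ (fun i ↦ ?_) i <;> refine Fin.lastCases ?_ (fun j ↦ ?_) j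
      · simp [hψ'1]
      · simp only [Fin.snoc_last, Fin.snoc_castSucc]
        rw [← inner_conj_symm, hψ'M j, if_neg (Fin.castSucc_lt_last j).ne', map_zero]
      · simp only [Fin.snoc_last, Fin.snoc_castSucc]
        rw [hψ'M i, if_neg (Fin.castSucc_lt_last i).ne]
      · simp [hψ i j]
    · refine Fin.lastCases (by simpa using hev') (fun i ↦ by simpa using hev i)
    · refine Fin.lastCases (by simpa using hθ') (fun i ↦ by simpa using hθ i)

/-- The perturbed resolvent `(Γ⁻¹ - B)⁻¹` for a symmetric `B` that is smaller than `Γ⁻¹`. -/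
theorem exists_perturbed_resolvent {Γ B : E →L[ℂ] E} {κ u : ℝ} (hκ : 0 < κ) (hu : u < κ ^ 2)
    (hΓsymm : ∀ x y, inner ℂ (Γ x) y = inner ℂ x (Γ y))
    (hΓ : ∀ x, κ ^ 2 * ‖Γ x‖ ^ 2 ≤ (inner ℂ x (Γ x)).re)
    (hΓn : ∀ x, κ ^ 2 * ‖Γ x‖ ≤ ‖x‖)
    (hBsymm : ∀ x y, inner ℂ (B x) y = inner ℂ x (B y)) (hB : ∀ x, ‖B x‖ ≤ u * ‖x‖) :
    ∃ T : E →L[ℂ] E, (∀ x y, inner ℂ (T x) y = inner ℂ x (T y)) ∧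
      (∀ x, 0 ≤ (inner ℂ x (T x)).re) ∧ (∀ x, T x = Γ (x + B (T x))) ∧
      (∀ h, T (h - B (Γ h)) = Γ h) ∧ T = Γ + T ∘L (B ∘L Γ) := by
  have hu0 : 0 ≤ max u 0 / κ ^ 2 := by positivity
  -- This makes 1 - BΓ invertible by a Neumann series; with Y its inverse, the perturbed resolvent
  -- is Γ Y.
  have hlt : ‖B ∘L Γ‖ < 1 := by
    refine lt_of_le_of_lt (ContinuousLinearMap.opNorm_le_bound _ hu0 fun x ↦ ?_)
      ((div_lt_one (by positivity)).mpr (max_lt hu (by positivity)))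
    have h1 := hB (Γ x)
    have h2 : ‖Γ x‖ ≤ ‖x‖ / κ ^ 2 := by
      rw [le_div_iff₀' (by positivity)]; exact hΓn x
    calc ‖B (Γ x)‖ ≤ max u 0 * ‖Γ x‖ := h1.trans (by gcongr; exact le_max_left _ _)
      _ ≤ max u 0 * (‖x‖ / κ ^ 2) := by gcongr
      _ = _ := by ring
  set X := Units.oneSub (B ∘L Γ) hlt
  have hX1 : (1 - B ∘L Γ) * (↑X⁻¹ : E →L[ℂ] E) = 1 := X.mul_inv
  have hX2 : (↑X⁻¹ : E →L[ℂ] E) * (1 - B ∘L Γ) = 1 := X.inv_mul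
  set Y : E →L[ℂ] E := ↑X⁻¹
  have hY1 : ∀ x, Y x - B (Γ (Y x)) = x := fun x ↦ by
    simpa using congrArg (fun A : E →L[ℂ] E ↦ A x) hX1
  have hY2 : ∀ x, Y (x - B (Γ x)) = x := fun x ↦ by
    simpa using congrArg (fun A : E →L[ℂ] E ↦ A x) hX2
  refine ⟨Γ ∘L Y, ?_, ?_, ?_, ?_, ?_⟩
  · intro x y
    change inner ℂ (Γ (Y x)) y = inner ℂ x (Γ (Y y))
    conv_lhs => rw [← hY1 y]
    conv_rhs => rw [← hY1 x]
    rw [inner_sub_left, inner_sub_right, hΓsymm, hBsymm]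
  · intro x
    change 0 ≤ (inner ℂ x (Γ (Y x))).re
    -- With y = Y x, positivity becomes ⟨BΓy, Γy⟩ ≤ ⟨y, Γy⟩: the left side is at most u ‖Γy‖², the
    -- right side at least κ² ‖Γy‖².
    have hx : inner ℂ x (Γ (Y x)) = inner ℂ (Y x - B (Γ (Y x))) (Γ (Y x)) := by rw [hY1]
    rw [hx, inner_sub_left, Complex.sub_re, sub_nonneg]
    refine le_trans ?_ (hΓ (Y x))
    refine (Complex.re_le_norm _).trans ((norm_inner_le_norm _ _).trans ?_)
    have h1 := hB (Γ (Y x))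
    calc _ ≤ (κ ^ 2 * ‖Γ (Y x)‖) * ‖Γ (Y x)‖ := by
          gcongr
          exact h1.trans (by gcongr)
      _ = _ := by ring
  · intro x
    change Γ (Y x) = Γ (x + B (Γ (Y x)))
    rw [← sub_eq_iff_eq_add.mp (hY1 x)]
  · intro h
    change Γ (Y _) = _
    rw [hY2]
  · ext x
    change Γ (Y x) = Γ x + Γ (Y (B (Γ x)))
    rw [← map_add]
    congr 1
    have := hY2 x
    rw [map_sub] at this
    exact sub_eq_iff_eq_add.mp this

end Abstract

/-! ### Removing a bound state by double commutation -/

/-- `ψ`, with derivative `ψ'`, is a bound state of `-d²/dx² + W` with energy `-ν²` that equals a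
nonzero multiple of `e^{νx}` to the left of `R` and vanishes at `+∞`. -/
structure IsBoundState (W : ℝ → ℝ) (R ν : ℝ) (ψ ψ' : ℝ → ℝ) : Prop where
  hasDerivAt : ∀ x, HasDerivAt ψ (ψ' x) x
  hasDerivAt' : ∀ x, HasDerivAt ψ' ((W x + ν ^ 2) * ψ x) x
  left : ∀ x ≤ R, ψ x ≠ 0 ∧ ψ' x = ν * ψ x
  tendsto : Tendsto ψ atTop (𝓝 0)
  tendsto' : Tendsto ψ' atTop (𝓝 0)

/-- The accumulated mass `∫_{-∞}^x ψ²` of a bound state. -/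
def mass (R ν : ℝ) (ψ : ℝ → ℝ) (x : ℝ) : ℝ := ψ R ^ 2 / (2 * ν) + ∫ y in R..x, ψ y ^ 2

/-- The logarithmic second derivative `(log ∫_{-∞}^x ψ²)''`. -/
def logMassDeriv₂ (R ν : ℝ) (ψ ψ' : ℝ → ℝ) (x : ℝ) : ℝ :=
  2 * ψ x * ψ' x / mass R ν ψ x - ψ x ^ 4 / mass R ν ψ x ^ 2

/-- The potential from which the bound state `ψ` has been removed. -/
def commutedPotential (W : ℝ → ℝ) (R ν : ℝ) (ψ ψ' : ℝ → ℝ) (x : ℝ) : ℝ :=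
  W x - 2 * logMassDeriv₂ R ν ψ ψ' x

namespace IsBoundState

variable {W : ℝ → ℝ} {R ν : ℝ} {ψ ψ' : ℝ → ℝ}

theorem continuous (h : IsBoundState W R ν ψ ψ') : Continuous ψ :=
  continuous_iff_continuousAt.mpr fun x ↦ (h.hasDerivAt x).continuousAt

theorem continuous' (h : IsBoundState W R ν ψ ψ') : Continuous ψ' :=
  continuous_iff_continuousAt.mpr fun x ↦ (h.hasDerivAt' x).continuousAt

theorem hasDerivAt_mass (h : IsBoundState W R ν ψ ψ') (x : ℝ) :
    HasDerivAt (mass R ν ψ) (ψ x ^ 2) x :=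
  (hasDerivAt_integral_of_continuous (h.continuous.pow 2) x).const_add _

theorem continuous_mass (h : IsBoundState W R ν ψ ψ') : Continuous (mass R ν ψ) :=
  continuous_iff_continuousAt.mpr fun x ↦ (h.hasDerivAt_mass x).continuousAt

/-- Where ψ' = νψ, the function ψ²/(2ν) is a primitive of ψ². Hence the constant in `mass` is the
mass of (-∞, R], and log m is affine there, so commutation changes nothing to the left of R. -/
theorem mass_eq_left (h : IsBoundState W R ν ψ ψ') (hν : 0 < ν) {x : ℝ} (hx : x ≤ R) :
    mass R ν ψ x = ψ x ^ 2 / (2 * ν) := by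
  have h1 : ∫ y in R..x, ψ y ^ 2 = ψ x ^ 2 / (2 * ν) - ψ R ^ 2 / (2 * ν) := by
    refine intervalIntegral.integral_eq_sub_of_hasDerivAt (f := fun y ↦ ψ y ^ 2 / (2 * ν))
      (fun y hy ↦ ?_) ((h.continuous.pow 2).intervalIntegrable _ _)
    rw [Set.uIcc_of_ge hx] at hy
    convert! ((h.hasDerivAt y).pow 2).div_const (2 * ν) using 1
    rw [(h.left y hy.2).2]
    field_simp
    push_cast
    ring
  rw [mass, h1]; ring

theorem mass_pos_left (h : IsBoundState W R ν ψ ψ') (hν : 0 < ν) {x : ℝ} (hx : x ≤ R) :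
    0 < mass R ν ψ x := by
  rw [h.mass_eq_left hν hx]
  have := (h.left x hx).1
  positivity

theorem monotone_mass (h : IsBoundState W R ν ψ ψ') : Monotone (mass R ν ψ) :=
  monotone_of_hasDerivAt_nonneg h.hasDerivAt_mass fun x ↦ by positivity

theorem mass_pos (h : IsBoundState W R ν ψ ψ') (hν : 0 < ν) (x : ℝ) : 0 < mass R ν ψ x := by
  rcases le_total x R with hx | hx
  · exact h.mass_pos_left hν hx
  · exact (h.mass_pos_left hν le_rfl).trans_le (h.monotone_mass hx)

theorem continuous_commutedPotential (h : IsBoundState W R ν ψ ψ') (hν : 0 < ν)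
    (hW : Continuous W) : Continuous (commutedPotential W R ν ψ ψ') := by
  have h1 := h.continuous
  have h2 := h.continuous'
  have h3 := h.continuous_mass
  have h4 : ∀ x, mass R ν ψ x ≠ 0 := fun x ↦ (h.mass_pos hν x).ne'
  have h5 : ∀ x, mass R ν ψ x ^ 2 ≠ 0 := fun x ↦ pow_ne_zero _ (h4 x)
  unfold commutedPotential logMassDeriv₂
  fun_prop (disch := assumption)

theorem tendsto_div_mass (h : IsBoundState W R ν ψ ψ') (hν : 0 < ν) {f : ℝ → ℝ}
    (hf : Tendsto f atTop (𝓝 0)) : Tendsto (fun x ↦ f x / mass R ν ψ x) atTop (𝓝 0) := by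
  have hR := h.mass_pos_left hν le_rfl
  refine squeeze_zero_norm' (a := fun x ↦ ‖f x‖ / mass R ν ψ R) ?_ ?_
  · filter_upwards [eventually_ge_atTop R] with x hx
    rw [norm_div, Real.norm_of_nonneg (h.mass_pos hν x).le]
    gcongr
    exact h.monotone_mass hx
  · simpa using hf.norm.div_const (mass R ν ψ R)

/-- The primitive of `(log m)'' (W - (log m)'')`, where `m` is the accumulated mass. -/
def primitive (R ν : ℝ) (ψ ψ' : ℝ → ℝ) (x : ℝ) : ℝ :=
  (ψ' x ^ 2 - ν ^ 2 * ψ x ^ 2) / mass R ν ψ x - ψ x ^ 3 * ψ' x / mass R ν ψ x ^ 2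
    + ψ x ^ 6 / (3 * mass R ν ψ x ^ 3)

/-- After inserting ψ'' = (W + ν²)ψ and m' = ψ² this is an algebraic identity. -/
theorem hasDerivAt_primitive (h : IsBoundState W R ν ψ ψ') (hν : 0 < ν) (x : ℝ) :
    HasDerivAt (primitive R ν ψ ψ')
      (logMassDeriv₂ R ν ψ ψ' x * (W x - logMassDeriv₂ R ν ψ ψ' x)) x := by
  have hm : mass R ν ψ x ≠ 0 := (h.mass_pos hν x).ne'
  have h0 := h.hasDerivAt x
  have h1 := h.hasDerivAt' x
  have h2 := h.hasDerivAt_mass x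
  convert! ((((h1.pow 2).sub ((h0.pow 2).const_mul (ν ^ 2))).div h2 hm).sub
    (((h0.pow 3).mul h1).div (h2.pow 2) (pow_ne_zero 2 hm))).add
    ((h0.pow 6).div ((h2.pow 3).const_mul 3) (mul_ne_zero three_ne_zero (pow_ne_zero 3 hm))) using 1
  simp only [logMassDeriv₂, Pi.pow_apply, Pi.sub_apply, Pi.mul_apply]
  field_simp
  ring

theorem primitive_left (h : IsBoundState W R ν ψ ψ') (hν : 0 < ν) :
    primitive R ν ψ ψ' R = -(4 / 3 * ν ^ 3) := by
  have h1 := (h.left R le_rfl).1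
  rw [primitive, h.mass_eq_left hν le_rfl, (h.left R le_rfl).2]
  field_simp
  ring

theorem tendsto_primitive (h : IsBoundState W R ν ψ ψ') (hν : 0 < ν) :
    Tendsto (primitive R ν ψ ψ') atTop (𝓝 0) := by
  have h0 := h.tendsto
  have h1 := h.tendsto'
  have t1 := h.tendsto_div_mass hν (f := fun x ↦ ψ' x ^ 2 - ν ^ 2 * ψ x ^ 2) (by
    simpa using (h1.pow 2).sub ((h0.pow 2).const_mul (ν ^ 2)))
  have t2 := h.tendsto_div_mass hν (h.tendsto_div_mass hν (f := fun x ↦ ψ x ^ 3 * ψ' x) (by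
    simpa using (h0.pow 3).mul h1))
  have t3 := h.tendsto_div_mass hν (h.tendsto_div_mass hν (h.tendsto_div_mass hν
    (f := fun x ↦ ψ x ^ 6 / 3) (by simpa using (h0.pow 6).div_const 3)))
  have t := (t1.sub t2).add t3
  simp only [sub_zero, add_zero] at t
  refine t.congr fun x ↦ ?_
  have hm : mass R ν ψ x ≠ 0 := (h.mass_pos hν x).ne'
  rw [primitive]
  field_simp

/-- With λ = (log m)'', W² - (W - 2λ)² = 4λ(W - λ) is four times the derivative of the primitive.
Its value -(4/3)ν³ at R produces the constant 16/3; the term at x tends to 0. -/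
theorem integral_sq_eq (h : IsBoundState W R ν ψ ψ') (hν : 0 < ν) (hW : Continuous W) (x : ℝ) :
    ∫ y in R..x, W y ^ 2 = (∫ y in R..x, commutedPotential W R ν ψ ψ' y ^ 2) + 16 / 3 * ν ^ 3
      + 4 * primitive R ν ψ ψ' x := by
  have hc := h.continuous_commutedPotential hν hW
  have hInt : IntervalIntegrable (fun y ↦ W y ^ 2 - commutedPotential W R ν ψ ψ' y ^ 2)
    volume R x := ((hW.pow 2).sub (hc.pow 2)).intervalIntegrable _ _
  have h1 : ∫ y in R..x, (W y ^ 2 - commutedPotential W R ν ψ ψ' y ^ 2) =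
      4 * primitive R ν ψ ψ' x - 4 * primitive R ν ψ ψ' R := by
    refine intervalIntegral.integral_eq_sub_of_hasDerivAt
      (f := fun y ↦ 4 * primitive R ν ψ ψ' y) (fun y _ ↦ ?_) hInt
    convert! (h.hasDerivAt_primitive hν y).const_mul 4 using 1
    rw [commutedPotential]; ring
  rw [intervalIntegral.integral_sub (f := fun y ↦ W y ^ 2)
    (g := fun y ↦ commutedPotential W R ν ψ ψ' y ^ 2) ((hW.pow 2).intervalIntegrable _ _)
    ((hc.pow 2).intervalIntegrable _ _), h.primitive_left hν] at h1
  linarith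

/-- The other bound states survive the removal of one of them. -/
theorem exists_commuted (h : IsBoundState W R ν ψ ψ') (hν : 0 < ν) {ν₁ : ℝ} {φ φ' : ℝ → ℝ}
    (h₁ : IsBoundState W R ν₁ φ φ') (hν₁ : 0 < ν₁) (hne : ν₁ ≠ ν) :
    ∃ χ χ' : ℝ → ℝ, IsBoundState (commutedPotential W R ν ψ ψ') R ν₁ χ χ' := by
  have hd : ν ^ 2 - ν₁ ^ 2 ≠ 0 := by
    rw [sq_sub_sq]
    exact mul_ne_zero (by positivity) (sub_ne_zero.mpr hne.symm)
  -- The Wronskian quotient is ∫_{-∞}^x ψφ in closed form; its decay at +∞ expresses the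
  -- orthogonality of ψ and φ. The transformed state is then χ = φ - ψ n / m.
  set n : ℝ → ℝ := fun x ↦ (ψ' x * φ x - ψ x * φ' x) / (ν ^ 2 - ν₁ ^ 2) with hn
  have hnd : ∀ x, HasDerivAt n (ψ x * φ x) x := by
    intro x
    convert! (((h.hasDerivAt' x).mul (h₁.hasDerivAt x)).sub
      ((h.hasDerivAt x).mul (h₁.hasDerivAt' x))).div_const (ν ^ 2 - ν₁ ^ 2) using 1
    field_simp
    ring
  have hnt : Tendsto n atTop (𝓝 0) := by
    simpa using ((h.tendsto'.mul h₁.tendsto).sub (h.tendsto.mul h₁.tendsto')).div_const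
      (ν ^ 2 - ν₁ ^ 2)
  refine ⟨fun x ↦ φ x - ψ x * n x / mass R ν ψ x,
    fun x ↦ φ' x - (ψ' x * n x + ψ x ^ 2 * φ x) / mass R ν ψ x
      + ψ x ^ 3 * n x / mass R ν ψ x ^ 2, ?_, ?_, ?_, ?_, ?_⟩
  · intro x
    have hm : mass R ν ψ x ≠ 0 := (h.mass_pos hν x).ne'
    convert! (h₁.hasDerivAt x).sub
      (((h.hasDerivAt x).mul (hnd x)).div (h.hasDerivAt_mass x) hm) using 1
    simp only [Pi.mul_apply]
    field_simp
    ring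
  · intro x
    have hm : mass R ν ψ x ≠ 0 := (h.mass_pos hν x).ne'
    have hnx : ψ' x * φ x - ψ x * φ' x = n x * (ν ^ 2 - ν₁ ^ 2) := by
      rw [hn]; field_simp
    convert! ((h₁.hasDerivAt' x).sub
      ((((h.hasDerivAt' x).mul (hnd x)).add
        (((h.hasDerivAt x).pow 2).mul (h₁.hasDerivAt x))).div (h.hasDerivAt_mass x) hm)).add
      ((((h.hasDerivAt x).pow 3).mul (hnd x)).div ((h.hasDerivAt_mass x).pow 2)
        (pow_ne_zero 2 hm)) using 1
    simp only [commutedPotential, logMassDeriv₂, Pi.pow_apply, Pi.mul_apply, Pi.add_apply]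
    generalize n x = nx at *
    field_simp
    linear_combination (-ψ x * mass R ν ψ x ^ 3) * hnx
  · intro x hx
    obtain ⟨h2, h3⟩ := h.left x hx
    obtain ⟨h4, h5⟩ := h₁.left x hx
    have h6 : n x = ψ x * φ x / (ν + ν₁) := by
      rw [hn]
      simp only [h3, h5]
      field_simp
      ring
    -- On the left, commutation only rescales the exponential tail, by a factor that is nonzero
    -- because the energies differ.
    have h7 : φ x - ψ x * n x / mass R ν ψ x = (ν₁ - ν) / (ν₁ + ν) * φ x := by
      rw [h6, h.mass_eq_left hν hx]
      field_simp
      ring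
    refine ⟨?_, ?_⟩
    · rw [h7]
      exact mul_ne_zero (div_ne_zero (sub_ne_zero.mpr hne) (by positivity)) h4
    · rw [h7, h6, h.mass_eq_left hν hx, h3, h5]
      field_simp
      ring
  · simpa using h₁.tendsto.sub (h.tendsto_div_mass hν (by simpa using h.tendsto.mul hnt))
  · have t1 := h.tendsto_div_mass hν (f := fun x ↦ ψ' x * n x + ψ x ^ 2 * φ x) (by
      simpa using (h.tendsto'.mul hnt).add ((h.tendsto.pow 2).mul h₁.tendsto))
    have t2 := h.tendsto_div_mass hν (h.tendsto_div_mass hν (f := fun x ↦ ψ x ^ 3 * n x) (by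
      simpa using (h.tendsto.pow 3).mul hnt))
    have t := (h₁.tendsto'.sub t1).add t2
    simp only [sub_zero, add_zero] at t
    refine t.congr fun x ↦ ?_
    rw [div_div, ← sq]

end IsBoundState

/-- The sum rule inequality for finitely many bound states. -/
theorem sum_cube_le_integral_sq {N : ℕ} {W : ℝ → ℝ} (hW : Continuous W) {R : ℝ} (ν : Fin N → ℝ)
    (hν : ∀ i, 0 < ν i) (hinj : Function.Injective ν)
    (h : ∀ i, ∃ ψ ψ', IsBoundState W R (ν i) ψ ψ') {ε : ℝ} (hε : 0 < ε) :
    ∀ᶠ x in atTop, 16 / 3 * ∑ i, ν i ^ 3 - ε ≤ ∫ y in R..x, W y ^ 2 := by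
  induction N generalizing W ε with
  | zero =>
    filter_upwards [eventually_ge_atTop R] with x hx
    have : 0 ≤ ∫ y in R..x, W y ^ 2 :=
      intervalIntegral.integral_nonneg hx fun y _ ↦ sq_nonneg _
    simp only [Finset.univ_eq_empty, Finset.sum_empty, mul_zero]
    linarith
  | succ N ih =>
    obtain ⟨ψ, ψ', hψ⟩ := h 0
    have h1 := ih (hψ.continuous_commutedPotential (hν 0) hW) (fun i ↦ ν i.succ)
      (fun i ↦ hν _) (hinj.comp (Fin.succ_injective N)) (fun i ↦ by
        obtain ⟨φ, φ', hφ⟩ := h i.succ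
        exact hψ.exists_commuted (hν 0) hφ (hν _) (hinj.ne (Fin.succ_ne_zero i)))
      (half_pos hε)
    -- The primitive enters with the factor 4, so ε/8 here and ε/2 from the induction hypothesis add
    -- up to ε.
    have h2 := (hψ.tendsto_primitive (hν 0)).eventually
      (lt_mem_nhds (show -(ε / 8) < 0 by linarith))
    filter_upwards [h1, h2] with x hx1 hx2
    rw [hψ.integral_sq_eq (hν 0) hW, Fin.sum_univ_succ]
    linarith

/-! ### Regularity and decay of eigenfunctions -/

/-- A bounded solution of `v'' = q v` with `q = ν²` on `[R, ∞)` decays exponentially there. -/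
theorem decay_right {v w q : ℝ → ℂ} {R ν C : ℝ} (hν : 0 < ν)
    (hv : ∀ x, HasDerivAt v (w x) x) (hw : ∀ x, HasDerivAt w (q x * v x) x)
    (hq : ∀ x, R ≤ x → q x = (ν : ℂ) ^ 2) (hC : ∀ x, ‖v x‖ ≤ C) {x : ℝ} (hx : R ≤ x) :
    w x = -(ν * v x) ∧ v x = v R * Complex.exp (-ν * (x - R)) := by
  have hexp : ∀ (s : ℂ) (x : ℝ), HasDerivAt (fun x : ℝ ↦ Complex.exp (s * x))
      (s * Complex.exp (s * x)) x := by
    intro s x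
    have h1 : HasDerivAt (fun y : ℝ ↦ s * (y : ℂ)) (s * 1) x :=
      (Complex.ofRealCLM.hasDerivAt).const_mul _
    convert! h1.cexp using 1
    ring
  have hν' : (ν : ℂ) ≠ 0 := by exact_mod_cast hν.ne'
  have hconst : ∀ s : ℂ, s ^ 2 = (ν : ℂ) ^ 2 → ∀ x, R ≤ x →
      (w x + s * v x) * Complex.exp (-s * x) = (w R + s * v R) * Complex.exp (-s * R) := by
    intro s hs x hx
    have hd : ∀ y, R ≤ y →
        HasDerivAt (fun y : ℝ ↦ (w y + s * v y) * Complex.exp (-s * y)) 0 y := by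
      intro y hy
      convert! ((hw y).add ((hv y).const_mul s)).mul (hexp (-s) y) using 1
      simp only [Pi.add_apply, hq y hy]
      linear_combination (v y * Complex.exp (-s * y)) * hs
    exact constant_of_has_deriv_right_zero
      (fun y hy ↦ (hd y hy.1).continuousAt.continuousWithinAt)
      (fun y hy ↦ (hd y hy.1).hasDerivWithinAt) x ⟨hx, le_rfl⟩
  have hee : ∀ x : ℝ, Complex.exp (-ν * x) * Complex.exp (ν * x) = 1 := fun x ↦ by
    rw [← Complex.exp_add]; simp
  have hp : w R + ν * v R = 0 := by
    by_contra hne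
    set p : ℂ := (w R + ν * v R) * Complex.exp (-ν * R)
    set z : ℂ := (w R + -ν * v R) * Complex.exp (- -ν * R)
    have hp0 : 0 < ‖p‖ := norm_pos_iff.mpr (mul_ne_zero hne (Complex.exp_ne_zero _))
    have hbound : ∀ x, max R 0 ≤ x → ‖p‖ * Real.exp (ν * x) ≤ 2 * ν * C + ‖z‖ := by
      intro x hx
      have h1 := hconst ν rfl x ((le_max_left _ _).trans hx)
      have h2 := hconst (-ν) (by ring) x ((le_max_left _ _).trans hx)
      -- The quantities (w ± νv) e^{∓νx} are conserved. Subtracting them eliminates w, so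
      -- boundedness of v alone excludes the growing exponential.
      have h3 : p * Complex.exp (ν * x) = 2 * ν * v x + z * Complex.exp (-ν * x) := by
        have e := hee x
        change _ = p at h1
        change _ = z at h2
        rw [neg_neg] at h2
        rw [← h1, ← h2]
        linear_combination (2 * ν * v x) * e
      have hn : ∀ s : ℝ, ‖Complex.exp ((s : ℂ) * x)‖ = Real.exp (s * x) := fun s ↦ by
        rw [Complex.norm_exp, ← Complex.ofReal_mul, Complex.ofReal_re]
      have h4 := congrArg norm h3
      rw [norm_mul, hn] at h4
      rw [h4]
      refine (norm_add_le _ _).trans ?_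
      have h5 : ‖Complex.exp (-ν * x)‖ ≤ 1 := by
        have := hn (-ν)
        push_cast at this
        rw [this, Real.exp_le_one_iff]
        nlinarith [(le_max_right R 0).trans hx]
      rw [norm_mul, norm_mul, norm_mul, Complex.norm_real, Real.norm_of_nonneg hν.le]
      simp only [Complex.norm_ofNat]
      have := hC x
      gcongr
      exact mul_le_of_le_one_right (norm_nonneg _) h5
    have ht : Tendsto (fun x ↦ ‖p‖ * Real.exp (ν * x)) atTop atTop :=
      (Real.tendsto_exp_atTop.comp (tendsto_id.const_mul_atTop hν)).const_mul_atTop hp0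
    obtain ⟨x, hx1, hx2⟩ := ((ht.eventually_gt_atTop (2 * ν * C + ‖z‖)).and
      (eventually_ge_atTop (max R 0))).exists
    exact absurd (hbound x hx2) (not_le.mpr hx1)
  have hw' : ∀ x, R ≤ x → w x = -(ν * v x) := by
    intro x hx
    have h1 := hconst ν rfl x hx
    rw [hp, zero_mul] at h1
    have := (mul_eq_zero.mp h1).resolve_right (Complex.exp_ne_zero _)
    linear_combination this
  refine ⟨hw' x hx, ?_⟩
  have h2 := hconst (-ν) (by ring) x hx
  rw [hw' x hx, hw' R le_rfl, neg_neg] at h2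
  have e := hee x
  rw [show (-ν : ℂ) * (x - R) = -ν * x + ν * R by ring, Complex.exp_add]
  have h3 : v x * Complex.exp (ν * x) = v R * Complex.exp (ν * R) := by
    have h4 : (2 * ν : ℂ) ≠ 0 := mul_ne_zero two_ne_zero hν'
    apply mul_left_cancel₀ h4
    linear_combination -h2
  linear_combination (-v x) * e + Complex.exp (-ν * x) * h3

/-- A bounded solution of `v'' = q v` with `q = ν²` on `(-∞, R]` decays exponentially there. -/
theorem decay_left {v w q : ℝ → ℂ} {R ν C : ℝ} (hν : 0 < ν)
    (hv : ∀ x, HasDerivAt v (w x) x) (hw : ∀ x, HasDerivAt w (q x * v x) x)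
    (hq : ∀ x, x ≤ R → q x = (ν : ℂ) ^ 2) (hC : ∀ x, ‖v x‖ ≤ C) {x : ℝ} (hx : x ≤ R) :
    w x = ν * v x ∧ v x = v R * Complex.exp (ν * (x - R)) := by
  have h := decay_right (v := fun x ↦ v (-x)) (w := fun x ↦ -w (-x)) (q := fun x ↦ q (-x))
    (R := -R) (x := -x) hν (fun x ↦ by
      convert! (hv (-x)).scomp x (hasDerivAt_neg x) using 1; simp)
    (fun x ↦ by
      convert! ((hw (-x)).scomp x (hasDerivAt_neg x)).neg using 1; simp)
    (fun x hx ↦ hq _ (by linarith)) (fun x ↦ hC _) (by linarith)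
  simp only [neg_neg] at h
  refine ⟨by linear_combination -h.1, ?_⟩
  rw [h.2]
  congr 2
  push_cast
  ring

/-- Uniqueness for the linear equation `v'' = q v` with bounded `q`. -/
theorem eq_zero_of_cauchy_data {v w q : ℝ → ℂ} {Q x₀ : ℝ} (hQ : ∀ x, ‖q x‖ ≤ Q)
    (hv : ∀ x, HasDerivAt v (w x) x) (hw : ∀ x, HasDerivAt w (q x * v x) x)
    (hv0 : v x₀ = 0) (hw0 : w x₀ = 0) (x : ℝ) : v x = 0 := by
  have hQ0 : 0 ≤ Q := (norm_nonneg _).trans (hQ 0)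
  have h := ODE_solution_unique_univ (v := fun t (p : ℂ × ℂ) ↦ (p.2, q t * p.1))
    (s := fun _ ↦ Set.univ) (K := (max 1 Q).toNNReal) (f := fun x ↦ (v x, w x))
    (g := fun _ ↦ (0, 0)) (t₀ := x₀) (fun t ↦ by
      refine LipschitzWith.lipschitzOnWith (LipschitzWith.of_dist_le_mul fun a b ↦ ?_)
      rw [Real.coe_toNNReal _ (by positivity), Prod.dist_eq, Prod.dist_eq]
      simp only [dist_eq_norm, ← mul_sub, norm_mul]
      refine max_le ?_ ?_
      · calc ‖a.2 - b.2‖ = 1 * ‖a.2 - b.2‖ := (one_mul _).symm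
          _ ≤ _ := by gcongr; exacts [le_max_left _ _, le_max_right _ _]
      · gcongr
        exacts [(hQ t).trans (le_max_right _ _), le_max_left _ _])
    (fun t ↦ ⟨(hv t).prodMk (hw t), Set.mem_univ _⟩)
    (fun t ↦ ⟨by simpa using! hasDerivAt_const t ((0 : ℂ), (0 : ℂ)), Set.mem_univ _⟩)
    (by simp [hv0, hw0])
  have := congrFun h x
  simp only [Prod.mk.injEq] at this
  exact this.1

/-- An eigenfunction of `-d²/dx² - U` is a classical bounded solution of the eigenvalue
equation. -/
theorem exists_classical_solution {U : ℝ →ᵇ ℝ} {κ s : ℝ} (hκ : 0 < κ) {ψ : L2}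
    (hψ : ψ = freeResolvent κ hκ ((s : ℂ) • ψ + mulBounded U ψ)) :
    ∃ (v w : ℝ → ℂ) (C : ℝ), ψ =ᵐ[volume] v ∧ (∀ x, HasDerivAt v (w x) x) ∧
      (∀ x, HasDerivAt w (((κ ^ 2 - s - U x : ℝ) : ℂ) * v x) x) ∧ ∀ x, ‖v x‖ ≤ C := by
  set h : L2 := (s : ℂ) • ψ + mulBounded U ψ with hh
  set v : ℝ → ℂ := fun x ↦ inner ℂ (greenFn hκ x) h with hvdef
  have hae : ψ =ᵐ[volume] v := by
    have := freeResolvent_ae_eq hκ h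
    rwa [← hψ] at this
  have hvc : Continuous v := (continuous_greenFn hκ).inner continuous_const
  -- Regularity bootstraps: the kernel representation makes v continuous, so the source is a.e.
  -- equal to the continuous function k, and the representation of v can be differentiated twice.
  set k : ℝ → ℂ := fun x ↦ ((s + U x : ℝ) : ℂ) * v x
  have hk : Continuous k := by
    have := U.continuous
    fun_prop
  have hhk : h =ᵐ[volume] k := by
    filter_upwards [hae, Lp.coeFn_add ((s : ℂ) • ψ) (mulBounded U ψ), Lp.coeFn_smul (s : ℂ) ψ,
      coeFn_mulBounded U ψ] with x h1 h2 h3 h4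
    rw [hh, h2, Pi.add_apply, h3, h4, Pi.smul_apply, h1]
    simp only [k, smul_eq_mul]
    push_cast
    ring
  have hvk : v = fun x ↦ ∫ y, (green κ (x - y) : ℂ) * k y := by
    ext x
    rw [hvdef]
    simp only
    rw [inner_greenFn]
    refine integral_congr_ae ?_
    filter_upwards [hhk] with y hy
    rw [hy]
  obtain ⟨w, hw⟩ := hasDerivAt_integral_green hκ hk fun x ↦ by
    refine (integrable_green_mul hκ x h).congr ?_
    filter_upwards [hhk] with y hy
    rw [hy]
  rw [← hvk] at hw
  refine ⟨v, w, ‖greenFn hκ 0‖ * ‖h‖, hae, fun x ↦ (hw x).1, fun x ↦ ?_,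
    fun x ↦ norm_inner_greenFn_le hκ x h⟩
  convert! (hw x).2 using 1
  rw [← congrFun hvk x]
  simp only [k]
  push_cast
  ring

/-- An eigenfunction of `-d²/dx² - U` with compactly supported `U` has a nonzero exponential
tail at `-∞`, vanishes at `+∞`, and gives rise to a real bound state. -/
theorem exists_isBoundState {U : ℝ →ᵇ ℝ} {R ν C : ℝ} (hR : 0 < R)
    (hU : ∀ x, R ≤ |x| → U x = 0) (hν : 0 < ν) {v w : ℝ → ℂ}
    (hv : ∀ x, HasDerivAt v (w x) x)
    (hw : ∀ x, HasDerivAt w (((ν ^ 2 - U x : ℝ) : ℂ) * v x) x) (hC : ∀ x, ‖v x‖ ≤ C)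
    (hne : v ≠ 0) :
    v (-R) ≠ 0 ∧ w (-R) = ν * v (-R) ∧
      ∃ ψ ψ', IsBoundState (fun x ↦ -U x) (-R) ν ψ ψ' := by
  have hQ : ∀ x, ‖((ν ^ 2 - U x : ℝ) : ℂ)‖ ≤ ν ^ 2 + ‖U‖ := by
    intro x
    rw [Complex.norm_real]
    refine (norm_sub_le _ _).trans ?_
    rw [Real.norm_of_nonneg (sq_nonneg ν)]
    gcongr
    exact U.norm_coe_le_norm x
  have hL : ∀ x, x ≤ -R → w x = ν * v x ∧ v x = v (-R) * Complex.exp (ν * (x - (-R : ℝ))) :=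
    fun x hx ↦ decay_left hν hv hw (fun y hy ↦ by
      rw [hU y (by rw [abs_of_nonpos (by linarith)]; linarith)]; simp) hC hx
  have hRt : ∀ x, R ≤ x → w x = -(ν * v x) ∧ v x = v R * Complex.exp (-ν * (x - R)) :=
    fun x hx ↦ decay_right hν hv hw (fun y hy ↦ by
      rw [hU y (by rw [abs_of_nonneg (by linarith)]; linarith)]; simp) hC hx
  have hw0 : w (-R) = ν * v (-R) := (hL (-R) le_rfl).1
  have hv0 : v (-R) ≠ 0 := by
    intro h0
    exact hne (funext (eq_zero_of_cauchy_data hQ hv hw h0 (by rw [hw0, h0, mul_zero])))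
  have htend : Tendsto v atTop (𝓝 0) := by
    have h1 : Tendsto (fun x : ℝ ↦ ‖v R‖ * Real.exp (-(ν * (x - R)))) atTop (𝓝 (‖v R‖ * 0)) := by
      refine Tendsto.const_mul _ (Real.tendsto_exp_neg_atTop_nhds_zero.comp ?_)
      exact (tendsto_atTop_add_const_right _ (-R) tendsto_id).const_mul_atTop hν
    rw [mul_zero] at h1
    refine squeeze_zero_norm' ?_ h1
    filter_upwards [eventually_ge_atTop R] with x hx
    rw [(hRt x hx).2, norm_mul, Complex.norm_exp]
    refine le_of_eq ?_
    congr 2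
    rw [← Complex.ofReal_neg, ← Complex.ofReal_sub, ← Complex.ofReal_mul, Complex.ofReal_re]
    ring
  have htend' : Tendsto w atTop (𝓝 0) := by
    have := (htend.const_mul (ν : ℂ)).neg
    rw [mul_zero, neg_zero] at this
    refine this.congr' ?_
    filter_upwards [eventually_ge_atTop R] with x hx
    rw [(hRt x hx).1]
  refine ⟨hv0, hw0, ?_⟩
  -- The equation is real, so real and imaginary parts both solve it; one of them is nonzero at -R
  -- and hence has a nonzero tail on the left.
  have key : ∀ L : ℂ →L[ℝ] ℝ, L (v (-R)) ≠ 0 →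
      IsBoundState (fun x ↦ -U x) (-R) ν (fun x ↦ L (v x)) (fun x ↦ L (w x)) := by
    intro L hLne
    have hreal : ∀ (r : ℝ) (z : ℂ), L ((r : ℂ) * z) = r * L z := fun r z ↦ by
      rw [← Complex.real_smul, map_smul, smul_eq_mul]
    refine ⟨fun x ↦ L.hasFDerivAt.comp_hasDerivAt x (hv x), fun x ↦ ?_, fun x hx ↦ ⟨?_, ?_⟩, ?_, ?_⟩
    · convert! L.hasFDerivAt.comp_hasDerivAt x (hw x) using 1
      rw [hreal]
      ring
    · rw [(hL x hx).2, ← Complex.ofReal_sub, ← Complex.ofReal_mul, ← Complex.ofReal_exp,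
        mul_comm, hreal]
      exact mul_ne_zero (Real.exp_ne_zero _) hLne
    · rw [(hL x hx).1, hreal]
    · simpa [Function.comp_def] using (L.continuous.tendsto 0).comp htend
    · simpa [Function.comp_def] using (L.continuous.tendsto 0).comp htend'
  by_cases hre : (v (-R)).re = 0
  · have him : (v (-R)).im ≠ 0 := fun him ↦ hv0 (Complex.ext hre him)
    exact ⟨_, _, key Complex.imCLM him⟩
  · exact ⟨_, _, key Complex.reCLM hre⟩

/-! ### The bound for compactly supported potentials -/

/-- Eigenfunctions of `-d²/dx² - U` for the same eigenvalue are not orthogonal. -/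
theorem inner_ne_zero_of_same_energy {U : ℝ →ᵇ ℝ} {R ν C₁ C₂ : ℝ} (hR : 0 < R)
    (hU : ∀ x, R ≤ |x| → U x = 0) (hν : 0 < ν) {ψ₁ ψ₂ : L2} {v₁ w₁ v₂ w₂ : ℝ → ℂ}
    (hψ₁ : ψ₁ =ᵐ[volume] v₁) (hψ₂ : ψ₂ =ᵐ[volume] v₂) (h₁0 : ψ₁ ≠ 0) (h₂0 : ψ₂ ≠ 0)
    (hv₁ : ∀ x, HasDerivAt v₁ (w₁ x) x) (hv₂ : ∀ x, HasDerivAt v₂ (w₂ x) x)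
    (hw₁ : ∀ x, HasDerivAt w₁ (((ν ^ 2 - U x : ℝ) : ℂ) * v₁ x) x)
    (hw₂ : ∀ x, HasDerivAt w₂ (((ν ^ 2 - U x : ℝ) : ℂ) * v₂ x) x)
    (hC₁ : ∀ x, ‖v₁ x‖ ≤ C₁) (hC₂ : ∀ x, ‖v₂ x‖ ≤ C₂) : inner ℂ ψ₁ ψ₂ ≠ 0 := by
  have hne : ∀ {ψ : L2} {v : ℝ → ℂ}, ψ =ᵐ[volume] v → ψ ≠ 0 → v ≠ 0 := by
    intro ψ v h h0 hv
    refine h0 (Lp.ext (h.trans ?_))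
    rw [hv]
    exact (Lp.coeFn_zero _ _ _).symm
  obtain ⟨h1, h1', -⟩ := exists_isBoundState hR hU hν hv₁ hw₁ hC₁ (hne hψ₁ h₁0)
  obtain ⟨h2, h2', -⟩ := exists_isBoundState hR hU hν hv₂ hw₂ hC₂ (hne hψ₂ h₂0)
  have hQ : ∀ x, ‖((ν ^ 2 - U x : ℝ) : ℂ)‖ ≤ ν ^ 2 + ‖U‖ := by
    intro x
    rw [Complex.norm_real]
    refine (norm_sub_le _ _).trans ?_
    rw [Real.norm_of_nonneg (sq_nonneg ν)]
    gcongr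
    exact U.norm_coe_le_norm x
  -- Both solutions satisfy w = νv at -R, so this combination has zero Cauchy data. The two
  -- eigenfunctions are therefore proportional.
  have hzero := eq_zero_of_cauchy_data (x₀ := -R) hQ
    (v := fun x ↦ v₁ (-R) * v₂ x - v₂ (-R) * v₁ x) (w := fun x ↦ v₁ (-R) * w₂ x - v₂ (-R) * w₁ x)
    (fun x ↦ ((hv₂ x).const_mul _).sub ((hv₁ x).const_mul _))
    (fun x ↦ by
      convert! ((hw₂ x).const_mul (v₁ (-R))).sub ((hw₁ x).const_mul (v₂ (-R))) using 1
      ring) (by ring) (by rw [h1', h2']; ring)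
  have heq : v₁ (-R) • ψ₂ = v₂ (-R) • ψ₁ := by
    refine Lp.ext ?_
    filter_upwards [hψ₁, hψ₂, Lp.coeFn_smul (v₁ (-R)) ψ₂, Lp.coeFn_smul (v₂ (-R)) ψ₁]
      with x e1 e2 e3 e4
    rw [e3, e4, Pi.smul_apply, Pi.smul_apply, e1, e2, smul_eq_mul, smul_eq_mul]
    exact sub_eq_zero.mp (hzero x)
  intro h0
  have := congrArg (inner ℂ ψ₁) heq
  rw [inner_smul_right, inner_smul_right, h0, mul_zero] at this
  rcases mul_eq_zero.mp this.symm with h | h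
  · exact h2 h
  · exact h₁0 (inner_self_eq_zero.mp h)

/-- Trial functions produce orthonormal eigenfunctions of `-d²/dx² - U` with lower energies, written
in terms of the free resolvent. -/
theorem exists_eigenfunctions_of_form_le {U : ℝ →ᵇ ℝ} (hU : HasCompactSupport U) {N : ℕ}
    (f : Fin N → sobolevH2) (hf : LinearIndependent ℂ fun i ↦ (f i : L2)) (l : Fin N → ℝ)
    (hl : ∀ i, 0 < l i)
    (hform : ∀ (k : Fin N) (c : Fin N → ℂ), (∀ i, k < i → c i = 0) →
      (inner ℂ ((∑ i, c i • f i : sobolevH2) : L2) (-secondDeriv (∑ i, c i • f i)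
        - mulBounded U ((∑ i, c i • f i : sobolevH2) : L2))).re
        ≤ -(l k) ^ 2 * ‖((∑ i, c i • f i : sobolevH2) : L2)‖ ^ 2) :
    ∃ (κ : ℝ) (hκ : 0 < κ) (ψ : Fin N → L2) (s : Fin N → ℝ), Orthonormal ℂ ψ ∧
      (∀ k, ψ k = freeResolvent κ hκ ((s k : ℂ) • ψ k + mulBounded U (ψ k))) ∧
      ∀ k, l k ^ 2 ≤ κ ^ 2 - s k := by
  -- κ² > ‖U‖ makes the perturbed resolvent T exist and be nonnegative; κ² > lᵢ² makes the inverted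
  -- form bounds (κ² - lᵢ²)⁻¹ positive. They exceed κ⁻², the upper bound for the free part, so
  -- min-max applies.
  obtain ⟨κ, hκ, hκU, hκl⟩ : ∃ κ : ℝ, 0 < κ ∧ ‖U‖ < κ ^ 2 ∧ ∀ i, l i ^ 2 < κ ^ 2 := by
    have h0 : 0 ≤ ∑ i, l i ^ 2 := by positivity
    have hU0 := norm_nonneg U
    refine ⟨1 + ‖U‖ + ∑ i, l i ^ 2, by positivity, by nlinarith, fun i ↦ ?_⟩
    have := Finset.single_le_sum (f := fun i ↦ l i ^ 2) (fun j _ ↦ sq_nonneg (l j))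
      (Finset.mem_univ i)
    nlinarith
  obtain ⟨T, hTsymm, hTpos, hT1, hT2, hT3⟩ := exists_perturbed_resolvent hκ hκU
    (inner_freeResolvent_left hκ) (sq_mul_norm_freeResolvent_sq_le hκ)
    (sq_mul_norm_freeResolvent_le hκ) (inner_mulBounded_left U) (norm_mulBounded_le U)
  have hK : IsCompactOperator (T ∘L (mulBounded U ∘L freeResolvent κ hκ)) :=
    (isCompactOperator_mulBounded_freeResolvent hU hκ).clm_comp T
  have hΓ : ∀ x : L2, (inner ℂ x (freeResolvent κ hκ x)).re ≤ (κ ^ 2)⁻¹ * ‖x‖ ^ 2 := by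
    intro x
    refine (Complex.re_le_norm _).trans ((norm_inner_le_norm _ _).trans ?_)
    have h : ‖freeResolvent κ hκ x‖ ≤ (κ ^ 2)⁻¹ * ‖x‖ := by
      rw [← div_eq_inv_mul, le_div_iff₀' (by positivity)]
      exact sq_mul_norm_freeResolvent_le hκ x
    calc _ ≤ ‖x‖ * ((κ ^ 2)⁻¹ * ‖x‖) := by gcongr
      _ = _ := by ring
  have hd : ∀ k, 0 < κ ^ 2 - l k ^ 2 := fun k ↦ sub_pos.mpr (hκl k)
  obtain ⟨ψ, θ, hψ, hev, hθ⟩ := exists_orthonormal_eigenvectors hTsymm hT3 hK hΓ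
    (fun i ↦ (f i : L2)) hf (fun k ↦ (κ ^ 2 - l k ^ 2)⁻¹)
    (fun k ↦ inv_strictAnti₀ (hd k) (by nlinarith [hl k])) (by
      intro k c hc
      have hF : (∑ i, c i • (f i : L2)) = ((∑ i, c i • f i : sobolevH2) : L2) := by
        simp
      have hfm := hform k c hc
      rw [hF]
      set F : sobolevH2 := ∑ i, c i • f i
      have hres := eq_freeResolvent_of_sobolevH2 hκ F
      set h : L2 := ((κ : ℂ) ^ 2) • (F : L2) - secondDeriv F with hh
      have hT2' := hT2 h
      rw [← hres] at hT2'
      refine form_resolvent_ge hTsymm hTpos hT2'.symm (hd k) ?_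
      have : h - mulBounded U F = ((κ ^ 2 : ℝ) : ℂ) • (F : L2)
          + (-secondDeriv F - mulBounded U F) := by
        rw [hh]; push_cast; abel
      rw [this, inner_add_right, inner_smul_right, Complex.add_re, Complex.re_ofReal_mul]
      have h2 : (inner ℂ (F : L2) (F : L2)).re = ‖(F : L2)‖ ^ 2 :=
        inner_self_eq_norm_sq (𝕜 := ℂ) (F : L2)
      rw [h2]
      linarith)
  have hθpos : ∀ k, 0 < θ k := fun k ↦ (inv_pos.mpr (hd k)).trans_le (hθ k)
  have hν2 : ∀ k, l k ^ 2 ≤ κ ^ 2 - (θ k)⁻¹ := by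
    intro k
    have := inv_anti₀ (inv_pos.mpr (hd k)) (hθ k)
    rw [inv_inv] at this
    linarith
  -- An eigenvalue θ of the resolvent corresponds to the energy θ⁻¹ - κ².
  refine ⟨κ, hκ, ψ, fun k ↦ (θ k)⁻¹, hψ, fun k ↦ ?_, hν2⟩
  have hθ0 : ((θ k : ℝ) : ℂ) ≠ 0 := by exact_mod_cast (hθpos k).ne'
  have h1 := hT1 (ψ k)
  rw [hev k, map_smul] at h1
  have h2 := congrArg (fun y ↦ ((θ k : ℝ) : ℂ)⁻¹ • y) h1
  simp only [smul_smul, inv_mul_cancel₀ hθ0, one_smul] at h2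
  conv_lhs => rw [h2]
  rw [← map_smul, smul_add, smul_smul, inv_mul_cancel₀ hθ0, one_smul]
  push_cast
  rfl

/-- Each eigenfunction becomes a real bound state with νₖ² = κ² - sₖ and lₖ ≤ νₖ, to which the sum
rule applies. The νₖ are distinct because eigenfunctions of equal energy could not be orthogonal. -/
theorem sum_cube_le_of_eigenfunctions {U : ℝ →ᵇ ℝ} (hU : HasCompactSupport U) {N : ℕ}
    {κ : ℝ} (hκ : 0 < κ) {ψ : Fin N → L2} {s : Fin N → ℝ} (hψ : Orthonormal ℂ ψ)
    (hres : ∀ k, ψ k = freeResolvent κ hκ ((s k : ℂ) • ψ k + mulBounded U (ψ k)))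
    {l : Fin N → ℝ} (hl : ∀ i, 0 < l i) (hν2 : ∀ k, l k ^ 2 ≤ κ ^ 2 - s k) :
    16 / 3 * ∑ i, l i ^ 3 ≤ ∫ x, U x ^ 2 := by
  obtain ⟨ν, hνsq, hνl⟩ : ∃ ν : Fin N → ℝ, (∀ k, ν k ^ 2 = κ ^ 2 - s k) ∧ ∀ k, l k ≤ ν k :=
    ⟨fun k ↦ √(κ ^ 2 - s k), fun k ↦ Real.sq_sqrt ((sq_nonneg _).trans (hν2 k)),
      fun k ↦ Real.le_sqrt_of_sq_le (hν2 k)⟩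
  have hνpos : ∀ k, 0 < ν k := fun k ↦ (hl k).trans_le (hνl k)
  have hcl : ∀ k, ∃ (v w : ℝ → ℂ) (C : ℝ), ψ k =ᵐ[volume] v ∧ (∀ x, HasDerivAt v (w x) x) ∧
      (∀ x, HasDerivAt w (((ν k ^ 2 - U x : ℝ) : ℂ) * v x) x) ∧ ∀ x, ‖v x‖ ≤ C := by
    intro k
    rw [hνsq]
    exact exists_classical_solution hκ (hres k)
  choose v w C hψv hv hw hC using hcl
  have hψ0 : ∀ k, ψ k ≠ 0 := fun k ↦ hψ.ne_zero k
  have hv0 : ∀ k, v k ≠ 0 := by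
    intro k h
    refine hψ0 k (Lp.ext ((hψv k).trans ?_))
    rw [h]
    exact (Lp.coeFn_zero _ _ _).symm
  obtain ⟨R, hRpos, hR⟩ : ∃ R : ℝ, 0 < R ∧ ∀ x, R ≤ |x| → U x = 0 := by
    obtain ⟨R, hR⟩ := hU.isCompact.isBounded.subset_closedBall 0
    refine ⟨max R 0 + 1, by positivity, fun x hx ↦ ?_⟩
    by_contra hne
    have := hR (subset_tsupport _ hne)
    rw [mem_closedBall_zero_iff, Real.norm_eq_abs] at this
    linarith [le_max_left R 0]
  have hinj : Function.Injective ν := by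
    intro j k hjk
    by_contra hne
    refine inner_ne_zero_of_same_energy hRpos hR (hνpos j) (hψv j) (hψv k) (hψ0 j) (hψ0 k) (hv j)
      (hv k) (hw j) (fun x ↦ by rw [hjk]; exact hw k x) (hC j) (hC k) (hψ.2 hne)
  have hbs : ∀ k, ∃ φ φ', IsBoundState (fun x ↦ -U x) (-R) (ν k) φ φ' := fun k ↦
    (exists_isBoundState hRpos hR (hνpos k) (hv k) (hw k) (hC k) (hv0 k)).2.2
  have hUint : Integrable (fun x ↦ U x ^ 2) volume := by
    have h : HasCompactSupport fun x ↦ U x * U x := hU.mul_right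
    simp only [pow_two]
    exact (U.continuous.mul U.continuous).integrable_of_hasCompactSupport h
  have hle : 16 / 3 * ∑ i, ν i ^ 3 ≤ ∫ x, U x ^ 2 := by
    refine le_of_forall_pos_sub_le fun ε hε ↦ ?_
    have hev := sum_cube_le_integral_sq (W := fun x ↦ -U x) U.continuous.neg ν hνpos hinj hbs hε
    obtain ⟨x, hx, hxR⟩ := (hev.and (eventually_ge_atTop (-R))).exists
    refine hx.trans ?_
    rw [intervalIntegral.integral_of_le hxR]
    simp only [neg_sq]
    exact setIntegral_le_integral hUint (Eventually.of_forall fun y ↦ sq_nonneg (U y))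
  refine le_trans ?_ hle
  gcongr with i
  · exact (hl i).le
  · exact hνl i

/-- The sharp bound for `γ = 3/2`, in terms of trial functions, for compactly supported
potentials. -/
theorem sum_cube_le_of_hasCompactSupport {U : ℝ →ᵇ ℝ} (hU : HasCompactSupport U) {N : ℕ}
    (f : Fin N → sobolevH2) (hf : LinearIndependent ℂ fun i ↦ (f i : L2)) (l : Fin N → ℝ)
    (hl : ∀ i, 0 < l i)
    (hform : ∀ (k : Fin N) (c : Fin N → ℂ), (∀ i, k < i → c i = 0) →
      (inner ℂ ((∑ i, c i • f i : sobolevH2) : L2) (-secondDeriv (∑ i, c i • f i)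
        - mulBounded U ((∑ i, c i • f i : sobolevH2) : L2))).re
        ≤ -(l k) ^ 2 * ‖((∑ i, c i • f i : sobolevH2) : L2)‖ ^ 2) :
    16 / 3 * ∑ i, l i ^ 3 ≤ ∫ x, U x ^ 2 := by
  obtain ⟨κ, hκ, ψ, s, hψ, hres, hν⟩ := exists_eigenfunctions_of_form_le hU f hf l hl hform
  exact sum_cube_le_of_eigenfunctions hU hκ hψ hres hl hν

/-! ### The case `γ = 3/2` -/

theorem re_inner_toLp_mul (W : ℝ → ℝ) (F : L2)
    (hWF : MemLp (fun x ↦ (W x : ℂ) * F x) 2 volume) :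
    Integrable (fun x ↦ W x * ‖F x‖ ^ 2) volume ∧
      (inner ℂ F hWF.toLp).re = ∫ x, W x * ‖F x‖ ^ 2 := by
  have hInt : Integrable (fun x ↦ inner ℂ (F x) (hWF.toLp _ x)) volume :=
    L2.integrable_inner F hWF.toLp
  have hae : (fun x ↦ RCLike.re (inner ℂ (F x) (hWF.toLp _ x))) =ᵐ[volume]
      fun x ↦ W x * ‖F x‖ ^ 2 := by
    filter_upwards [hWF.coeFn_toLp] with x hx
    rw [hx]
    simp only [RCLike.inner_apply, RCLike.re_eq_complex_re]
    rw [mul_assoc, Complex.mul_conj, ← Complex.ofReal_mul, Complex.ofReal_re,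
      Complex.normSq_eq_norm_sq]
  refine ⟨hInt.re.congr hae, ?_⟩
  rw [L2_inner_def, ← RCLike.re_eq_complex_re, ← integral_re hInt]
  exact integral_congr_ae hae

theorem norm_toLp_sq_real {h : ℝ → ℝ} (hh : MemLp h 2 (volume : Measure ℝ)) :
    ‖hh.toLp‖ ^ 2 = ∫ x, h x ^ 2 := by
  rw [← real_inner_self_eq_norm_sq, L2.inner_def]
  refine integral_congr_ae ?_
  filter_upwards [hh.coeFn_toLp] with x hx
  rw [hx]
  simp [pow_two]

/-- Functions in `H²(ℝ)` are bounded. -/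
theorem ae_norm_le_of_sobolevH2 (F : sobolevH2) :
    ∀ᵐ x, ‖(F : L2) x‖ ≤ ‖greenFn one_pos 0‖ * ‖(F : L2) - secondDeriv F‖ := by
  have h := eq_freeResolvent_of_sobolevH2 one_pos F
  simp only [Complex.ofReal_one, one_pow, one_smul] at h
  have hae := freeResolvent_ae_eq one_pos ((F : L2) - secondDeriv F)
  rw [← h] at hae
  filter_upwards [hae] with x hx
  rw [hx]
  exact norm_inner_greenFn_le one_pos x _

theorem secondDeriv_sum {N : ℕ} (c : Fin N → ℂ) (f : Fin N → sobolevH2) :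
    secondDeriv (∑ i, c i • f i) = ∑ i, c i • secondDeriv (f i) := by
  let D : sobolevH2 →ₗ[ℂ] L2 := freeOperator.toFun
  have hneg : ∀ g : sobolevH2, D g = -secondDeriv g := fun _ ↦ rfl
  have h : D (∑ i, c i • f i) = ∑ i, c i • D (f i) := by
    rw [map_sum]
    exact Finset.sum_congr rfl fun i _ ↦ map_smul _ _ _
  rw [hneg] at h
  simp only [hneg, smul_neg, Finset.sum_neg_distrib, neg_inj] at h
  exact h

theorem exists_toLp_mul_sum {N : ℕ} {W : ℝ → ℝ} (c : Fin N → ℂ) (f : Fin N → L2)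
    (hWf : ∀ i, MemLp (fun x ↦ (W x : ℂ) * f i x) 2 volume) :
    ∃ h : MemLp (fun x ↦ (W x : ℂ) * (∑ i, c i • f i : L2) x) 2 volume,
      h.toLp = ∑ i, c i • (hWf i).toLp := by
  let e : Fin N → (mulOperator W).domain := fun i ↦ ⟨f i, hWf i⟩
  have he : ((∑ i, c i • e i : (mulOperator W).domain) : L2) = ∑ i, c i • f i := by
    simp [e]
  have h1 : ∀ F : (mulOperator W).domain, MemLp (fun x ↦ (W x : ℂ) * (F : L2) x) 2 volume :=
    fun F ↦ F.2
  have h2 : ∀ F : (mulOperator W).domain, (mulOperator W).toFun F = (h1 F).toLp := fun _ ↦ rfl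
  have h3 : (mulOperator W).toFun (∑ i, c i • e i) = ∑ i, c i • (mulOperator W).toFun (e i) := by
    rw [map_sum]
    exact Finset.sum_congr rfl fun i _ ↦ map_smul _ _ _
  have h4 := h1 (∑ i, c i • e i)
  refine ⟨by rw [← he]; exact h4, Eq.trans ?_ h3⟩
  rw [h2]
  congr 1
  rw [he]

theorem norm_coeff_le {N : ℕ} {f : Fin N → L2} (hf : Orthonormal ℂ f) (c : Fin N → ℂ)
    (i : Fin N) : ‖c i‖ ≤ ‖∑ i, c i • f i‖ := by
  have h := hf.inner_right_fintype c i
  have h2 := norm_inner_le_norm (𝕜 := ℂ) (f i) (∑ i, c i • f i)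
  rwa [h, hf.1 i, one_mul] at h2

/-- The form of `-d²/dx² - U` on the span of eigenfunctions of `-d²/dx² + W`, when `U` is close to
an upper bound of `-W`. -/
theorem re_inner_form_le {N : ℕ} {W U₀ : ℝ → ℝ} (f : Fin N → sobolevH2)
    (hf : Orthonormal ℂ fun i ↦ (f i : L2))
    (hWf : ∀ i, MemLp (fun x ↦ (W x : ℂ) * (f i : L2) x) 2 volume) {μ : Fin N → ℝ}
    (hμ : Monotone μ)
    (hev : ∀ i, -secondDeriv (f i) + (hWf i).toLp = (μ i : ℂ) • (f i : L2))
    (hU₀ : ∀ x, -W x ≤ U₀ x) {U : ℝ →ᵇ ℝ} (hg : MemLp (fun x ↦ U₀ x - U x) 2 volume)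
    {k : Fin N} {c : Fin N → ℂ} (hc : ∀ i, k < i → c i = 0) :
    (inner ℂ ((∑ i, c i • f i : sobolevH2) : L2) (-secondDeriv (∑ i, c i • f i)
        - mulBounded U ((∑ i, c i • f i : sobolevH2) : L2))).re
      ≤ (μ k + (‖greenFn one_pos 0‖ * ∑ i, ‖(f i : L2) - secondDeriv (f i)‖) * ‖hg.toLp‖)
        * ‖((∑ i, c i • f i : sobolevH2) : L2)‖ ^ 2 := by
  set B : ℝ := ‖greenFn one_pos 0‖ * ∑ i, ‖(f i : L2) - secondDeriv (f i)‖ with hB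
  have hFsum : ((∑ i, c i • f i : sobolevH2) : L2) = ∑ i, c i • (f i : L2) := by simp
  obtain ⟨hWF, hWFsum⟩ := exists_toLp_mul_sum c (fun i ↦ (f i : L2)) hWf
  rw [← hFsum] at hWF
  have hWFsum' : hWF.toLp = ∑ i, c i • (hWf i).toLp := by
    rw [← hWFsum]; congr 1; rw [hFsum]
  have hcoef : ∀ i, ‖c i‖ ≤ ‖((∑ i, c i • f i : sobolevH2) : L2)‖ := fun i ↦ by
    rw [hFsum]; exact norm_coeff_le hf c i
  have hsd := secondDeriv_sum c f
  have hbound := ae_norm_le_of_sobolevH2 (∑ i, c i • f i)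
  set F : sobolevH2 := ∑ i, c i • f i
  -- On the span of an orthonormal family in H², coefficients are bounded by the L² norm, so the sup
  -- norm is too. The constant B does not depend on U, which is what permits the later
  -- approximation.
  have hsup : ∀ᵐ x, ‖(F : L2) x‖ ≤ B * ‖(F : L2)‖ := by
    filter_upwards [hbound] with x hx
    refine hx.trans ?_
    rw [hB, mul_assoc]
    gcongr
    rw [hsd, hFsum, ← Finset.sum_sub_distrib, Finset.sum_mul]
    refine (norm_sum_le _ _).trans (Finset.sum_le_sum fun i _ ↦ ?_)
    rw [← smul_sub, norm_smul, mul_comm, ← hFsum]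
    gcongr
    exact hcoef i
  have hgF : MemLp (fun x ↦ ((U₀ x - U x : ℝ) : ℂ) * (F : L2) x) 2 volume := by
    have hgC : MemLp (fun x ↦ ((U₀ x - U x : ℝ) : ℂ)) 2 volume := hg.ofReal
    refine MemLp.of_le_mul (c := B * ‖(F : L2)‖) hgC ?_ ?_
    · exact hgC.aestronglyMeasurable.mul (Lp.aestronglyMeasurable _)
    · filter_upwards [hsup] with x hx
      rw [norm_mul, mul_comm]
      gcongr
  obtain ⟨hInt1, hre1⟩ := re_inner_toLp_mul W F hWF
  obtain ⟨hInt2, hre2⟩ := re_inner_toLp_mul (fun x ↦ U₀ x - U x) F hgF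
  have hInt3 : Integrable (fun x ↦ U x * ‖(F : L2) x‖ ^ 2) volume :=
    (integrable_norm_sq (F : L2)).bdd_mul (c := ‖U‖) U.continuous.aestronglyMeasurable
      (Eventually.of_forall fun x ↦ U.norm_coe_le_norm x)
  have hgnorm : ‖hgF.toLp‖ ≤ (B * ‖(F : L2)‖) * ‖hg.toLp‖ := by
    refine Lp.norm_le_mul_norm_of_ae_le_mul ?_
    filter_upwards [hsup, hgF.coeFn_toLp, hg.coeFn_toLp] with x hx h1 h2
    rw [h1, h2, norm_mul, mul_comm, Complex.norm_real]
    gcongr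
  -- Replacing W by -U changes the form by ∫ (-W - U)|F|², at most ∫ (U₀ - U)|F|². Cauchy–Schwarz
  -- then uses the sup bound for one factor F.
  have hpert : ∫ x, (-(W x * ‖(F : L2) x‖ ^ 2) - U x * ‖(F : L2) x‖ ^ 2) ≤
      B * ‖hg.toLp‖ * ‖(F : L2)‖ ^ 2 := by
    calc _ ≤ ∫ x, (U₀ x - U x) * ‖(F : L2) x‖ ^ 2 := by
          refine integral_mono (hInt1.neg.sub hInt3) hInt2 fun x ↦ ?_
          have := mul_le_mul_of_nonneg_right (hU₀ x) (sq_nonneg ‖(F : L2) x‖)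
          simp only
          linarith
      _ = (inner ℂ (F : L2) hgF.toLp).re := hre2.symm
      _ ≤ ‖(F : L2)‖ * ‖hgF.toLp‖ := (Complex.re_le_norm _).trans (norm_inner_le_norm _ _)
      _ ≤ ‖(F : L2)‖ * ((B * ‖(F : L2)‖) * ‖hg.toLp‖) := by gcongr
      _ = _ := by ring
  have hmain : (inner ℂ (F : L2) (-secondDeriv F + hWF.toLp)).re ≤ μ k * ‖(F : L2)‖ ^ 2 := by
    have h1 : -secondDeriv F + hWF.toLp = ∑ i, (c i * μ i) • (f i : L2) := by
      rw [hsd, hWFsum', ← Finset.sum_neg_distrib, ← Finset.sum_add_distrib]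
      refine Finset.sum_congr rfl fun i _ ↦ ?_
      rw [← smul_neg, ← smul_add, hev, smul_smul]
    have h2 : ‖(F : L2)‖ ^ 2 = ∑ i, ‖c i‖ ^ 2 := by
      have e : ‖(F : L2)‖ ^ 2 = (inner ℂ (F : L2) (F : L2)).re :=
        (inner_self_eq_norm_sq (𝕜 := ℂ) (F : L2)).symm
      rw [e, hFsum, hf.inner_sum, Complex.re_sum]
      refine Finset.sum_congr rfl fun i _ ↦ ?_
      rw [mul_comm, Complex.mul_conj, Complex.ofReal_re, Complex.normSq_eq_norm_sq]
    rw [h1, hFsum, hf.inner_sum, Complex.re_sum, ← hFsum, h2, Finset.mul_sum]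
    refine Finset.sum_le_sum fun i _ ↦ ?_
    rw [← mul_assoc, mul_comm (starRingEnd ℂ (c i)), Complex.mul_conj, ← Complex.ofReal_mul,
      Complex.ofReal_re, Complex.normSq_eq_norm_sq, mul_comm]
    rcases le_or_gt i k with hik | hik
    · gcongr
      exact hμ hik
    · simp [hc i hik]
  have hsplit : -secondDeriv F - mulBounded U F = (-secondDeriv F + hWF.toLp) - hWF.toLp
      - mulBounded U F := by abel
  rw [hsplit, inner_sub_right, inner_sub_right, Complex.sub_re, Complex.sub_re,
    re_inner_mulBounded, hre1]
  have hInt1' : Integrable (fun x ↦ -(W x * ‖(F : L2) x‖ ^ 2)) volume := hInt1.neg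
  rw [integral_sub hInt1' hInt3, integral_neg] at hpert
  linarith

/-- The sharp Lieb–Thirring bound for `γ = 3/2`, for finitely many eigenfunctions. -/
theorem sum_sqrt_cube_le {N : ℕ} {W U₀ : ℝ → ℝ} (f : Fin N → sobolevH2)
    (hf : Orthonormal ℂ fun i ↦ (f i : L2))
    (hWf : ∀ i, MemLp (fun x ↦ (W x : ℂ) * (f i : L2) x) 2 volume) {μ : Fin N → ℝ}
    (hμ : Monotone μ) (hneg : ∀ i, μ i < 0)
    (hev : ∀ i, -secondDeriv (f i) + (hWf i).toLp = (μ i : ℂ) • (f i : L2))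
    (hU₀ : ∀ x, -W x ≤ U₀ x) (hU₀L : MemLp U₀ 2 volume) :
    16 / 3 * ∑ i, √(-μ i) ^ 3 ≤ ∫ x, U₀ x ^ 2 := by
  set B : ℝ := ‖greenFn one_pos 0‖ * ∑ i, ‖(f i : L2) - secondDeriv (f i)‖ with hB
  have hB0 : 0 ≤ B := by positivity
  -- A compactly supported u within δ of U₀ in L² raises the energy bounds by at most Bδ; for small
  -- δ they all stay negative.
  have hsmall : ∀ᶠ δ in 𝓝[>] (0 : ℝ), 16 / 3 * ∑ i, √(-μ i - B * δ) ^ 3 ≤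
      (‖hU₀L.toLp‖ + δ) ^ 2 := by
    have hlt : ∀ᶠ δ in 𝓝[>] (0 : ℝ), ∀ i, 0 < -μ i - B * δ := by
      refine eventually_all.mpr fun i ↦ ?_
      have : Tendsto (fun δ : ℝ ↦ -μ i - B * δ) (𝓝[>] 0) (𝓝 (-μ i - B * 0)) :=
        (Continuous.tendsto (by fun_prop) 0).mono_left nhdsWithin_le_nhds
      exact this.eventually (lt_mem_nhds (by simpa using hneg i))
    filter_upwards [hlt, self_mem_nhdsWithin] with δ hδ hδ0
    have hδ0 : 0 < δ := hδ0
    obtain ⟨u, hu1, hu2, hu3, hu4⟩ := hU₀L.exists_hasCompactSupport_eLpNorm_sub_le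
      ENNReal.ofNat_ne_top (ε := ENNReal.ofReal δ) (by simpa using hδ0)
    obtain ⟨C, hC⟩ := hu3.bounded_above_of_compact_support hu1
    set U : ℝ →ᵇ ℝ := BoundedContinuousFunction.ofNormedAddCommGroup u hu3 C hC
    have hg : MemLp (fun x ↦ U₀ x - U x) 2 volume := hU₀L.sub hu4
    have hgn : ‖hg.toLp‖ ≤ δ := by
      rw [Lp.norm_toLp]
      exact ENNReal.toReal_le_of_le_ofReal hδ0.le hu2
    have hbound := sum_cube_le_of_hasCompactSupport (U := U) hu1 f hf.linearIndependent
      (fun i ↦ √(-μ i - B * δ)) (fun i ↦ Real.sqrt_pos.mpr (hδ i)) (by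
        intro k c hc
        refine (re_inner_form_le f hf hWf hμ hev hU₀ hg hc).trans ?_
        rw [Real.sq_sqrt (hδ k).le, neg_sub, sub_neg_eq_add, add_comm (B * δ)]
        gcongr)
    refine hbound.trans ?_
    have hUn : ∫ x, U x ^ 2 = ‖hu4.toLp‖ ^ 2 := (norm_toLp_sq_real hu4).symm
    rw [hUn]
    gcongr
    have : hu4.toLp = hU₀L.toLp - hg.toLp := by
      rw [← MemLp.toLp_sub]
      refine MemLp.toLp_congr _ _ (Eventually.of_forall fun x ↦ ?_)
      change u x = U₀ x - (U₀ x - u x)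
      ring
    rw [this]
    refine (norm_sub_le _ _).trans ?_
    gcongr
  have hlim1 : Tendsto (fun δ : ℝ ↦ 16 / 3 * ∑ i, √(-μ i - B * δ) ^ 3) (𝓝[>] 0)
      (𝓝 (16 / 3 * ∑ i, √(-μ i) ^ 3)) := by
    have : Tendsto (fun δ : ℝ ↦ 16 / 3 * ∑ i, √(-μ i - B * δ) ^ 3) (𝓝 0)
        (𝓝 (16 / 3 * ∑ i, √(-μ i - B * 0) ^ 3)) := Continuous.tendsto (by fun_prop) 0
    simp only [mul_zero, sub_zero] at this
    exact this.mono_left nhdsWithin_le_nhds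
  have hlim2 : Tendsto (fun δ : ℝ ↦ (‖hU₀L.toLp‖ + δ) ^ 2) (𝓝[>] 0)
      (𝓝 (‖hU₀L.toLp‖ ^ 2)) := by
    have : Tendsto (fun δ : ℝ ↦ (‖hU₀L.toLp‖ + δ) ^ 2) (𝓝 0) (𝓝 ((‖hU₀L.toLp‖ + 0) ^ 2)) :=
      Continuous.tendsto (by fun_prop) 0
    rw [add_zero] at this
    exact this.mono_left nhdsWithin_le_nhds
  rw [← norm_toLp_sq_real hU₀L]
  exact le_of_tendsto_of_tendsto hlim1 hlim2 hsmall

/-! ### Eigenfunctions of Schrödinger operators -/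

theorem mem_eigenspace_schrodinger_iff {V : ℝ → ℝ} {μ : ℝ} {F : L2} :
    (∃ h : F ∈ (schrodinger V).domain, (⟨F, h⟩ : (schrodinger V).domain)
        ∈ eigenspace (schrodinger V) μ) ↔
      ∃ (h₁ : F ∈ sobolevH2) (h₂ : MemLp (fun x ↦ (V x : ℂ) * F x) 2 volume),
        -secondDeriv ⟨F, h₁⟩ + h₂.toLp = (μ : ℂ) • F := by
  constructor
  · rintro ⟨h, hF⟩
    refine ⟨h.1, h.2, ?_⟩
    have := LinearMap.mem_ker.mp hF
    rw [LinearMap.sub_apply, sub_eq_zero] at this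
    exact this
  · rintro ⟨h₁, h₂, h⟩
    refine ⟨⟨h₁, h₂⟩, ?_⟩
    refine LinearMap.mem_ker.mpr ?_
    rw [LinearMap.sub_apply, sub_eq_zero]
    exact h

/-- Symmetry of the second derivative is inherited from that of the free resolvent, without
integrating by parts. -/
theorem inner_secondDeriv_left (f g : sobolevH2) :
    inner ℂ (secondDeriv f) (g : L2) = inner ℂ (f : L2) (secondDeriv g) := by
  have hf := eq_freeResolvent_of_sobolevH2 one_pos f
  have hg := eq_freeResolvent_of_sobolevH2 one_pos g
  simp only [Complex.ofReal_one, one_pow, one_smul] at hf hg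
  have h : inner ℂ ((f : L2) - secondDeriv f) (g : L2)
      = inner ℂ (f : L2) ((g : L2) - secondDeriv g) := by
    conv_lhs => rw [hg]
    conv_rhs => rw [hf]
    rw [inner_freeResolvent_left]
  rw [inner_sub_left, inner_sub_right] at h
  exact sub_right_inj.mp h

theorem inner_toLp_mul_left {V : ℝ → ℝ} {f g : L2}
    (hf : MemLp (fun x ↦ (V x : ℂ) * f x) 2 volume)
    (hg : MemLp (fun x ↦ (V x : ℂ) * g x) 2 volume) :
    inner ℂ hf.toLp g = inner ℂ f hg.toLp := by
  rw [L2_inner_def, L2_inner_def]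
  refine integral_congr_ae ?_
  filter_upwards [hf.coeFn_toLp, hg.coeFn_toLp] with x h1 h2
  rw [h1, h2]
  simp only [RCLike.inner_apply, map_mul, Complex.conj_ofReal]
  ring

/-- Eigenfunctions for different eigenvalues are orthogonal. -/
theorem inner_eq_zero_of_ne {V : ℝ → ℝ} {μ ν : ℝ} (hμν : μ ≠ ν) {f g : sobolevH2}
    (hf : MemLp (fun x ↦ (V x : ℂ) * (f : L2) x) 2 volume)
    (hg : MemLp (fun x ↦ (V x : ℂ) * (g : L2) x) 2 volume)
    (hfe : -secondDeriv f + hf.toLp = (μ : ℂ) • (f : L2))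
    (hge : -secondDeriv g + hg.toLp = (ν : ℂ) • (g : L2)) :
    inner ℂ (f : L2) (g : L2) = 0 := by
  have h : inner ℂ (-secondDeriv f + hf.toLp) (g : L2)
      = inner ℂ (f : L2) (-secondDeriv g + hg.toLp) := by
    rw [inner_add_left, inner_add_right, inner_neg_left, inner_neg_right,
      inner_secondDeriv_left, inner_toLp_mul_left hf hg]
  rw [hfe, hge, inner_smul_left, inner_smul_right, Complex.conj_ofReal, ← sub_eq_zero,
    ← sub_mul] at h
  refine (mul_eq_zero.mp h).resolve_left ?_
  rw [sub_eq_zero]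
  exact_mod_cast hμν

/-- An eigenvalue of multiplicity at least `n` has `n` orthonormal eigenvectors. -/
theorem exists_orthonormal_of_le_multiplicity {H : L2 →ₗ.[ℂ] L2} {μ : ℝ} {n : ℕ}
    (hn : (n : ℕ∞) ≤ multiplicity H μ) :
    ∃ v : Fin n → L2, Orthonormal ℂ v ∧
      ∀ i, ∃ h : v i ∈ H.domain, (⟨v i, h⟩ : H.domain) ∈ eigenspace H μ := by
  have hn' : (n : Cardinal) ≤ Module.rank ℂ (eigenspace H μ) := by
    rw [multiplicity] at hn
    exact Cardinal.natCast_le_toENat.mp hn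
  let j : eigenspace H μ →ₗ[ℂ] L2 := H.domain.subtype ∘ₗ (eigenspace H μ).subtype
  have hj : Function.Injective j :=
    Subtype.val_injective.comp Subtype.val_injective
  obtain ⟨s, hs, hlin⟩ := le_rank_iff_exists_linearIndependent_finset.mp hn'
  have hlin' : LinearIndependent ℂ fun x : s ↦ j x :=
    hlin.map' j (LinearMap.ker_eq_bot.mpr hj)
  let S := Submodule.span ℂ (Set.range fun x : s ↦ j x)
  have hS : Module.finrank ℂ S = n := by
    rw [finrank_span_eq_card hlin', Fintype.card_coe, hs]
  have : FiniteDimensional ℂ S := FiniteDimensional.span_of_finite ℂ (Set.finite_range _)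
  let b := (stdOrthonormalBasis ℂ S).reindex (finCongr hS)
  refine ⟨fun i ↦ (b i : L2), b.orthonormal.comp_linearIsometry S.subtypeₗᵢ, fun i ↦ ?_⟩
  have hle : S ≤ LinearMap.range j := by
    rw [Submodule.span_le]
    rintro _ ⟨x, rfl⟩
    exact ⟨x, rfl⟩
  have hmem : ∀ w ∈ LinearMap.range j,
      ∃ h : w ∈ H.domain, (⟨w, h⟩ : H.domain) ∈ eigenspace H μ := by
    rintro _ ⟨y, rfl⟩
    exact ⟨y.1.2, y.2⟩
  exact hmem _ (hle (b i).2)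

/-- The sum over the negative eigenvalues is bounded by any bound that holds for all finite
orthonormal systems of eigenfunctions. -/
theorem negativeEigenvalueSum_le {V : ℝ → ℝ} {γ : ℝ} {X : ℝ≥0∞}
    (hX : ∀ (ι : Type) [Fintype ι] (f : ι → sobolevH2) (μ : ι → ℝ)
      (hVf : ∀ i, MemLp (fun x ↦ (V x : ℂ) * (f i : L2) x) 2 volume),
      (Orthonormal ℂ fun i ↦ (f i : L2)) → (∀ i, μ i < 0) →
      (∀ i, -secondDeriv (f i) + (hVf i).toLp = (μ i : ℂ) • (f i : L2)) →
      ∑ i, ENNReal.ofReal ((-μ i) ^ γ) ≤ X) :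
    negativeEigenvalueSum (schrodinger V) γ ≤ X := by
  -- The natural numbers n μ need only lie below the multiplicities: an infinite multiplicity is
  -- handled by letting n grow, which forces X = ⊤.
  have key : ∀ (s : Finset (Set.Iio (0 : ℝ))) (n : Set.Iio (0 : ℝ) → ℕ),
      (∀ μ ∈ s, (n μ : ℕ∞) ≤ multiplicity (schrodinger V) μ) →
      ∑ μ ∈ s, (n μ : ℝ≥0∞) * ENNReal.ofReal (|(μ : ℝ)| ^ γ) ≤ X := by
    intro s n hn
    choose v hv hvmem using fun μ : s ↦ exists_orthonormal_of_le_multiplicity (hn μ μ.2)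
    have hv' := fun (μ : s) i ↦ mem_eigenspace_schrodinger_iff.mp (hvmem μ i)
    choose h₁ h₂ h₃ using hv'
    have hon : Orthonormal ℂ fun p : (Σ μ : s, Fin (n μ)) ↦ v p.1 p.2 := by
      refine ⟨fun p ↦ (hv p.1).1 p.2, ?_⟩
      rintro ⟨μ, i⟩ ⟨ν, k⟩ hne
      rcases eq_or_ne μ ν with rfl | h
      · exact (hv μ).2 fun hik ↦ hne (congrArg (Sigma.mk μ) hik)
      · refine inner_eq_zero_of_ne (f := ⟨_, h₁ μ i⟩) (g := ⟨_, h₁ ν k⟩) ?_ (h₂ μ i) (h₂ ν k)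
          (h₃ μ i) (h₃ ν k)
        exact fun h' ↦ h (Subtype.ext (Subtype.ext h'))
    have := hX (Σ μ : s, Fin (n μ)) (fun p ↦ ⟨v p.1 p.2, h₁ p.1 p.2⟩) (fun p ↦ p.1)
      (fun p ↦ h₂ p.1 p.2) hon (fun p ↦ p.1.1.2) (fun p ↦ h₃ p.1 p.2)
    refine le_trans (le_of_eq ?_) this
    rw [Fintype.sum_sigma, ← Finset.sum_coe_sort s]
    refine Finset.sum_congr rfl fun μ _ ↦ ?_
    simp only [Finset.sum_const, Finset.card_univ, Fintype.card_fin, nsmul_eq_mul]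
    rw [abs_of_neg (Set.mem_Iio.mp μ.1.2)]
  rw [negativeEigenvalueSum, ENNReal.tsum_eq_iSup_sum]
  refine iSup_le fun s ↦ ?_
  by_cases htop : ∃ μ ∈ s, multiplicity (schrodinger V) (μ : ℝ) = ⊤
  · obtain ⟨μ, -, hμ⟩ := htop
    have hle : ∀ n : ℕ, (n : ℝ≥0∞) * ENNReal.ofReal (|(μ : ℝ)| ^ γ) ≤ X := fun n ↦ by
      simpa using key {μ} (fun _ ↦ n) (by simp [hμ])
    have hpos : ENNReal.ofReal (|(μ : ℝ)| ^ γ) ≠ 0 := by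
      have : 0 < |(μ : ℝ)| := abs_pos.mpr (Set.mem_Iio.mp μ.2).ne
      simpa using Real.rpow_pos_of_pos this γ
    have : (⊤ : ℝ≥0∞) ≤ X := by
      rw [← ENNReal.top_mul hpos, ← ENNReal.iSup_natCast, ENNReal.iSup_mul]
      exact iSup_le hle
    exact le_top.trans this
  · push Not at htop
    refine le_trans (le_of_eq ?_) (key s (fun μ ↦ (multiplicity (schrodinger V) μ).toNat)
      fun μ hμ ↦ (ENat.natCast_toNat (htop μ hμ)).le)
    refine Finset.sum_congr rfl fun μ hμ ↦ ?_
    congr 1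
    rw [← ENat.toENNReal_coe, ENat.natCast_toNat (htop μ hμ)]

theorem multiplicity_pos_of_eigenfunction {V : ℝ → ℝ} {μ : ℝ} (f : sobolevH2) (hf : (f : L2) ≠ 0)
    (hVf : MemLp (fun x ↦ (V x : ℂ) * (f : L2) x) 2 volume)
    (hev : -secondDeriv f + hVf.toLp = (μ : ℂ) • (f : L2)) :
    1 ≤ multiplicity (schrodinger V) μ := by
  obtain ⟨h, hmem⟩ := mem_eigenspace_schrodinger_iff.mpr ⟨f.2, hVf, hev⟩
  have hnt : Nontrivial (eigenspace (schrodinger V) μ) := by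
    refine ⟨⟨⟨⟨f, h⟩, hmem⟩, 0, fun h0 ↦ hf ?_⟩⟩
    exact congrArg (fun x : eigenspace (schrodinger V) μ ↦ (x.1 : L2)) h0
  rw [multiplicity, ← Nat.cast_one, Cardinal.natCast_le_toENat, Nat.cast_one,
    Cardinal.one_le_iff_pos]
  exact rank_pos

/-! ### From `γ = 3/2` to `γ ≥ 3/2` -/

theorem sum_sqrt_cube_le_of_fintype {ι : Type*} [Fintype ι] {W U₀ : ℝ → ℝ} (f : ι → sobolevH2)
    (hf : Orthonormal ℂ fun i ↦ (f i : L2))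
    (hWf : ∀ i, MemLp (fun x ↦ (W x : ℂ) * (f i : L2) x) 2 volume) {μ : ι → ℝ}
    (hneg : ∀ i, μ i < 0)
    (hev : ∀ i, -secondDeriv (f i) + (hWf i).toLp = (μ i : ℂ) • (f i : L2))
    (hU₀ : ∀ x, -W x ≤ U₀ x) (hU₀L : MemLp U₀ 2 volume) :
    16 / 3 * ∑ i, √(-μ i) ^ 3 ≤ ∫ x, U₀ x ^ 2 := by
  let e₀ := (Fintype.equivFin ι).symm
  let e : Fin (Fintype.card ι) ≃ ι := (Tuple.sort (μ ∘ e₀)).trans e₀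
  have hmono : Monotone (μ ∘ e) := Tuple.monotone_sort (μ ∘ e₀)
  have := sum_sqrt_cube_le (fun i ↦ f (e i)) (hf.comp e e.injective) (fun i ↦ hWf (e i)) hmono
    (fun i ↦ hneg (e i)) (fun i ↦ hev (e i)) hU₀ hU₀L
  rwa [← e.sum_comp fun i ↦ √(-μ i) ^ 3]

theorem exists_toLp_add_const {V : ℝ → ℝ} (t : ℝ) {F : L2}
    (hVF : MemLp (fun x ↦ (V x : ℂ) * F x) 2 volume) :
    ∃ h : MemLp (fun x ↦ ((V x + t : ℝ) : ℂ) * F x) 2 volume,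
      h.toLp = hVF.toLp + (t : ℂ) • F := by
  have h1 : MemLp (fun x ↦ (V x : ℂ) * F x + (t : ℂ) • F x) 2 volume :=
    hVF.add ((Lp.memLp F).const_smul (t : ℂ))
  have h2 : MemLp (fun x ↦ ((V x + t : ℝ) : ℂ) * F x) 2 volume := by
    refine h1.ae_eq (Eventually.of_forall fun x ↦ ?_)
    simp only [smul_eq_mul, Complex.ofReal_add, add_mul]
  refine ⟨h2, Lp.ext ?_⟩
  filter_upwards [h2.coeFn_toLp, hVF.coeFn_toLp, Lp.coeFn_add hVF.toLp ((t : ℂ) • F),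
    Lp.coeFn_smul (t : ℂ) F] with x e1 e2 e3 e4
  rw [e1, e3, Pi.add_apply, e2, e4, Pi.smul_apply, smul_eq_mul, Complex.ofReal_add, add_mul]

/-- The bound for `γ = 3/2` applied to `V + t`. -/
theorem sum_shifted_le {ι : Type*} [Fintype ι] {V : ℝ → ℝ} (hV : AEStronglyMeasurable V volume)
    (f : ι → sobolevH2) (hf : Orthonormal ℂ fun i ↦ (f i : L2))
    (hVf : ∀ i, MemLp (fun x ↦ (V x : ℂ) * (f i : L2) x) 2 volume) {μ : ι → ℝ}
    (hev : ∀ i, -secondDeriv (f i) + (hVf i).toLp = (μ i : ℂ) • (f i : L2)) (t : ℝ) :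
    ∑ i, ENNReal.ofReal (max (-μ i - t) 0 ^ (3 / 2 : ℝ)) ≤
      ENNReal.ofReal (3 / 16) * ∫⁻ x, ENNReal.ofReal (max (-V x - t) 0 ^ (2 : ℝ)) := by
  rcases eq_or_ne (∫⁻ x, ENNReal.ofReal (max (-V x - t) 0 ^ (2 : ℝ))) ⊤ with htop | htop
  · rw [htop, ENNReal.mul_top (by simp)]
    exact le_top
  set U₀ : ℝ → ℝ := fun x ↦ max (-V x - t) 0
  have hmeas : AEStronglyMeasurable U₀ volume :=
    (hV.neg.sub aestronglyMeasurable_const).sup aestronglyMeasurable_const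
  have hInt : Integrable (fun x ↦ U₀ x ^ (2 : ℝ)) volume := by
    refine ⟨by simpa only [Real.rpow_two] using! hmeas.pow 2, ?_⟩
    rw [hasFiniteIntegral_iff_ofReal (Eventually.of_forall fun x ↦ by positivity)]
    exact lt_top_iff_ne_top.mpr htop
  have hL : MemLp U₀ 2 volume := by
    rw [memLp_two_iff_integrable_sq hmeas]
    simpa using hInt
  -- The same functions are eigenfunctions for V + t with energies μᵢ + t; those no longer negative
  -- contribute zero to the left side.
  let κ := {i : ι // μ i + t < 0}
  choose h2 h3 using fun i : κ ↦ exists_toLp_add_const t (hVf i)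
  have hbound := sum_sqrt_cube_le_of_fintype (fun i : κ ↦ f i)
    (hf.comp Subtype.val Subtype.val_injective) h2 (μ := fun i ↦ μ i + t) (fun i ↦ i.2)
    (fun i ↦ by rw [h3, ← add_assoc, hev, Complex.ofReal_add, add_smul])
    (U₀ := U₀) (fun x ↦ by
      refine le_trans (le_of_eq ?_) (le_max_left _ _)
      ring) hL
  rw [← ofReal_integral_eq_lintegral_ofReal hInt (Eventually.of_forall fun x ↦ by positivity),
    ← ENNReal.ofReal_mul (by norm_num),
    ← ENNReal.ofReal_sum_of_nonneg fun i _ ↦ by positivity]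
  refine ENNReal.ofReal_le_ofReal ?_
  simp only [Real.rpow_two]
  have hsum : ∑ i, max (-μ i - t) 0 ^ (3 / 2 : ℝ) = ∑ i : κ, √(-(μ i + t)) ^ 3 := by
    rw [← Finset.sum_subtype (Finset.univ.filter fun i ↦ μ i + t < 0) (by simp)
      fun i ↦ √(-(μ i + t)) ^ 3, Finset.sum_filter]
    refine Finset.sum_congr rfl fun i _ ↦ ?_
    split_ifs with h
    · rw [max_eq_left (by linarith), Real.sqrt_eq_rpow, ← Real.rpow_natCast,
        ← Real.rpow_mul (by linarith)]
      congr 1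
      · ring
      · norm_num
    · rw [max_eq_right (by linarith), Real.zero_rpow (by norm_num)]
  rw [hsum]
  linarith

/-- Scaling t = m s reduces this to the Beta integral. It writes a power of m as a superposition of
lower powers of (m - t)₊, for use both with m = -μᵢ and with m = V(x)_-. -/
theorem lintegral_rpow_mul_rpow {a b m : ℝ} (ha : 0 < a) (hb : 1 < b) (hm : 0 ≤ m) :
    ∫⁻ t in Set.Ioi (0 : ℝ), ENNReal.ofReal (t ^ (a - 1)) * ENNReal.ofReal (max (m - t) 0 ^ (b - 1))
      = ENNReal.ofReal (ProbabilityTheory.beta a b) * ENNReal.ofReal (m ^ (a + b - 1)) := by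
  have hb0 : 0 < b := one_pos.trans hb
  have hbeta := ProbabilityTheory.beta_pos ha hb0
  have hsupp : ∫⁻ t in Set.Ioi (0 : ℝ),
      ENNReal.ofReal (t ^ (a - 1)) * ENNReal.ofReal (max (m - t) 0 ^ (b - 1)) =
      ∫⁻ t in Set.Ioo (0 : ℝ) m,
        ENNReal.ofReal (t ^ (a - 1)) * ENNReal.ofReal (max (m - t) 0 ^ (b - 1)) := by
    rw [← lintegral_indicator measurableSet_Ioi, ← lintegral_indicator measurableSet_Ioo]
    refine lintegral_congr fun t ↦ ?_
    by_cases h0 : 0 < t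
    · by_cases h1 : t < m
      · rw [Set.indicator_of_mem (Set.mem_Ioi.mpr h0),
          Set.indicator_of_mem (Set.mem_Ioo.mpr ⟨h0, h1⟩)]
      · rw [Set.indicator_of_mem (Set.mem_Ioi.mpr h0),
          Set.indicator_of_notMem fun h ↦ h1 (Set.mem_Ioo.mp h).2, max_eq_right (by linarith),
          Real.zero_rpow (by linarith), ENNReal.ofReal_zero, mul_zero]
    · rw [Set.indicator_of_notMem fun h ↦ h0 (Set.mem_Ioi.mp h),
        Set.indicator_of_notMem fun h ↦ h0 (Set.mem_Ioo.mp h).1]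
  rw [hsupp]
  rcases hm.eq_or_lt with rfl | hm
  · simp [Real.zero_rpow (show a + b - 1 ≠ 0 by linarith)]
  have himage : (fun s : ℝ ↦ m * s) '' Set.Ioo 0 1 = Set.Ioo 0 m := by
    rw [Set.image_mul_left_Ioo hm, mul_zero, mul_one]
  rw [← himage, lintegral_image_eq_lintegral_abs_deriv_mul (f := fun s : ℝ ↦ m * s)
    (f' := fun _ ↦ m) measurableSet_Ioo
    (fun s _ ↦ by simpa using ((hasDerivAt_id s).const_mul m).hasDerivWithinAt)
    (mul_right_injective₀ hm.ne').injOn]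
  have hone := ProbabilityTheory.lintegral_betaPDF_eq_one ha hb0
  rw [ProbabilityTheory.lintegral_betaPDF] at hone
  have hcongr : ∀ s ∈ Set.Ioo (0 : ℝ) 1,
      ENNReal.ofReal |m| * (ENNReal.ofReal ((m * s) ^ (a - 1)) *
        ENNReal.ofReal (max (m - m * s) 0 ^ (b - 1))) =
      ENNReal.ofReal (ProbabilityTheory.beta a b * m ^ (a + b - 1)) *
        ENNReal.ofReal (1 / ProbabilityTheory.beta a b * s ^ (a - 1) * (1 - s) ^ (b - 1)) := by
    intro s hs
    have h1 : 0 < 1 - s := by linarith [hs.2]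
    have h2 : m - m * s = m * (1 - s) := by ring
    rw [h2, max_eq_left (by positivity), abs_of_pos hm, Real.mul_rpow hm.le hs.1.le,
      Real.mul_rpow hm.le h1.le]
    have hs0 := hs.1
    rw [← ENNReal.ofReal_mul (by positivity), ← ENNReal.ofReal_mul (by positivity),
      ← ENNReal.ofReal_mul (by positivity)]
    congr 1
    have : m ^ (a + b - 1) = m * m ^ (a - 1) * m ^ (b - 1) := by
      rw [show a + b - 1 = 1 + (a - 1) + (b - 1) by ring, Real.rpow_add hm, Real.rpow_add hm,
        Real.rpow_one]
    rw [this]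
    field_simp
  rw [setLIntegral_congr_fun measurableSet_Ioo hcongr, lintegral_const_mul' _ _ (by simp), hone,
    mul_one, ENNReal.ofReal_mul hbeta.le]

theorem Gamma_five_halves : Real.Gamma (5 / 2) = 3 / 4 * √Real.pi := by
  rw [show (5 / 2 : ℝ) = 1 / 2 + 1 + 1 by norm_num, Real.Gamma_add_one (by norm_num),
    Real.Gamma_add_one (by norm_num), Real.Gamma_one_half_eq]
  ring

theorem Gamma_three : Real.Gamma 3 = 2 := by
  rw [show (3 : ℝ) = 2 + 1 by norm_num, Real.Gamma_add_one (by norm_num), Real.Gamma_two, mul_one]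

theorem four_pi_rpow : (4 * Real.pi) ^ (-((1 : ℕ) : ℝ) / 2) = 1 / (2 * √Real.pi) := by
  rw [show -((1 : ℕ) : ℝ) / 2 = -(1 / 2) by push_cast; ring, Real.rpow_neg (by positivity),
    ← Real.sqrt_eq_rpow, Real.sqrt_mul (by norm_num), show (4 : ℝ) = 2 ^ 2 by norm_num,
    Real.sqrt_sq (by norm_num), one_div]

/-- The left Beta factor arises from the eigenvalues (exponent 3/2), the right one from the
potential (exponent 2); hence lifting 3/16 gives exactly the semi-classical constant at γ. -/
theorem semiclassicalConstant_mul_beta {γ : ℝ} (hγ : 3 / 2 < γ) :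
    semiclassicalConstant γ 1 * ProbabilityTheory.beta (γ - 3 / 2) (5 / 2) =
      3 / 16 * ProbabilityTheory.beta (γ - 3 / 2) 3 := by
  have h1 := Real.Gamma_pos_of_pos (show 0 < γ + 1 by linarith)
  have h2 := Real.Gamma_pos_of_pos (show 0 < γ + 3 / 2 by linarith)
  have hpi : √Real.pi ≠ 0 := by positivity
  rw [semiclassicalConstant, four_pi_rpow, ProbabilityTheory.beta, ProbabilityTheory.beta,
    Gamma_five_halves, Gamma_three, show γ - 3 / 2 + 5 / 2 = γ + 1 by ring,
    show γ - 3 / 2 + 3 = γ + 3 / 2 by ring,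
    show γ + 1 + ((1 : ℕ) : ℝ) / 2 = γ + 3 / 2 by push_cast; ring]
  field_simp
  ring

theorem semiclassicalConstant_three_halves : semiclassicalConstant (3 / 2) 1 = 3 / 16 := by
  have hpi : √Real.pi ≠ 0 := by positivity
  rw [semiclassicalConstant, four_pi_rpow, show (3 / 2 + 1 : ℝ) = 5 / 2 by norm_num,
    show 5 / 2 + ((1 : ℕ) : ℝ) / 2 = 3 by norm_num, Gamma_five_halves, Gamma_three]
  field_simp
  ring

theorem semiclassicalConstant_pos {γ : ℝ} (hγ : 3 / 2 ≤ γ) : 0 < semiclassicalConstant γ 1 := by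
  rw [semiclassicalConstant]
  have h1 := Real.Gamma_pos_of_pos (show 0 < γ + 1 by linarith)
  have h2 := Real.Gamma_pos_of_pos (show 0 < γ + 1 + ((1 : ℕ) : ℝ) / 2 by push_cast; linarith)
  positivity

/-- Aizenman–Lieb lifting: integrate the bound for V + t against t^{γ-5/2} dt and exchange integrals
by Tonelli. At γ = 3/2 the weight is not integrable at 0, so that case is t = 0 directly. -/
theorem sum_rpow_le {ι : Type*} [Fintype ι] {V : ℝ → ℝ} (hV : AEStronglyMeasurable V volume)
    (f : ι → sobolevH2) (hf : Orthonormal ℂ fun i ↦ (f i : L2))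
    (hVf : ∀ i, MemLp (fun x ↦ (V x : ℂ) * (f i : L2) x) 2 volume) {μ : ι → ℝ}
    (hneg : ∀ i, μ i < 0)
    (hev : ∀ i, -secondDeriv (f i) + (hVf i).toLp = (μ i : ℂ) • (f i : L2)) {γ : ℝ}
    (hγ : 3 / 2 ≤ γ) :
    ∑ i, ENNReal.ofReal ((-μ i) ^ γ) ≤ ENNReal.ofReal (semiclassicalConstant γ 1) *
      ∫⁻ x, ENNReal.ofReal ((V x)⁻ ^ (γ + 1 / 2)) := by
  have hshift := sum_shifted_le hV f hf hVf hev
  rcases hγ.eq_or_lt with rfl | hγ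
  · refine le_trans (le_of_eq ?_) ((hshift 0).trans (le_of_eq ?_))
    · refine Finset.sum_congr rfl fun i _ ↦ ?_
      rw [sub_zero, max_eq_left (by linarith [hneg i])]
    · rw [semiclassicalConstant_three_halves]
      norm_num [negPart_def]
  set a := γ - 3 / 2 with ha
  have ha0 : 0 < a := by linarith
  set B₁ := ProbabilityTheory.beta a (5 / 2)
  set B₂ := ProbabilityTheory.beta a 3
  have hB₁ : 0 < B₁ := ProbabilityTheory.beta_pos ha0 (by norm_num)
  have hL : ENNReal.ofReal B₁ * ∑ i, ENNReal.ofReal ((-μ i) ^ γ) =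
      ∫⁻ t in Set.Ioi (0 : ℝ), ENNReal.ofReal (t ^ (a - 1)) *
        ∑ i, ENNReal.ofReal (max (-μ i - t) 0 ^ (3 / 2 : ℝ)) := by
    simp only [Finset.mul_sum]
    rw [lintegral_finsetSum _ fun i _ ↦ by fun_prop]
    refine Finset.sum_congr rfl fun i _ ↦ ?_
    have := lintegral_rpow_mul_rpow (b := 5 / 2) ha0 (by norm_num) (neg_pos.mpr (hneg i)).le
    rw [show (5 / 2 - 1 : ℝ) = 3 / 2 by norm_num, show a + 5 / 2 - 1 = γ by rw [ha]; ring] at this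
    exact this.symm
  have hR : ∫⁻ t in Set.Ioi (0 : ℝ), ENNReal.ofReal (t ^ (a - 1)) *
        ∫⁻ x, ENNReal.ofReal (max (-V x - t) 0 ^ (2 : ℝ)) =
      ENNReal.ofReal B₂ * ∫⁻ x, ENNReal.ofReal ((V x)⁻ ^ (γ + 1 / 2)) := by
    simp_rw [← lintegral_const_mul' _ _ ENNReal.ofReal_ne_top]
    rw [lintegral_lintegral_swap]
    · refine lintegral_congr fun x ↦ ?_
      have := lintegral_rpow_mul_rpow (b := 3) ha0 (by norm_num) (negPart_nonneg (V x))
      rw [show (3 - 1 : ℝ) = 2 by norm_num, show a + 3 - 1 = γ + 1 / 2 by rw [ha]; ring] at this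
      rw [← this]
      refine setLIntegral_congr_fun measurableSet_Ioi fun t ht ↦ ?_
      have ht0 : 0 < t := ht
      have : max (-V x - t) 0 = max ((V x)⁻ - t) 0 := by
        rw [negPart_def, ← max_sub_sub_right, max_assoc, max_eq_right (a := 0 - t) (by linarith)]
      simp only [this]
    · have hV' : AEMeasurable (fun p : ℝ × ℝ ↦ V p.2)
          ((volume.restrict (Set.Ioi 0)).prod volume) :=
        hV.aemeasurable.comp_quasiMeasurePreserving Measure.quasiMeasurePreserving_snd
      have h1 : AEMeasurable (fun p : ℝ × ℝ ↦ ENNReal.ofReal (max (-V p.2 - p.1) 0 ^ (2 : ℝ)))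
          ((volume.restrict (Set.Ioi 0)).prod volume) :=
        (((hV'.neg.sub measurable_fst.aemeasurable).max aemeasurable_const).pow_const
          _).ennreal_ofReal
      have h2 : AEMeasurable (fun p : ℝ × ℝ ↦ ENNReal.ofReal (p.1 ^ (a - 1)))
          ((volume.restrict (Set.Ioi 0)).prod volume) := Measurable.aemeasurable (by fun_prop)
      exact h2.mul h1
  have hB₁' : ENNReal.ofReal B₁ ≠ 0 := by simpa using hB₁
  refine (ENNReal.mul_le_mul_iff_right hB₁' ENNReal.ofReal_ne_top).mp ?_
  calc _ = _ := hL
    _ ≤ ∫⁻ t in Set.Ioi (0 : ℝ), ENNReal.ofReal (3 / 16) * (ENNReal.ofReal (t ^ (a - 1)) *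
        ∫⁻ x, ENNReal.ofReal (max (-V x - t) 0 ^ (2 : ℝ))) := by
      refine lintegral_mono fun t ↦ ?_
      rw [mul_left_comm]
      gcongr
      exact hshift t
    _ = _ := by
      rw [lintegral_const_mul' _ _ ENNReal.ofReal_ne_top, hR, ← mul_assoc, ← mul_assoc,
        ← ENNReal.ofReal_mul (by norm_num), ← ENNReal.ofReal_mul hB₁.le,
        ← semiclassicalConstant_mul_beta hγ, mul_comm B₁]

/-- The Lieb–Thirring inequality with the semi-classical constant. -/
theorem liebThirringInequality_semiclassicalConstant {γ : ℝ} (hγ : 3 / 2 ≤ γ) {V : ℝ → ℝ}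
    (hV : AEStronglyMeasurable V volume) :
    LiebThirringInequality γ (semiclassicalConstant γ 1) V :=
  negativeEigenvalueSum_le fun _ _ f _ hVf hf hneg hev ↦ sum_rpow_le hV f hf hVf hneg hev hγ

open Polynomial (X C derivative)

/-! ### Classical functions in `H²(ℝ)` -/

/-- Integration by parts against a Schwartz function has no boundary terms, since all products of L²
functions involved are integrable. -/
theorem lineDeriv_toLp {u u' : ℝ → ℂ} (hu : MemLp u 2 volume) (hu' : MemLp u' 2 volume)
    (hd : ∀ x, HasDerivAt u (u' x) x) :
    ∂_{(1 : ℝ)} ((hu.toLp : L2) : 𝓢'(ℝ, ℂ)) = ((hu'.toLp : L2) : 𝓢'(ℝ, ℂ)) := by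
  ext φ
  rw [TemperedDistribution.lineDerivOp_apply_apply, Lp.toTemperedDistribution_apply,
    Lp.toTemperedDistribution_apply]
  have hφ : ∀ y : ℝ, HasDerivAt φ ((∂_{(1 : ℝ)} φ : 𝓢(ℝ, ℂ)) y) y := by
    intro y
    have h := φ.hasDerivAt y
    rwa [SchwartzMap.lineDerivOp_apply, ← SchwartzMap.lineDerivOp_apply,
      SchwartzMap.lineDerivOp_apply_eq_fderiv, fderiv_apply_one_eq_deriv]
  have h1 : MemLp φ 2 (volume : Measure ℝ) := φ.memLp 2 volume
  have h2 : MemLp (∂_{(1 : ℝ)} φ : 𝓢(ℝ, ℂ)) 2 (volume : Measure ℝ) :=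
    SchwartzMap.memLp (∂_{(1 : ℝ)} φ : 𝓢(ℝ, ℂ)) 2 volume
  have hparts := integral_mul_deriv_eq_deriv_mul_of_integrable (fun x _ ↦ hφ x) (fun x _ ↦ hd x)
    (h1.integrable_mul hu') (h2.integrable_mul hu) (h1.integrable_mul hu)
  have e1 : ∫ x, φ x • (hu'.toLp : L2) x = ∫ x, φ x * u' x := by
    refine integral_congr_ae ?_
    filter_upwards [hu'.coeFn_toLp] with x hx
    rw [hx, smul_eq_mul]
  have e2 : ∫ x, (-∂_{(1 : ℝ)} φ : 𝓢(ℝ, ℂ)) x • (hu.toLp : L2) x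
      = -∫ x, (∂_{(1 : ℝ)} φ : 𝓢(ℝ, ℂ)) x * u x := by
    rw [← integral_neg]
    refine integral_congr_ae ?_
    filter_upwards [hu.coeFn_toLp] with x hx
    rw [hx, smul_eq_mul, neg_apply, neg_mul]
  rw [e1, e2, hparts]

/-- The Bessel symbol is 1 + ξ², whereas ∂² has symbol -(2πξ)²; this is why the Helmholtz identity
is taken at κ = 2π. -/
theorem besselPotential_two (f : 𝓢'(ℝ, ℂ)) :
    ((2 * Real.pi : ℂ) ^ 2) • TemperedDistribution.besselPotential ℝ ℂ 2 f =
      ((2 * Real.pi : ℂ) ^ 2) • f - ∂_{(1 : ℝ)} (∂_{(1 : ℝ)} f) := by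
  have h := distribution_helmholtz_eq (2 * Real.pi) f
  push_cast at h
  rw [h, TemperedDistribution.besselPotential, ← smul_apply,
    ← TemperedDistribution.fourierMultiplierCLM_smul (by fun_prop)]
  congr 2
  ext ξ
  simp
  ring

theorem exists_sobolevH2_of_hasDerivAt {u u' u'' : ℝ → ℂ} (hu : MemLp u 2 volume)
    (hu' : MemLp u' 2 volume) (hu'' : MemLp u'' 2 volume) (hd : ∀ x, HasDerivAt u (u' x) x)
    (hd' : ∀ x, HasDerivAt u' (u'' x) x) :
    ∃ h : hu.toLp ∈ sobolevH2, secondDeriv ⟨hu.toLp, h⟩ = hu''.toLp := by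
  have hdd : ∂_{(1 : ℝ)} (∂_{(1 : ℝ)} ((hu.toLp : L2) : 𝓢'(ℝ, ℂ)))
      = ((hu''.toLp : L2) : 𝓢'(ℝ, ℂ)) := by
    rw [lineDeriv_toLp hu hu' hd, lineDeriv_toLp hu' hu'' hd']
  have hpi : (2 * Real.pi : ℂ) ^ 2 ≠ 0 := by
    have := Real.pi_ne_zero
    simp [this]
  have hmem : hu.toLp ∈ sobolevH2 := by
    refine ⟨hu.toLp - (((2 * Real.pi : ℂ) ^ 2)⁻¹) • hu''.toLp, ?_⟩
    have h := besselPotential_two ((hu.toLp : L2) : 𝓢'(ℝ, ℂ))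
    rw [hdd] at h
    simp only [← Lp.toTemperedDistributionCLM_apply, map_sub, map_smul] at h ⊢
    rw [← inv_smul_smul₀ hpi (TemperedDistribution.besselPotential ℝ ℂ 2 _), h, smul_sub,
      inv_smul_smul₀ hpi]
  refine ⟨hmem, toTemperedDistribution_injective ?_⟩
  simp only
  rw [secondDeriv_spec, hdd]

/-! ### The Pöschl–Teller potential -/

/-- The function `sech^k p(tanh)`. -/
def solitonFn (k : ℕ) (p : Polynomial ℝ) (x : ℝ) : ℝ := (Real.cosh x)⁻¹ ^ k * p.eval (Real.tanh x)

theorem inv_cosh_sq (x : ℝ) : (Real.cosh x)⁻¹ ^ 2 = 1 - Real.tanh x ^ 2 := by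
  have h := (Real.cosh_pos x).ne'
  rw [Real.tanh_eq_sinh_div_cosh, div_pow, inv_pow]
  field_simp
  rw [Real.cosh_sq]
  ring

theorem hasDerivAt_tanh (x : ℝ) : HasDerivAt Real.tanh (1 - Real.tanh x ^ 2) x := by
  have h := (Real.cosh_pos x).ne'
  have h1 := (Real.hasDerivAt_sinh x).div (Real.hasDerivAt_cosh x) h
  have h2 : Real.tanh = fun y ↦ Real.sinh y / Real.cosh y :=
    funext Real.tanh_eq_sinh_div_cosh
  rw [h2]
  refine h1.congr_deriv ?_
  field_simp

theorem hasDerivAt_inv_cosh (x : ℝ) :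
    HasDerivAt (fun x ↦ (Real.cosh x)⁻¹) (-((Real.cosh x)⁻¹ * Real.tanh x)) x := by
  have h := (Real.cosh_pos x).ne'
  refine ((Real.hasDerivAt_cosh x).inv h).congr_deriv ?_
  rw [Real.tanh_eq_sinh_div_cosh]
  field_simp

/-- Differentiation preserves the form sech^k p(tanh) and acts on p by a first-order operator, so
the eigenvalue equation becomes a polynomial identity. -/
theorem hasDerivAt_solitonFn (k : ℕ) (p : Polynomial ℝ) (x : ℝ) :
    HasDerivAt (solitonFn k p)
      (solitonFn k ((1 - X ^ 2) * derivative p - C (k : ℝ) * X * p) x) x := by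
  have h1 := (hasDerivAt_inv_cosh x).pow k
  have h2 := (p.hasDerivAt (Real.tanh x)).comp x (hasDerivAt_tanh x)
  refine (h1.mul h2).congr_deriv ?_
  simp only [solitonFn, Polynomial.eval_sub, Polynomial.eval_mul, Polynomial.eval_one,
    Polynomial.eval_pow, Polynomial.eval_X, Polynomial.eval_C, Function.comp, Pi.pow_apply]
  rcases k with _ | k
  · simp
    ring
  · simp only [Nat.add_sub_cancel, pow_succ]
    ring

theorem memLp_solitonFn {k : ℕ} (hk : 1 ≤ k) (p : Polynomial ℝ) :
    MemLp (fun x ↦ (solitonFn k p x : ℂ)) 2 volume := by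
  obtain ⟨M, hM⟩ := (isCompact_Icc (a := (-1 : ℝ)) (b := 1)).exists_bound_of_continuousOn
    p.continuous.continuousOn
  have hcont : Continuous (solitonFn k p) :=
    continuous_iff_continuousAt.mpr fun x ↦ (hasDerivAt_solitonFn k p x).continuousAt
  refine MemLp.of_le_mul (c := 4 * M) (memLp_green one_pos)
    (Complex.continuous_ofReal.comp hcont).aestronglyMeasurable (Eventually.of_forall fun x ↦ ?_)
  rw [Complex.norm_real, Complex.norm_real, solitonFn, norm_mul, green]
  have h1 : ‖p.eval (Real.tanh x)‖ ≤ M :=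
    hM _ ⟨(Real.neg_one_lt_tanh x).le, (Real.tanh_lt_one x).le⟩
  have h2 : (Real.cosh x)⁻¹ ≤ 2 * Real.exp (-|x|) := by
    rw [inv_le_iff_one_le_mul₀ (Real.cosh_pos x), ← Real.cosh_abs, Real.cosh_eq, Real.exp_neg]
    have := Real.exp_pos |x|
    field_simp
    nlinarith
  have h3 : ‖(Real.cosh x)⁻¹ ^ k‖ ≤ 2 * Real.exp (-|x|) := by
    have h0 : 0 < (Real.cosh x)⁻¹ := inv_pos.mpr (Real.cosh_pos x)
    rw [Real.norm_of_nonneg (by positivity)]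
    refine (pow_le_of_le_one h0.le ?_ (by lia)).trans h2
    exact inv_le_one_of_one_le₀ (Real.one_le_cosh x)
  have h4 : 0 ≤ M := (norm_nonneg _).trans h1
  rw [Real.norm_of_nonneg (show 0 ≤ Real.exp (-1 * |x|) / (2 * 1) by positivity)]
  calc _ ≤ (2 * Real.exp (-|x|)) * M := by gcongr
    _ = _ := by simp; ring

/-- The polynomial `dⁿ/dXⁿ (X² - 1)^N`; for `n = N + k` it is, up to a factor, the `k`-th derivative
of a Legendre polynomial. -/
def rodrigues (N n : ℕ) : Polynomial ℝ := derivative^[n] ((X ^ 2 - 1) ^ N)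

theorem derivative_rodrigues (N n : ℕ) : derivative (rodrigues N n) = rodrigues N (n + 1) :=
  (Function.iterate_succ_apply' _ _ _).symm

/-- This is (X² - 1) u' = 2N X u for u = (X² - 1)^N, differentiated n + 1 times by Leibniz; the
induction step is one differentiation. -/
theorem rodrigues_ode (N n : ℕ) :
    (X ^ 2 - 1) * rodrigues N (n + 2) + C (2 * (n + 1) : ℝ) * X * rodrigues N (n + 1)
        + C ((n + 1) * n : ℝ) * rodrigues N n =
      C (2 * N : ℝ) * (X * rodrigues N (n + 1) + C (n + 1 : ℝ) * rodrigues N n) := by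
  induction n with
  | zero =>
    have h0 : (X ^ 2 - 1) * rodrigues N 1 = C (2 * N : ℝ) * (X * rodrigues N 0) := by
      rcases N with _ | N
      · simp [rodrigues]
      · simp only [rodrigues, Function.iterate_one, Function.iterate_zero, id_eq,
          Polynomial.derivative_pow, Nat.add_sub_cancel, Polynomial.derivative_sub,
          Polynomial.derivative_one, Polynomial.derivative_X]
        simp only [map_mul, map_natCast, pow_succ, Nat.cast_add, Nat.cast_one, map_add, map_one,
          map_ofNat, Nat.cast_ofNat]
        simp
        ring
    have h1 := congrArg derivative h0
    simp only [Polynomial.derivative_mul, derivative_rodrigues, Polynomial.derivative_sub,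
      Polynomial.derivative_one, Polynomial.derivative_X_pow, Polynomial.derivative_C,
      Polynomial.derivative_X] at h1
    simp only [map_mul, map_natCast, map_ofNat, map_add, map_one] at h1 ⊢
    push_cast at h1 ⊢
    linear_combination h1
  | succ n ih =>
    have h1 := congrArg derivative ih
    simp only [Polynomial.derivative_mul, derivative_rodrigues, Polynomial.derivative_sub,
      Polynomial.derivative_one, Polynomial.derivative_X_pow, Polynomial.derivative_C,
      Polynomial.derivative_X, Polynomial.derivative_add] at h1
    simp only [map_mul, map_natCast, map_ofNat, map_add, map_one] at h1 ⊢
    push_cast at h1 ⊢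
    linear_combination h1

theorem rodrigues_ne_zero {N n : ℕ} (hn : n ≤ 2 * N) : rodrigues N n ≠ 0 := by
  have hmonic : ((X ^ 2 - 1 : Polynomial ℝ) ^ N).Monic :=
    (Polynomial.monic_X_pow_sub_C (1 : ℝ) two_ne_zero).pow N
  have hdeg : ((X ^ 2 - 1 : Polynomial ℝ) ^ N).natDegree = 2 * N := by
    have := Polynomial.natDegree_X_pow_sub_C (n := 2) (r := (1 : ℝ))
    rw [Polynomial.natDegree_pow, ← map_one C, this, mul_comm]
  intro h
  have hc := congrArg (fun q ↦ q.coeff (2 * N - n)) h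
  simp only [rodrigues, Polynomial.coeff_iterate_derivative, Polynomial.coeff_zero,
    Nat.sub_add_cancel hn] at hc
  have hlead : ((X ^ 2 - 1 : Polynomial ℝ) ^ N).coeff (2 * N) = 1 := by
    rw [← hdeg]
    exact hmonic
  rw [hlead, nsmul_eq_mul, mul_one, Nat.cast_eq_zero, Nat.descFactorial_eq_zero_iff_lt] at hc
  lia

theorem solitonFn_ne_zero {k : ℕ} {p : Polynomial ℝ} (hp : p ≠ 0) : ∃ x, solitonFn k p x ≠ 0 := by
  by_contra! h
  refine hp (Polynomial.eq_zero_of_infinite_isRoot p ?_)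
  refine (Set.infinite_range_of_injective Real.tanh_injective).mono ?_
  rintro _ ⟨x, rfl⟩
  have := h x
  rw [solitonFn] at this
  refine (mul_eq_zero.mp this).resolve_left ?_
  have := Real.cosh_pos x
  positivity

/-- The Pöschl–Teller potential `-N(N + 1) sech²`. -/
def poschlTeller (N : ℕ) (x : ℝ) : ℝ := -(N * (N + 1) : ℝ) * (Real.cosh x)⁻¹ ^ 2

/-- With y = tanh x the eigenvalue equation is the associated Legendre equation, solved by (1 -
y²)^{k/2} times the k-th derivative of the N-th Legendre polynomial. That derivative is nonzero
exactly because k ≤ N. -/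
theorem one_le_multiplicity_poschlTeller {N k : ℕ} (hk : 1 ≤ k) (hkN : k ≤ N) :
    1 ≤ multiplicity (schrodinger (poschlTeller N)) (-(k : ℝ) ^ 2) := by
  set p := rodrigues N (N + k) with hp
  have hp0 : p ≠ 0 := rodrigues_ne_zero (by lia)
  let D : Polynomial ℝ → Polynomial ℝ := fun q ↦ (1 - X ^ 2) * derivative q - C (k : ℝ) * X * q
  have hode : D (D p) + C (N * (N + 1) : ℝ) * (1 - X ^ 2) * p = C ((k : ℝ) ^ 2) * p := by
    have h := rodrigues_ode N (N + k)
    rw [← derivative_rodrigues N (N + k + 1), ← derivative_rodrigues, ← hp] at h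
    simp only [D, Polynomial.derivative_mul, Polynomial.derivative_sub,
      Polynomial.derivative_one, Polynomial.derivative_X_pow, Polynomial.derivative_C,
      Polynomial.derivative_X]
    simp only [map_mul, map_natCast, map_ofNat, map_add, map_one, map_pow] at h ⊢
    push_cast at h ⊢
    linear_combination (X ^ 2 - 1) * h
  have hd : ∀ (q : Polynomial ℝ) (x : ℝ), HasDerivAt (fun x ↦ (solitonFn k q x : ℂ))
      (solitonFn k (D q) x : ℂ) x := fun q x ↦ (hasDerivAt_solitonFn k q x).ofReal_comp
  have hm := memLp_solitonFn hk
  obtain ⟨hmem, hsd⟩ := exists_sobolevH2_of_hasDerivAt (hm p) (hm (D p)) (hm (D (D p)))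
    (hd p) (hd (D p))
  have hVae : (fun x ↦ (poschlTeller N x : ℂ) * (hm p).toLp _ x) =ᵐ[volume]
      fun x ↦ (solitonFn k (-(C (N * (N + 1) : ℝ) * (1 - X ^ 2) * p)) x : ℂ) := by
    filter_upwards [(hm p).coeFn_toLp] with x hx
    rw [hx, ← Complex.ofReal_mul, poschlTeller, inv_cosh_sq]
    congr 1
    simp only [solitonFn, Polynomial.eval_neg, Polynomial.eval_mul, Polynomial.eval_C,
      Polynomial.eval_sub, Polynomial.eval_one, Polynomial.eval_pow, Polynomial.eval_X]
    ring
  have hVf : MemLp (fun x ↦ (poschlTeller N x : ℂ) * (hm p).toLp _ x) 2 volume :=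
    (memLp_congr_ae hVae).mpr (hm _)
  refine multiplicity_pos_of_eigenfunction ⟨_, hmem⟩ ?_ hVf ?_
  · intro h0
    obtain ⟨x, hx⟩ := solitonFn_ne_zero (k := k) hp0
    have hae : (fun x ↦ (solitonFn k p x : ℂ)) =ᵐ[volume] fun _ ↦ 0 :=
      (hm p).coeFn_toLp.symm.trans ((Lp.ext_iff.mp h0).trans (Lp.coeFn_zero ℂ 2 volume))
    have hcont : Continuous fun x ↦ (solitonFn k p x : ℂ) :=
      continuous_iff_continuousAt.mpr fun x ↦ (hd p x).continuousAt
    have := congrFun ((hcont.ae_eq_iff_eq volume continuous_const).mp hae) x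
    exact hx (by exact_mod_cast this)
  · rw [hsd]
    refine Lp.ext ?_
    have e1 := Lp.coeFn_add (-(hm (D (D p))).toLp) hVf.toLp
    have e2 := Lp.coeFn_neg (hm (D (D p))).toLp
    have e3 := Lp.coeFn_smul ((-(k : ℝ) ^ 2 : ℝ) : ℂ) (hm p).toLp
    filter_upwards [e1, e2, e3, (hm (D (D p))).coeFn_toLp, (hm p).coeFn_toLp, hVf.coeFn_toLp,
      hVae] with x h1 h2 h3 h4 h5 h6 h7
    rw [h1, h3, Pi.add_apply, h2, Pi.neg_apply, Pi.smul_apply, h4, h5, h6, h7, smul_eq_mul,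
      ← Complex.ofReal_neg, ← Complex.ofReal_add, ← Complex.ofReal_mul]
    congr 1
    have := congrArg (fun q ↦ (Real.cosh x)⁻¹ ^ k * q.eval (Real.tanh x)) hode
    simp only [solitonFn, Polynomial.eval_neg, Polynomial.eval_mul, Polynomial.eval_C,
      Polynomial.eval_add] at this ⊢
    linear_combination -this

/-! ### Sharpness -/

/-- The sum dominates ∫₀^N x^s dx. The induction step is Bernoulli's inequality for (N/(N+1))^{s+1}.
-/
theorem rpow_div_le_sum {s : ℝ} (hs : 0 ≤ s) (N : ℕ) :
    (N : ℝ) ^ (s + 1) / (s + 1) ≤ ∑ k ∈ Finset.range N, ((k : ℝ) + 1) ^ s := by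
  have hs1 : 0 < s + 1 := by linarith
  induction N with
  | zero => simp [Real.zero_rpow hs1.ne']
  | succ N ih =>
    rw [Finset.sum_range_succ]
    have hN : (0 : ℝ) < N + 1 := by positivity
    have hb := one_add_mul_self_le_rpow_one_add (s := -(1 / ((N : ℝ) + 1))) (p := s + 1)
      (by rw [neg_le_neg_iff, div_le_one hN]; linarith [(Nat.cast_nonneg N : (0 : ℝ) ≤ N)])
      (by linarith)
    have hfrac : 1 + -(1 / ((N : ℝ) + 1)) = N / (N + 1) := by field_simp; ring
    rw [hfrac, Real.div_rpow (Nat.cast_nonneg N) hN.le, le_div_iff₀ (by positivity)] at hb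
    have hpow : ((N : ℝ) + 1) ^ (s + 1) = (N + 1) ^ s * (N + 1) := by
      rw [Real.rpow_add hN, Real.rpow_one]
    have hexp : (1 + (s + 1) * -(1 / ((N : ℝ) + 1))) * ((N : ℝ) + 1) ^ (s + 1) =
        ((N : ℝ) + 1) ^ (s + 1) - (s + 1) * (N + 1) ^ s := by
      rw [hpow]
      field_simp
      ring
    rw [hexp] at hb
    rw [div_le_iff₀ hs1] at ih ⊢
    push_cast
    linarith

theorem sum_le_negativeEigenvalueSum_poschlTeller (N : ℕ) (γ : ℝ) :
    ENNReal.ofReal (∑ k ∈ Finset.range N, ((k : ℝ) + 1) ^ (2 * γ)) ≤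
      negativeEigenvalueSum (schrodinger (poschlTeller N)) γ := by
  let e : ℕ ↪ Set.Iio (0 : ℝ) := ⟨fun k ↦ ⟨-((k + 1 : ℕ) : ℝ) ^ 2, by
    have : (0 : ℝ) < ((k + 1 : ℕ) : ℝ) ^ 2 := by positivity
    simpa using this⟩, fun k l h ↦ by
      have h' := congrArg Subtype.val h
      simp only [neg_inj] at h'
      have := (pow_left_inj₀ (Nat.cast_nonneg _) (Nat.cast_nonneg _) two_ne_zero).mp h'
      exact Nat.succ_injective (Nat.cast_injective this)⟩
  refine le_trans ?_ (ENNReal.sum_le_tsum ((Finset.range N).map e))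
  rw [Finset.sum_map, ENNReal.ofReal_sum_of_nonneg fun k _ ↦ by positivity]
  refine Finset.sum_le_sum fun k hk ↦ ?_
  have hk' : k < N := Finset.mem_range.mp hk
  have hmult : 1 ≤ multiplicity (schrodinger (poschlTeller N)) (e k) :=
    one_le_multiplicity_poschlTeller (by lia) hk'
  have hmult' : (1 : ℝ≥0∞) ≤ (multiplicity (schrodinger (poschlTeller N)) (e k) : ℝ≥0∞) := by
    exact_mod_cast ENat.toENNReal_le.mpr hmult
  have habs : |((e k : Set.Iio (0 : ℝ)) : ℝ)| ^ γ = ((k : ℝ) + 1) ^ (2 * γ) := by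
    have : ((e k : Set.Iio (0 : ℝ)) : ℝ) = -((k : ℝ) + 1) ^ 2 := by simp [e]
    rw [this, abs_neg, abs_of_nonneg (by positivity), ← Real.rpow_two,
      ← Real.rpow_mul (by positivity)]
  rw [habs]
  exact le_mul_of_one_le_left' hmult'

/-- The substitution y = (1 + tanh x)/2 gives sech² x = 4y(1 - y) and turns the integral into a
multiple of B(a, a); Legendre duplication brings it to this form. -/
theorem lintegral_inv_cosh_rpow {a : ℝ} (ha : 0 < a) :
    ∫⁻ x : ℝ, ENNReal.ofReal (((Real.cosh x)⁻¹ ^ 2) ^ a) =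
      ENNReal.ofReal (√Real.pi * Real.Gamma a / Real.Gamma (a + 1 / 2)) := by
  have hone := ProbabilityTheory.lintegral_betaPDF_eq_one ha ha
  rw [ProbabilityTheory.lintegral_betaPDF] at hone
  have himage : (fun x : ℝ ↦ (1 + Real.tanh x) / 2) '' Set.univ = Set.Ioo 0 1 := by
    ext y
    simp only [Set.image_univ, Set.mem_range, Set.mem_Ioo]
    constructor
    · rintro ⟨x, rfl⟩
      constructor <;> linarith [Real.neg_one_lt_tanh x, Real.tanh_lt_one x]
    · rintro ⟨h0, h1⟩
      refine ⟨Real.artanh (2 * y - 1), ?_⟩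
      rw [Real.tanh_artanh ⟨by linarith, by linarith⟩]
      ring
  have hG1 := Real.Gamma_pos_of_pos ha
  have hG2 := Real.Gamma_pos_of_pos (show 0 < a + 1 / 2 by linarith)
  have hG3 := Real.Gamma_pos_of_pos (show 0 < a + a by linarith)
  have hdup := Real.Gamma_mul_Gamma_add_half a
  set B := ProbabilityTheory.beta a a with hB
  have hB0 : 0 < B := ProbabilityTheory.beta_pos ha ha
  rw [← himage, lintegral_image_eq_lintegral_abs_deriv_mul MeasurableSet.univ
    (fun x _ ↦ (((hasDerivAt_tanh x).const_add 1).div_const 2).hasDerivWithinAt)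
    (fun x _ y _ h ↦ Real.tanh_injective (by linarith [show (1 + Real.tanh x) / 2
      = (1 + Real.tanh y) / 2 from h])), Measure.restrict_univ] at hone
  have hC : √Real.pi * Real.Gamma a / Real.Gamma (a + 1 / 2) = B * (4 ^ a / 2) := by
    have h4 : (4 : ℝ) ^ a * 2 ^ (1 - 2 * a) = 2 := by
      rw [show (4 : ℝ) = 2 ^ (2 : ℝ) by norm_num, ← Real.rpow_mul (by norm_num),
        ← Real.rpow_add (by norm_num)]
      norm_num
    rw [hB, ProbabilityTheory.beta, div_eq_iff hG2.ne']
    rw [← two_mul] at hG3 ⊢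
    generalize Real.Gamma (a + 1 / 2) = G at hdup ⊢
    field_simp
    linear_combination (-(4 : ℝ) ^ a) * hdup - Real.Gamma (2 * a) * √Real.pi * h4
  have hcongr : ∀ x : ℝ, ENNReal.ofReal (((Real.cosh x)⁻¹ ^ 2) ^ a) =
      ENNReal.ofReal (B * (4 ^ a / 2)) * (ENNReal.ofReal |(1 - Real.tanh x ^ 2) / 2| *
        ENNReal.ofReal (1 / B * ((1 + Real.tanh x) / 2) ^ (a - 1) *
          (1 - (1 + Real.tanh x) / 2) ^ (a - 1))) := by
    intro x
    have h1 : 0 < 1 + Real.tanh x := by linarith [Real.neg_one_lt_tanh x]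
    have h2 : 0 < 1 - Real.tanh x := by linarith [Real.tanh_lt_one x]
    have h3 : 1 - Real.tanh x ^ 2 = (1 + Real.tanh x) * (1 - Real.tanh x) := by ring
    have h4 : 1 - (1 + Real.tanh x) / 2 = (1 - Real.tanh x) / 2 := by ring
    rw [inv_cosh_sq, h3, h4, abs_of_pos (by positivity), ← ENNReal.ofReal_mul (by positivity),
      ← ENNReal.ofReal_mul (by positivity)]
    congr 1
    have h5 : ∀ y : ℝ, 0 < y → (y / 2) ^ (a - 1) = y ^ a / y / (2 ^ a / 2) := fun y hy ↦ by
      rw [Real.div_rpow hy.le (by norm_num), Real.rpow_sub_one hy.ne',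
        Real.rpow_sub_one (by norm_num)]
    rw [h5 _ h1, h5 _ h2, Real.mul_rpow h1.le h2.le, show (4 : ℝ) = 2 * 2 by norm_num,
      Real.mul_rpow (by norm_num) (by norm_num)]
    have h6 : (0 : ℝ) < 2 ^ a := by positivity
    field_simp
  rw [lintegral_congr hcongr, lintegral_const_mul' _ _ ENNReal.ofReal_ne_top, hone, mul_one, hC]

theorem negPart_poschlTeller (N : ℕ) (x : ℝ) :
    (poschlTeller N x)⁻ = (N * (N + 1) : ℝ) * (Real.cosh x)⁻¹ ^ 2 := by
  have : 0 ≤ (N * (N + 1) : ℝ) * (Real.cosh x)⁻¹ ^ 2 := by positivity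
  rw [poschlTeller, neg_mul, negPart_neg, posPart_eq_self.mpr this]

theorem lintegral_negPart_poschlTeller (N : ℕ) {a : ℝ} (ha : 0 < a) :
    ∫⁻ x, ENNReal.ofReal ((poschlTeller N x)⁻ ^ a) =
      ENNReal.ofReal ((N * (N + 1) : ℝ) ^ a *
        (√Real.pi * Real.Gamma a / Real.Gamma (a + 1 / 2))) := by
  rw [ENNReal.ofReal_mul (by positivity), ← lintegral_inv_cosh_rpow ha,
    ← lintegral_const_mul' _ _ ENNReal.ofReal_ne_top]
  refine lintegral_congr fun x ↦ ?_
  rw [negPart_poschlTeller, Real.mul_rpow (by positivity) (by positivity),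
    ENNReal.ofReal_mul (by positivity)]

theorem continuous_poschlTeller (N : ℕ) : Continuous (poschlTeller N) :=
  continuous_const.mul ((Real.continuous_cosh.inv₀ fun x ↦ (Real.cosh_pos x).ne').pow 2)

theorem memLp_poschlTeller (N : ℕ) {a : ℝ} (ha : 0 < a) :
    MemLp (poschlTeller N) (ENNReal.ofReal a) volume := by
  have hcont := continuous_poschlTeller N
  rw [← integrable_norm_rpow_iff hcont.aestronglyMeasurable (by simpa using ha) (by simp),
    ENNReal.toReal_ofReal ha.le]
  refine ⟨(hcont.norm.rpow_const fun x ↦ Or.inr ha.le).aestronglyMeasurable, ?_⟩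
  rw [hasFiniteIntegral_iff_ofReal (Eventually.of_forall fun x ↦ by positivity)]
  have : ∀ x, ‖poschlTeller N x‖ = (poschlTeller N x)⁻ := fun x ↦ by
    rw [negPart_poschlTeller, poschlTeller, neg_mul, norm_neg, Real.norm_of_nonneg (by positivity)]
  simp only [this]
  rw [lintegral_negPart_poschlTeller N ha]
  exact ENNReal.ofReal_lt_top

theorem tendsto_poschlTeller (N : ℕ) : Tendsto (poschlTeller N) (cocompact ℝ) (𝓝 0) := by
  have h : Tendsto Real.cosh (cocompact ℝ) atTop := by
    refine tendsto_atTop_mono (fun x ↦ ?_) (tendsto_norm_cocompact_atTop (E := ℝ))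
    rw [← Real.cosh_abs, Real.norm_eq_abs, Real.cosh_eq]
    have h1 := Real.quadratic_le_exp_of_nonneg (abs_nonneg x)
    have h2 := Real.exp_pos (-|x|)
    nlinarith [sq_nonneg (|x| - 1)]
  have := (h.inv_tendsto_atTop.pow 2).const_mul (-(N * (N + 1) : ℝ))
  rw [zero_pow two_ne_zero, mul_zero] at this
  exact this

/-- The right side is the leading coefficient of ∑ k^{2γ} relative to N^{2γ+1}; the second factor on
the left is ∫ sech^{2γ+1}. Equality says that the Pöschl–Teller family saturates the bound
asymptotically. -/
theorem semiclassicalConstant_eq {γ : ℝ} (hγ : 3 / 2 ≤ γ) :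
    semiclassicalConstant γ 1 * (√Real.pi * Real.Gamma (γ + 1 / 2) / Real.Gamma (γ + 1))
      = 1 / (2 * γ + 1) := by
  have h1 := Real.Gamma_pos_of_pos (show 0 < γ + 1 by linarith)
  have h2 := Real.Gamma_pos_of_pos (show 0 < γ + 1 / 2 by linarith)
  have hpi : √Real.pi ≠ 0 := by positivity
  rw [semiclassicalConstant, four_pi_rpow,
    show γ + 1 + ((1 : ℕ) : ℝ) / 2 = γ + 1 / 2 + 1 by push_cast; ring,
    Real.Gamma_add_one (show γ + 1 / 2 ≠ 0 by linarith)]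
  have h3 : γ + 1 / 2 ≠ 0 := by linarith
  have h4 : 2 * γ + 1 ≠ 0 := by linarith
  field_simp

/-- The semi-classical constant is optimal. -/
theorem semiclassicalConstant_le {γ : ℝ} (hγ : 3 / 2 ≤ γ) {L : ℝ}
    (hL : ∀ N : ℕ, LiebThirringInequality γ L (poschlTeller N)) :
    semiclassicalConstant γ 1 ≤ L := by
  have ha : 0 < γ + 1 / 2 := by linarith
  set K := √Real.pi * Real.Gamma (γ + 1 / 2) / Real.Gamma (γ + 1) with hK
  have hK0 : 0 < K := by
    have h1 := Real.Gamma_pos_of_pos (show 0 < γ + 1 by linarith)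
    have h2 := Real.Gamma_pos_of_pos ha
    have := Real.pi_pos
    positivity
  have hbound : ∀ N : ℕ, 1 ≤ N →
      1 / (2 * γ + 1) ≤ max L 0 * K * (1 + 1 / (N : ℝ)) ^ (γ + 1 / 2) := by
    intro N hN
    have hN0 : (0 : ℝ) < N := by exact_mod_cast hN
    have h := (sum_le_negativeEigenvalueSum_poschlTeller N γ).trans (hL N)
    -- `ENNReal.ofReal` truncates negative L to 0, so the limit first bounds max L 0; positivity of
    -- the semi-classical constant then excludes 0.
    have h0 : ENNReal.ofReal L = ENNReal.ofReal (max L 0) := by simp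
    rw [lintegral_negPart_poschlTeller N ha, show γ + 1 / 2 + 1 / 2 = γ + 1 by ring, ← hK, h0,
      ← ENNReal.ofReal_mul (le_max_right _ _), ENNReal.ofReal_le_ofReal_iff (by positivity)] at h
    have h2 := (rpow_div_le_sum (show 0 ≤ 2 * γ by linarith) N).trans h
    have h3 : ((N : ℝ) * (N + 1)) ^ (γ + 1 / 2)
        = (N : ℝ) ^ (2 * γ + 1) * (1 + 1 / (N : ℝ)) ^ (γ + 1 / 2) := by
      have : (N : ℝ) * (N + 1) = (N : ℝ) ^ (2 : ℝ) * (1 + 1 / (N : ℝ)) := by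
        rw [Real.rpow_two]; field_simp
      rw [this, Real.mul_rpow (by positivity) (by positivity), ← Real.rpow_mul hN0.le]
      congr 2
      ring
    rw [h3] at h2
    have hp : (0 : ℝ) < (N : ℝ) ^ (2 * γ + 1) := by positivity
    refine le_of_mul_le_mul_left ?_ hp
    rw [mul_one_div]
    exact h2.trans (le_of_eq (by ring))
  have hlim : Tendsto (fun N : ℕ ↦ max L 0 * K * (1 + 1 / (N : ℝ)) ^ (γ + 1 / 2)) atTop
      (𝓝 (max L 0 * K * (1 + 0) ^ (γ + 1 / 2))) :=
    ((tendsto_one_div_atTop_nhds_zero_nat.const_add 1).rpow_const (Or.inr ha.le)).const_mul _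
  have hle := ge_of_tendsto hlim (eventually_atTop.mpr ⟨1, hbound⟩)
  rw [add_zero, Real.one_rpow, mul_one, ← semiclassicalConstant_eq hγ, ← hK] at hle
  have hle' := le_of_mul_le_mul_right hle hK0
  rcases le_max_iff.mp hle' with h | h
  · exact h
  · exact absurd (semiclassicalConstant_pos hγ) (not_lt.mpr h)

end LiebThirring
end

/-! ### The inequality together with its optimality -/

theorem mainTheorem6 (γ : ℝ) (hγ : 3 / 2 ≤ γ) :
    (∀ (p : ℝ≥0∞) (V : ℝ → ℝ), 2 ≤ p → MemLp V p volume →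
      LiebThirring.LiebThirringInequality γ (LiebThirring.semiclassicalConstant γ 1) V) ∧
    (∀ L : ℝ,
      (∀ V : ℝ → ℝ, MemLp V (ENNReal.ofReal (γ + 1 / 2)) volume →
        Tendsto V (cocompact ℝ) (𝓝 0) →
        LiebThirring.LiebThirringInequality γ L V) →
      LiebThirring.semiclassicalConstant γ 1 ≤ L) := by
  refine ⟨fun p V _ hV ↦ LiebThirring.liebThirringInequality_semiclassicalConstant hγ
    hV.aestronglyMeasurable, fun L hL ↦ LiebThirring.semiclassicalConstant_le hγ fun N ↦ ?_⟩
  exact hL _ (LiebThirring.memLp_poschlTeller N (by linarith)) (LiebThirring.tendsto_poschlTeller N)
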